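/- **Digraphs.** A digraph has no loops and at most one edge from $x$ to $y$ for each ordered pair $(x,y)$ of vertices (both $xy$ and $yx$ may be present). For a digraph $G$, $x\in V(G)$ and $X\subseteq V(G)$ let $d^+_X(x)$ and $d^-_X(x)$ be the numbers of out- and inneighbours of $x$ in $X$; a condition on $d^\pm_X(x)$ means that it holds for both $d^+_X(x)$ and $d^-_X(x)$. Let $\delta^0(G)$ be the minimum of all out- and indegrees of $G$. For disjoint $A,B\subseteq V(G)$ let $G[A,B]$ be the digraph with vertex set $A\cup B$ whose edges are the edges of $G$ from $A$ to $B$ and from $B$ to $A$. **$AB$-extremality.** Let $\varepsilon>0$. A digraph $G$ on $n$ vertices is *$AB$-extremal with parameter $\varepsilon$* if $V(G)$ has a partition into (possibly empty) sets $A,B,S,T$ of sizes $a,b,s,t$ such that 1. $a\le b$ and $s\le t$; 2. $\lfloor n/2\rfloor-\varepsilon n\le a,b\le\lceil n/2\rceil+\varepsilon n$; 3. $\delta^0(G[A,B])\ge n/50$; 4. $d^\pm_B(x)\ge n/2-\varepsilon n$ for all but at most $\varepsilon n$ vertices $x\in A$; 5. $d^\pm_A(x)\ge n/2-\varepsilon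 n$ for all but at most $\varepsilon n$ vertices $x\in B$; 6. $s+t\le\varepsilon n$; 7. $d^-_A(x),d^+_B(x)\ge n/50$ for all $x\in S$; 8. $d^-_B(x),d^+_A(x)\ge n/50$ for all $x\in T$; 9. if $a<b$, then $d^\pm_B(x)<n/20$ for all $x\in B$, $d^-_B(x)<n/20$ for all $x\in S$, and $d^+_B(x)<n/20$ for all $x\in T$. **Statement.** There is $\varepsilon_0>0$ such that for every $\varepsilon$ with $0<\varepsilon\le\varepsilon_0$ there is an integer $n_0=n_0(\varepsilon)$ such that the following holds for all $n\ge n_0$. Let $G$ be a digraph on $n$ vertices with $\delta^0(G)\ge n/2$ that is $AB$-extremal with parameter $\varepsilon$, and let $C$ be any orientation of a cycle on $n$ vertices which is not antidirected (that is, $C$ contains a consistently oriented path of length two: distinct vertices $x,y,z$ with $xy,yz\in E(C)$). Then $G$ contains a copy of $C$, that is, a subdigraph isomorphic to $C$. -/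

import Mathlib

noncomputable section

namespace Digraph

variable {V W : Type*}

/-- No loops. Mathlib's `Digraph` already forbids parallel edges in the same direction and allows
both `xy` and `yx`, so a loopless `Digraph` is a digraph in the usual sense. -/
def Loopless (G : Digraph V) : Prop :=
  ∀ x, ¬ G.Adj x x

open Classical in
/-- `d⁺_X(x)`: the number of outneighbours of `x` in `X`. -/
def outDegreeIn (G : Digraph V) (X : Finset V) (x : V) : ℕ :=
  (X.filter fun y => G.Adj x y).card

open Classical in
/-- `d⁻_X(x)`: the number of inneighbours of `x` in `X`. -/
def inDegreeIn (G : Digraph V) (X : Finset V) (x : V) : ℕ :=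
  (X.filter fun y => G.Adj y x).card

/-- The outdegree `d⁺(x)`. -/
def outDegree [Fintype V] (G : Digraph V) (x : V) : ℕ :=
  G.outDegreeIn Finset.univ x

/-- The indegree `d⁻(x)`. -/
def inDegree [Fintype V] (G : Digraph V) (x : V) : ℕ :=
  G.inDegreeIn Finset.univ x

/-- The minimum semidegree `δ⁰(G) = min {d⁺(x), d⁻(x) : x ∈ V(G)}` (which is `0` for the digraph
without vertices). -/
def minSemidegree [Fintype V] (G : Digraph V) : ℕ :=
  ⨅ x : V, min (G.outDegree x) (G.inDegree x)

open Classical in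
/-- `G[A,B]`: the digraph with vertex set `A ∪ B` whose edges are the edges of `G` from `A` to `B`
and those from `B` to `A`. -/
def between (G : Digraph V) (A B : Finset V) : Digraph {x : V // x ∈ A ∪ B} where
  Adj x y := G.Adj x y ∧ ((x.1 ∈ A ∧ y.1 ∈ B) ∨ (x.1 ∈ B ∧ y.1 ∈ A))

open Classical in
/-- The partition `A, B, S, T` of the vertex set witnesses that `G` is `AB`-extremal with
parameter `ε`. The classes of the partition are allowed to be empty. -/
structure IsABPartition [Fintype V] (G : Digraph V) (ε : ℝ) (A B S T : Finset V) : Prop where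
  cover : A ∪ B ∪ S ∪ T = Finset.univ
  disjoint_AB : Disjoint A B
  disjoint_AS : Disjoint A S
  disjoint_AT : Disjoint A T
  disjoint_BS : Disjoint B S
  disjoint_BT : Disjoint B T
  disjoint_ST : Disjoint S T
  card_A_le_card_B : A.card ≤ B.card
  card_S_le_card_T : S.card ≤ T.card
  card_A_lower : (⌊(Fintype.card V : ℝ) / 2⌋ : ℝ) - ε * Fintype.card V ≤ A.card
  card_A_upper : (A.card : ℝ) ≤ (⌈(Fintype.card V : ℝ) / 2⌉ : ℝ) + ε * Fintype.card V
  card_B_lower : (⌊(Fintype.card V : ℝ) / 2⌋ : ℝ) - ε * Fintype.card V ≤ B.card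
  card_B_upper : (B.card : ℝ) ≤ (⌈(Fintype.card V : ℝ) / 2⌉ : ℝ) + ε * Fintype.card V
  minSemidegree_between : (Fintype.card V : ℝ) / 50 ≤ (G.between A B).minSemidegree
  almost_all_A :
    ((A.filter fun x =>
        ¬ ((Fintype.card V : ℝ) / 2 - ε * Fintype.card V ≤ G.outDegreeIn B x ∧
           (Fintype.card V : ℝ) / 2 - ε * Fintype.card V ≤ G.inDegreeIn B x)).card : ℝ)
      ≤ ε * Fintype.card V
  almost_all_B :
    ((B.filter fun x =>
        ¬ ((Fintype.card V : ℝ) / 2 - ε * Fintype.card V ≤ G.outDegreeIn A x ∧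
           (Fintype.card V : ℝ) / 2 - ε * Fintype.card V ≤ G.inDegreeIn A x)).card : ℝ)
      ≤ ε * Fintype.card V
  card_S_add_card_T : ((S.card + T.card : ℕ) : ℝ) ≤ ε * Fintype.card V
  degree_S : ∀ x ∈ S, (Fintype.card V : ℝ) / 50 ≤ G.inDegreeIn A x ∧
    (Fintype.card V : ℝ) / 50 ≤ G.outDegreeIn B x
  degree_T : ∀ x ∈ T, (Fintype.card V : ℝ) / 50 ≤ G.inDegreeIn B x ∧
    (Fintype.card V : ℝ) / 50 ≤ G.outDegreeIn A x
  unbalanced : A.card < B.card →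
    (∀ x ∈ B, (G.outDegreeIn B x : ℝ) < (Fintype.card V : ℝ) / 20 ∧
      (G.inDegreeIn B x : ℝ) < (Fintype.card V : ℝ) / 20) ∧
    (∀ x ∈ S, (G.inDegreeIn B x : ℝ) < (Fintype.card V : ℝ) / 20) ∧
    (∀ x ∈ T, (G.outDegreeIn B x : ℝ) < (Fintype.card V : ℝ) / 20)

/-- `G` is `AB`-extremal with parameter `ε`. -/
def IsABExtremal [Fintype V] (G : Digraph V) (ε : ℝ) : Prop :=
  ∃ A B S T : Finset V, G.IsABPartition ε A B S T

/-- `C` is an orientation of a cycle on `n ≥ 3` vertices: no two vertices are joined in both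
directions, and the underlying simple graph is a cycle on `n` vertices. -/
structure IsOrientedCycle (C : Digraph W) (n : ℕ) : Prop where
  three_le : 3 ≤ n
  asymm : ∀ u v, C.Adj u v → ¬ C.Adj v u
  iso : Nonempty (C.toSimpleGraphInclusive ≃g SimpleGraph.cycleGraph n)

/-- `C` contains no consistently oriented path of length two. -/
def IsAntidirected (C : Digraph W) : Prop :=
  ¬ ∃ x y z : W, x ≠ y ∧ y ≠ z ∧ x ≠ z ∧ C.Adj x y ∧ C.Adj y z

/-- `G` contains a copy of `C`, as a not necessarily induced subdigraph. -/
def ContainsCopy (G : Digraph V) (C : Digraph W) : Prop :=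
  ∃ f : W → V, Function.Injective f ∧ ∀ u v, C.Adj u v → G.Adj (f u) (f v)

end Digraph

end

/-! Number the positions of the cycle by `ZMod n`, let `e i` be the direction of the edge between
positions `i` and `i + 1`, and give every position a role, `A` (`true`) or `B` (`false`). Nearly all
edges between `A` and `B` are present in both directions, so a stretch of alternating roles embeds
whatever its orientation is. What has to be dealt with is a bounded proportion of exceptional
vertices, the vertices of `S ∪ T`, the difference `|A| - |B|`, and the parity of `n`.

These are handled by few "items", single vertices or edges of `G`, put at well separated positions.
An item may be a flip: the roles fail to alternate after it. Going round the cycle, the number of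
flips must have the parity of `n`. Each item has an integer charge, and once the items cover `S ∪ T`
and their charges add up to `|A| - |B|`, the free positions of each role are as many as the unused
vertices of that class (`exists_embedding_of_items`). The rest is routine
(`IsCore.exists_embedding`): insert the bad vertices of `A ∪ B`, surround everything placed by good
vertices, and fill the positions of role `A` and then those of role `B` by Hall's theorem.

Call a position a turn if it is a source or a sink of the cycle, and a through position otherwise. A
vertex of `S` has many inneighbours in `A` and many outneighbours in `B`. Hence at a turn it
replaces a vertex of `A` (source) or `B` (sink) without a flip, with charge `-1` or `1`; at a
through position it is a flip of charge `0`. For `T` the classes are exchanged. An edge inside `B`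
is a flip of charge `-1`. Such edges, or edges from `T` to `B`, come from the semidegree condition,
in disjoint form from the low degrees inside `B` when `|A| < |B|` (`Frame.exists_disjoint_edges`).

If there are many through positions (`exists_embedding_of_many`), all vertices of `S ∪ T` outside
the chosen edges become through vertices, `|B| - |A|` disjoint edges supply the charge, and the
parity is automatic. If there are few (`exists_embedding_of_few`), nearly all positions are turns.
Vertices at turns realise every total charge of the right parity in a range, but `S` and `T` use
different "worlds" of turns, told apart by whether the role equals `e i`. One flip at a suitable
place makes both worlds large (`exists_special_position`). For odd `n` that flip is an edge from `B
∪ T` to `B ∪ S`; for even `n` a vertex of `T` at a through position provides a second flip, which is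
where the assumption that the cycle is not antidirected enters. The remaining case `|S| = |T| = 1`,
`|A| = |B|` with an edge from `T` to `S` is settled by placing that edge without any flip. -/

namespace Digraph

/-! ### Greedy and Hall-type selection lemmas. -/

section Choice

variable {α β V : Type*}

/-- A system of distinct representatives for large sets. -/
theorem exists_injOn_mem_of_card_le [Nonempty β] (s : Finset α) (t : α → Finset β)
    (h : ∀ a ∈ s, s.card ≤ (t a).card) :
    ∃ f : α → β, Set.InjOn f s ∧ ∀ a ∈ s, f a ∈ t a := by
  classical
  induction s using Finset.induction_on with
  | empty => exact ⟨fun _ => Classical.arbitrary β, by simp, by simp⟩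
  | insert a s ha ih =>
    rw [Finset.card_insert_of_notMem ha] at h
    obtain ⟨f, hf, hft⟩ := ih fun b hb => by
      have := h b (Finset.mem_insert_of_mem hb)
      omega
    have hlt : (s.image f).card < (t a).card := by
      have h1 := h a (Finset.mem_insert_self a s)
      have h2 := Finset.card_image_le (s := s) (f := f)
      omega
    obtain ⟨b, hb, hbs⟩ := Finset.exists_mem_notMem_of_card_lt_card hlt
    have hne : ∀ x ∈ s, x ≠ a := fun x hx h => ha (h ▸ hx)
    refine ⟨Function.update f a b, ?_, ?_⟩
    · intro x hx y hy hxy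
      simp only [Finset.coe_insert, Set.mem_insert_iff, Finset.mem_coe] at hx hy
      rcases hx with rfl | hx <;> rcases hy with rfl | hy
      · rfl
      · rw [Function.update_self, Function.update_of_ne (hne y hy)] at hxy
        exact (hbs (hxy ▸ Finset.mem_image_of_mem f hy)).elim
      · rw [Function.update_self, Function.update_of_ne (hne x hx)] at hxy
        exact (hbs (hxy ▸ Finset.mem_image_of_mem f hx)).elim
      · rw [Function.update_of_ne (hne x hx), Function.update_of_ne (hne y hy)] at hxy
        exact hf hx hy hxy
    · intro x hx
      rcases Finset.mem_insert.1 hx with rfl | hx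
      · rwa [Function.update_self]
      · rw [Function.update_of_ne (hne x hx)]
        exact hft x hx

open Classical in
/-- A balanced bipartite relation in which every element fails to be related to at most half of
the other side has a perfect matching. -/
theorem exists_injOn_rel_of_card_not_rel_le [Nonempty β] (P : Finset α) (Y : Finset β)
    (R : α → β → Prop) (k : ℕ) (hPY : P.card = Y.card) (hk : 2 * k ≤ Y.card)
    (hP : ∀ p ∈ P, (Y.filter fun y => ¬ R p y).card ≤ k)
    (hY : ∀ y ∈ Y, (P.filter fun p => ¬ R p y).card ≤ k) :
    ∃ f : α → β, Set.InjOn f P ∧ ∀ p ∈ P, f p ∈ Y ∧ R p (f p) := by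
  let t : P → Finset β := fun p => Y.filter fun y => R p y
  have hall : ∀ s : Finset P, s.card ≤ (s.biUnion t).card := by
    intro s
    rcases s.eq_empty_or_nonempty with rfl | ⟨p, hp⟩
    · simp
    have hsP : s.card ≤ P.card := by simpa using Finset.card_le_univ s
    -- Hall's condition: a small set is served by the neighbourhood of one element, of size at least
    -- `|Y| - k`; a set larger than `|Y| - k ≥ k` meets the neighbourhood of every `y`.
    by_cases hs : s.card + k ≤ Y.card
    · have h1 : (t p).card ≤ (s.biUnion t).card :=
        Finset.card_le_card (Finset.subset_biUnion_of_mem t hp)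
      have h2 := Finset.card_filter_add_card_filter_not (s := Y) (fun y => R p y)
      have h3 := hP p p.2
      have h4 : (Y.filter fun y => R p y).card = (t p).card := rfl
      omega
    · have hY' : Y ⊆ s.biUnion t := by
        intro y hy
        by_contra hcon
        have hsub : s.image (fun q : P => (q : α)) ⊆ P.filter fun p => ¬ R p y := by
          intro x hx
          obtain ⟨q, hq, rfl⟩ := Finset.mem_image.1 hx
          refine Finset.mem_filter.2 ⟨q.2, fun hR => hcon ?_⟩
          exact Finset.mem_biUnion.2 ⟨q, hq, Finset.mem_filter.2 ⟨hy, hR⟩⟩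
        have h1 := Finset.card_le_card hsub
        rw [Finset.card_image_of_injective _ Subtype.val_injective] at h1
        have := hY y hy
        omega
      have := Finset.card_le_card hY'
      omega
  obtain ⟨f, hf, hft⟩ := (Finset.all_card_le_biUnion_card_iff_exists_injective t).1 hall
  refine ⟨fun p => if h : p ∈ P then f ⟨p, h⟩ else Classical.arbitrary β, ?_, ?_⟩
  · intro x hx y hy hxy
    have hx' : x ∈ P := hx
    have hy' : y ∈ P := hy
    simp only [hx', hy', dif_pos] at hxy
    simpa using hf hxy
  · intro p hp
    simp only [hp, dif_pos]
    exact Finset.mem_filter.1 (hft ⟨p, hp⟩)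

/-- Two cyclic positions at distance at least six. -/
def Far {n : ℕ} (p q : ZMod n) : Prop :=
  ∀ t : ℕ, t ≤ 5 → p ≠ q + t ∧ q ≠ p + t

theorem Far.symm {n : ℕ} {p q : ZMod n} (h : Far p q) : Far q p :=
  fun t ht => ⟨(h t ht).2, (h t ht).1⟩

open Classical in
theorem card_filter_not_far_le {n : ℕ} [NeZero n] (q : ZMod n) :
    (Finset.univ.filter fun p : ZMod n => ¬ Far p q).card ≤ 12 := by
  have hsub : (Finset.univ.filter fun p : ZMod n => ¬ Far p q) ⊆
      (Finset.range 6).image (fun t : ℕ => q + t) ∪ (Finset.range 6).image (fun t : ℕ => q - t) := by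
    intro p hp
    simp only [Far, Finset.mem_filter, Finset.mem_univ, true_and, not_forall] at hp
    obtain ⟨t, ht, hpt⟩ := hp
    have ht' : t < 6 := by omega
    by_cases h : p = q + t
    · exact Finset.mem_union_left _ (Finset.mem_image.2 ⟨t, Finset.mem_range.2 ht', h.symm⟩)
    · have : q = p + t := by
        by_contra h'
        exact hpt ⟨h, h'⟩
      refine Finset.mem_union_right _ (Finset.mem_image.2 ⟨t, Finset.mem_range.2 ht', ?_⟩)
      simp [this]
  have h1 := Finset.card_le_card hsub
  have h2 := Finset.card_union_le ((Finset.range 6).image (fun t : ℕ => q + (t : ZMod n)))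
    ((Finset.range 6).image (fun t : ℕ => q - (t : ZMod n)))
  have h3 := Finset.card_image_le (s := Finset.range 6) (f := fun t : ℕ => q + (t : ZMod n))
  have h4 := Finset.card_image_le (s := Finset.range 6) (f := fun t : ℕ => q - (t : ZMod n))
  simp only [Finset.card_range] at h3 h4
  omega

open Classical in
/-- Choosing pairwise far positions from large candidate sets. -/
theorem exists_far {n : ℕ} [NeZero n] (s : Finset α) (cand : α → Finset (ZMod n))
    (X : Finset (ZMod n)) (h : ∀ a ∈ s, 12 * (X.card + s.card) ≤ (cand a).card) :
    ∃ π : α → ZMod n, (∀ a ∈ s, π a ∈ cand a) ∧ (∀ a ∈ s, ∀ q ∈ X, Far (π a) q) ∧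
      ∀ a ∈ s, ∀ b ∈ s, a ≠ b → Far (π a) (π b) := by
  induction s using Finset.induction_on generalizing X with
  | empty => exact ⟨fun _ => 0, by simp, by simp, by simp⟩
  | insert a s ha ih =>
    rw [Finset.card_insert_of_notMem ha] at h
    have hlt : (X.biUnion fun q => Finset.univ.filter fun p : ZMod n => ¬ Far p q).card
        < (cand a).card := by
      have h1 := h a (Finset.mem_insert_self a s)
      have h2 : (X.biUnion fun q => Finset.univ.filter fun p : ZMod n => ¬ Far p q).card
          ≤ X.card * 12 :=
        Finset.card_biUnion_le_card_mul _ _ _ fun q _ => card_filter_not_far_le q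
      omega
    obtain ⟨p, hp, hpX⟩ := Finset.exists_mem_notMem_of_card_lt_card hlt
    have hpfar : ∀ q ∈ X, Far p q := by
      intro q hq
      by_contra hcon
      exact hpX (Finset.mem_biUnion.2 ⟨q, hq, by simpa using hcon⟩)
    -- The chosen position joins the forbidden set while `s` loses an element, so the sum of the two
    -- sizes does not grow.
    obtain ⟨π, h1, h2, h3⟩ := ih (insert p X) fun b hb => by
      have := h b (Finset.mem_insert_of_mem hb)
      have := Finset.card_insert_le p X
      omega
    have hne : ∀ x ∈ s, x ≠ a := fun x hx h => ha (h ▸ hx)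
    refine ⟨Function.update π a p, ?_, ?_, ?_⟩
    · intro x hx
      rcases Finset.mem_insert.1 hx with rfl | hx
      · rwa [Function.update_self]
      · rw [Function.update_of_ne (hne x hx)]
        exact h1 x hx
    · intro x hx q hq
      rcases Finset.mem_insert.1 hx with rfl | hx
      · rw [Function.update_self]
        exact hpfar q hq
      · rw [Function.update_of_ne (hne x hx)]
        exact h2 x hx q (Finset.mem_insert_of_mem hq)
    · intro x hx y hy hxy
      rcases Finset.mem_insert.1 hx with hxa | hx' <;> rcases Finset.mem_insert.1 hy with hya | hy'
      · exact (hxy (hxa.trans hya.symm)).elim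
      · rw [hxa, Function.update_self, Function.update_of_ne (hne y hy')]
        exact (h2 y hy' p (Finset.mem_insert_self p X)).symm
      · rw [hya, Function.update_self, Function.update_of_ne (hne x hx')]
        exact h2 x hx' p (Finset.mem_insert_self p X)
      · rw [Function.update_of_ne (hne x hx'), Function.update_of_ne (hne y hy')]
        exact h3 x hx' y hy' hxy

open Classical in
/-- The greedy bound for matchings in a digraph with bounded degrees. -/
theorem exists_disjoint_pairs (E : Finset (V × V)) (Δ m : ℕ)
    (hΔ : ∀ r ∈ E, (E.filter fun p => p.1 = r.1 ∨ p.2 = r.1).card ≤ Δ ∧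
      (E.filter fun p => p.1 = r.2 ∨ p.2 = r.2).card ≤ Δ)
    (hm : ∀ j < m, 2 * Δ * j < E.card) :
    ∃ M ⊆ E, M.card = m ∧ ∀ p ∈ M, ∀ q ∈ M, p ≠ q →
      p.1 ≠ q.1 ∧ p.1 ≠ q.2 ∧ p.2 ≠ q.1 ∧ p.2 ≠ q.2 := by
  induction m with
  | zero => exact ⟨∅, by simp, by simp, by simp⟩
  | succ m ih =>
    obtain ⟨M, hME, hMm, hM⟩ := ih fun j hj => hm j (by omega)
    have hlt : (M.biUnion fun r => (E.filter fun p => p.1 = r.1 ∨ p.2 = r.1) ∪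
        (E.filter fun p => p.1 = r.2 ∨ p.2 = r.2)).card < E.card := by
      refine lt_of_le_of_lt (Finset.card_biUnion_le_card_mul _ _ (2 * Δ) fun r hr => ?_) ?_
      · have h1 := Finset.card_union_le (E.filter fun p => p.1 = r.1 ∨ p.2 = r.1)
          (E.filter fun p => p.1 = r.2 ∨ p.2 = r.2)
        have h2 := hΔ r (hME hr)
        omega
      · rw [hMm, mul_comm]
        exact hm m (by omega)
    obtain ⟨r, hr, hrM⟩ := Finset.exists_mem_notMem_of_card_lt_card hlt
    have hdis : ∀ q ∈ M, r.1 ≠ q.1 ∧ r.1 ≠ q.2 ∧ r.2 ≠ q.1 ∧ r.2 ≠ q.2 := by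
      intro q hq
      have : r ∉ (E.filter fun p => p.1 = q.1 ∨ p.2 = q.1) ∪
        (E.filter fun p => p.1 = q.2 ∨ p.2 = q.2) :=
        fun h => hrM (Finset.mem_biUnion.2 ⟨q, hq, h⟩)
      simp only [Finset.mem_union, Finset.mem_filter, hr, true_and, not_or] at this
      tauto
    have hrM' : r ∉ M := fun h => (hdis r h).1 rfl
    refine ⟨insert r M, Finset.insert_subset hr hME, ?_, ?_⟩
    · rw [Finset.card_insert_of_notMem hrM', hMm]
    · intro p hp q hq hpq
      rcases Finset.mem_insert.1 hp with hpr | hp' <;> rcases Finset.mem_insert.1 hq with hqr | hq'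
      · exact (hpq (hpr.trans hqr.symm)).elim
      · rw [hpr]
        exact hdis q hq'
      · have := hdis p hp'
        rw [hqr]
        exact ⟨this.1.symm, this.2.2.1.symm, this.2.1.symm, this.2.2.2.symm⟩
      · exact hM p hp' q hq' hpq

end Choice

/-! ### Partial embeddings of the cycle and their completion on independent positions. -/

noncomputable section Placement

open scoped Classical

variable {V : Type*} {n k : ℕ} {G : Digraph V} {e ρ : ZMod n → Bool}
  {R : Finset (ZMod n × V)}

/-- An edge of `G` between `x` and `y`, from `x` to `y` if `b` holds and from `y` to `x` if not. -/
def Arc (G : Digraph V) (b : Bool) (x y : V) : Prop :=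
  if b then G.Adj x y else G.Adj y x

theorem arc_not {b : Bool} {x y : V} : G.Arc (!b) x y ↔ G.Arc b y x := by
  cases b <;> simp [Arc]

/-- The class with role `b`: `A` for `true` and `B` for `false`. -/
def cls (A B : Finset V) (b : Bool) : Finset V :=
  if b then A else B

/-- The positions which a partial placement occupies. -/
def dom (R : Finset (ZMod n × V)) : Finset (ZMod n) :=
  R.image Prod.fst

/-- The vertices which a partial placement uses. -/
def ran (R : Finset (ZMod n × V)) : Finset V :=
  R.image Prod.snd

theorem mem_dom {i : ZMod n} : i ∈ dom R ↔ ∃ x, (i, x) ∈ R := by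
  simp [dom]

theorem mem_ran {x : V} : x ∈ ran R ↔ ∃ i, (i, x) ∈ R := by
  simp [ran]

/-- `R` is a partial embedding into `G` of the cycle with orientation `e`. -/
structure IsPlacement (G : Digraph V) (e : ZMod n → Bool) (R : Finset (ZMod n × V)) : Prop where
  fst_inj : ∀ r ∈ R, ∀ r' ∈ R, r.1 = r'.1 → r = r'
  snd_inj : ∀ r ∈ R, ∀ r' ∈ R, r.2 = r'.2 → r = r'
  arc : ∀ i x y, (i, x) ∈ R → (i + 1, y) ∈ R → G.Arc (e i) x y

theorem IsPlacement.card_dom (h : IsPlacement G e R) : (dom R).card = R.card :=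
  Finset.card_image_of_injOn fun r hr r' hr' => h.fst_inj r hr r' hr'

theorem IsPlacement.card_ran (h : IsPlacement G e R) : (ran R).card = R.card :=
  Finset.card_image_of_injOn fun r hr r' hr' => h.snd_inj r hr r' hr'

/-- The positions in `P` are occupied according to `f`. -/
def occupy (R : Finset (ZMod n × V)) (P : Finset (ZMod n)) (f : ZMod n → V) :
    Finset (ZMod n × V) :=
  R ∪ P.image fun p => (p, f p)

theorem mem_occupy {P : Finset (ZMod n)} {f : ZMod n → V} {r : ZMod n × V} :
    r ∈ occupy R P f ↔ r ∈ R ∨ (r.1 ∈ P ∧ r.2 = f r.1) := by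
  rcases r with ⟨i, x⟩
  simp only [occupy, Finset.mem_union, Finset.mem_image, Prod.mk.injEq]
  constructor
  · rintro (h | ⟨p, hp, rfl, rfl⟩)
    · exact Or.inl h
    · exact Or.inr ⟨hp, rfl⟩
  · rintro (h | ⟨h1, h2⟩)
    · exact Or.inl h
    · exact Or.inr ⟨i, h1, rfl, h2.symm⟩

theorem mem_dom_occupy {P : Finset (ZMod n)} {f : ZMod n → V} {i : ZMod n} :
    i ∈ dom (occupy R P f) ↔ i ∈ dom R ∨ i ∈ P := by
  simp only [mem_dom, mem_occupy, exists_or, exists_and_left, exists_eq, and_true]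

theorem mem_ran_occupy {P : Finset (ZMod n)} {f : ZMod n → V} {x : V} :
    x ∈ ran (occupy R P f) ↔ x ∈ ran R ∨ ∃ p ∈ P, f p = x := by
  simp only [mem_ran, mem_occupy, exists_or, eq_comm]

/-- As no two positions of `P` are consecutive, every new arc has its other end in `R`, and the two
arc hypotheses are the only adjacencies to check. -/
theorem IsPlacement.extend (h : IsPlacement G e R) {P : Finset (ZMod n)} {f : ZMod n → V}
    (hP : ∀ p ∈ P, p ∉ dom R) (hf : Set.InjOn f P) (hfR : ∀ p ∈ P, f p ∉ ran R)
    (hcons : ∀ p ∈ P, p + 1 ∉ P)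
    (hr : ∀ p ∈ P, ∀ y, (p + 1, y) ∈ R → G.Arc (e p) (f p) y)
    (hl : ∀ i y, i + 1 ∈ P → (i, y) ∈ R → G.Arc (e i) y (f (i + 1))) :
    IsPlacement G e (occupy R P f) := by
  refine ⟨?_, ?_, ?_⟩
  · rintro ⟨i, x⟩ hr ⟨j, y⟩ hr' (hij : i = j)
    subst hij
    rw [mem_occupy] at hr hr'
    rcases hr with hr | hr <;> rcases hr' with hr' | hr'
    · exact h.fst_inj _ hr _ hr' rfl
    · exact (hP _ hr'.1 (mem_dom.2 ⟨x, hr⟩)).elim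
    · exact (hP _ hr.1 (mem_dom.2 ⟨y, hr'⟩)).elim
    · exact Prod.ext rfl (hr.2.trans hr'.2.symm)
  · rintro ⟨i, x⟩ hr ⟨j, y⟩ hr' (hxy : x = y)
    subst hxy
    rw [mem_occupy] at hr hr'
    rcases hr with hr | hr <;> rcases hr' with hr' | hr'
    · exact h.snd_inj _ hr _ hr' rfl
    · exact (hfR _ hr'.1 (hr'.2 ▸ mem_ran.2 ⟨i, hr⟩)).elim
    · exact (hfR _ hr.1 (hr.2 ▸ mem_ran.2 ⟨j, hr'⟩)).elim
    · exact Prod.ext (hf hr.1 hr'.1 (hr.2.symm.trans hr'.2)) rfl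
  · intro i x y hx hy
    rw [mem_occupy] at hx hy
    rcases hx with hx | ⟨hx1, hx2⟩ <;> rcases hy with hy | ⟨hy1, hy2⟩
    · exact h.arc i x y hx hy
    · simp only at hy1 hy2
      rw [hy2]
      exact hl i x hy1 hx
    · simp only at hx1 hx2
      rw [hx2]
      exact hr i hx1 y hy
    · exact (hcons i hx1 hy1).elim

/-- Each vertex of `W` sits on at most one position. With `c = ±1` this bounds the positions which a
few bad neighbours can spoil. -/
theorem IsPlacement.card_filter_fst_le [NeZero n] (h : IsPlacement G e R) (W : Finset V)
    (c : ZMod n) (P : Finset (ZMod n)) :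
    (P.filter fun p => ∃ x ∈ W, (p + c, x) ∈ R).card ≤ W.card := by
  have h1 : (P.filter fun p => ∃ x ∈ W, (p + c, x) ∈ R) ⊆
      (R.filter fun r => r.2 ∈ W).image fun r => r.1 - c := by
    intro p hp
    obtain ⟨-, x, hx, hpx⟩ := Finset.mem_filter.1 hp
    exact Finset.mem_image.2 ⟨(p + c, x), Finset.mem_filter.2 ⟨hpx, hx⟩, by simp⟩
  refine (Finset.card_le_card h1).trans (Finset.card_image_le.trans ?_)
  refine Finset.card_le_card_of_injOn Prod.snd (fun r hr => (Finset.mem_filter.1 hr).2) ?_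
  intro r hr r' hr' hrr
  exact h.snd_inj r (Finset.mem_filter.1 hr).1 r' (Finset.mem_filter.1 hr').1 hrr

/-- If the neighbours of the positions in `P` are occupied by vertices of `W` and the edges between
`Y` and `W` are nearly complete, then `Y` can be placed on `P`. -/
theorem IsPlacement.fill [NeZero n] [Nonempty V] (h : IsPlacement G e R) (P : Finset (ZMod n))
    (Y W : Finset V) (hPY : P.card = Y.card) (hP : ∀ p ∈ P, p ∉ dom R)
    (hY : ∀ y ∈ Y, y ∉ ran R) (hcons : ∀ p ∈ P, p + 1 ∉ P)
    (hWr : ∀ p ∈ P, ∀ x, (p + 1, x) ∈ R → x ∈ W)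
    (hWl : ∀ i x, i + 1 ∈ P → (i, x) ∈ R → x ∈ W)
    (hYW : ∀ y ∈ Y, ∀ b, (W.filter fun w => ¬ G.Arc b y w).card ≤ k)
    (hWY : ∀ w ∈ W, ∀ b, (Y.filter fun y => ¬ G.Arc b w y).card ≤ k)
    (hk : 8 * k ≤ Y.card) :
    ∃ f : ZMod n → V, IsPlacement G e (occupy R P f) ∧ Set.InjOn f P ∧
      ∀ p ∈ P, f p ∈ Y := by
  have hWl' : ∀ p ∈ P, ∀ x, (p - 1, x) ∈ R → x ∈ W := fun p hp x hx =>
    hWl (p - 1) x (by simpa using hp) hx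
  have hrow : ∀ p ∈ P, (Y.filter fun y => ¬ ((∀ x, (p + 1, x) ∈ R → G.Arc (e p) y x) ∧
      ∀ x, (p - 1, x) ∈ R → G.Arc (e (p - 1)) x y)).card ≤ 4 * k := by
    intro p hp
    have h1 : (Y.filter fun y => ¬ ∀ x, (p + 1, x) ∈ R → G.Arc (e p) y x).card ≤ k := by
      by_cases hx : ∃ x, (p + 1, x) ∈ R
      · obtain ⟨x, hx⟩ := hx
        refine (Finset.card_le_card ?_).trans (hWY x (hWr p hp x hx) (!e p))
        intro y hy
        rw [Finset.mem_filter] at hy ⊢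
        refine ⟨hy.1, fun hA => hy.2 fun x' hx' => ?_⟩
        have := congrArg Prod.snd (h.fst_inj _ hx _ hx' rfl)
        simp only at this
        rw [← this]
        exact arc_not.1 hA
      · rw [Finset.filter_false_of_mem]
        · simp
        · intro y _ hy
          exact hy fun x hx' => (hx ⟨x, hx'⟩).elim
    have h2 : (Y.filter fun y => ¬ ∀ x, (p - 1, x) ∈ R → G.Arc (e (p - 1)) x y).card ≤ k := by
      by_cases hx : ∃ x, (p - 1, x) ∈ R
      · obtain ⟨x, hx⟩ := hx
        refine (Finset.card_le_card ?_).trans (hWY x (hWl' p hp x hx) (e (p - 1)))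
        intro y hy
        rw [Finset.mem_filter] at hy ⊢
        refine ⟨hy.1, fun hA => hy.2 fun x' hx' => ?_⟩
        have := congrArg Prod.snd (h.fst_inj _ hx _ hx' rfl)
        simp only at this
        rw [← this]
        exact hA
      · rw [Finset.filter_false_of_mem]
        · simp
        · intro y _ hy
          exact hy fun x hx' => (hx ⟨x, hx'⟩).elim
    have h3 := Finset.card_union_le (Y.filter fun y => ¬ ∀ x, (p + 1, x) ∈ R → G.Arc (e p) y x)
      (Y.filter fun y => ¬ ∀ x, (p - 1, x) ∈ R → G.Arc (e (p - 1)) x y)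
    refine (Finset.card_le_card ?_).trans (h3.trans (by omega))
    intro y hy
    rw [Finset.mem_filter] at hy
    rw [Finset.mem_union, Finset.mem_filter, Finset.mem_filter]
    by_contra hcon
    push Not at hcon
    exact hy.2 ⟨hcon.1 hy.1, hcon.2 hy.1⟩
  have hcol : ∀ y ∈ Y, (P.filter fun p => ¬ ((∀ x, (p + 1, x) ∈ R → G.Arc (e p) y x) ∧
      ∀ x, (p - 1, x) ∈ R → G.Arc (e (p - 1)) x y)).card ≤ 4 * k := by
    intro y hy
    -- The direction needed depends on the position, so vertices missing in either direction are
    -- discarded: at most `2 * k` of them, each spoiling one position on each side.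
    let Wb := (W.filter fun w => ¬ G.Arc true y w) ∪ (W.filter fun w => ¬ G.Arc false y w)
    have hWb : Wb.card ≤ 2 * k := by
      have h1 := hYW y hy true
      have h2 := hYW y hy false
      have h3 := Finset.card_union_le (W.filter fun w => ¬ G.Arc true y w)
        (W.filter fun w => ¬ G.Arc false y w)
      exact h3.trans (by omega)
    have hmem : ∀ x ∈ W, ∀ b, ¬ G.Arc b y x → x ∈ Wb := by
      intro x hx b hb
      cases b
      · exact Finset.mem_union_right _ (Finset.mem_filter.2 ⟨hx, hb⟩)
      · exact Finset.mem_union_left _ (Finset.mem_filter.2 ⟨hx, hb⟩)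
    have h1 := h.card_filter_fst_le Wb 1 P
    have h2 := h.card_filter_fst_le Wb (-1) P
    have h3 := Finset.card_union_le (P.filter fun p => ∃ x ∈ Wb, (p + 1, x) ∈ R)
      (P.filter fun p => ∃ x ∈ Wb, (p + -1, x) ∈ R)
    refine (Finset.card_le_card ?_).trans (h3.trans (by omega))
    intro p hp
    rw [Finset.mem_filter] at hp
    rw [Finset.mem_union, Finset.mem_filter, Finset.mem_filter]
    by_contra hcon
    push Not at hcon
    refine hp.2 ⟨fun x hx => ?_, fun x hx => ?_⟩
    · by_contra hA
      exact hcon.1 hp.1 x (hmem x (hWr p hp.1 x hx) _ hA) hx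
    · by_contra hA
      rw [sub_eq_add_neg] at hx
      refine hcon.2 hp.1 x (hmem x (hWl' p hp.1 x (by rwa [sub_eq_add_neg])) (!e (p - 1)) ?_) hx
      rwa [arc_not]
  obtain ⟨f, hf, hfY⟩ := exists_injOn_rel_of_card_not_rel_le P Y
    (fun p y => (∀ x, (p + 1, x) ∈ R → G.Arc (e p) y x) ∧
      (∀ x, (p - 1, x) ∈ R → G.Arc (e (p - 1)) x y)) (4 * k) hPY (by omega)
    (fun p hp => by convert hrow p hp) (fun y hy => by convert hcol y hy)
  refine ⟨f, h.extend hP hf (fun p hp => hY _ (hfY p hp).1) hcons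
    (fun p hp y hy => (hfY p hp).2.1 y hy) ?_, hf, fun p hp => (hfY p hp).1⟩
  intro i y hi hy
  have := (hfY (i + 1) hi).2.2 y (by simpa using hy)
  simpa using this

end Placement

/-! ### Cores, and the completion of a balanced core to the whole cycle. -/

noncomputable section Core

open scoped Classical

variable {V : Type*} {n k : ℕ} {G : Digraph V} {A B S T : Finset V} {e ρ : ZMod n → Bool}
  {R : Finset (ZMod n × V)}

/-- `x` has at least `n / 50` neighbours, with direction `b`, in the class with role `c`. -/
def Many (G : Digraph V) (n : ℕ) (A B : Finset V) (b : Bool) (x : V) (c : Bool) : Prop :=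
  n ≤ 50 * ((cls A B c).filter fun y => G.Arc b x y).card

/-- An `AB`-partition with all error terms bounded by a natural number `k`. -/
structure Frame [Fintype V] (G : Digraph V) (n k : ℕ) (A B S T : Finset V) : Prop where
  card_eq : Fintype.card V = n
  one_le : 1 ≤ k
  large : 1000000 * k ≤ n
  loopless : G.Loopless
  cover : ∀ x, x ∈ A ∨ x ∈ B ∨ x ∈ S ∨ x ∈ T
  disjoint_AB : Disjoint A B
  disjoint_AS : Disjoint A S
  disjoint_AT : Disjoint A T
  disjoint_BS : Disjoint B S
  disjoint_BT : Disjoint B T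
  disjoint_ST : Disjoint S T
  A_le_B : A.card ≤ B.card
  S_le_T : S.card ≤ T.card
  B_le : B.card ≤ A.card + k
  ST_le : S.card + T.card ≤ k
  A_lower : n ≤ 2 * A.card + 2 * k
  many_cls : ∀ c, ∀ x ∈ cls A B c, ∀ b, Many G n A B b x (!c)
  many_S : ∀ x ∈ S, ∀ b, Many G n A B b x (!b)
  many_T : ∀ x ∈ T, ∀ b, Many G n A B b x b
  good : ∃ Z : Finset V, Z.card ≤ 2 * k ∧ ∀ c, ∀ x ∈ cls A B c, x ∉ Z → ∀ b,
    ((cls A B (!c)).filter fun y => ¬ G.Arc b x y).card ≤ k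
  degree : ∀ x b, n ≤ 2 * (Finset.univ.filter fun y => G.Arc b x y).card
  unbalanced : A.card < B.card →
    (∀ x ∈ B, ∀ b, 20 * (B.filter fun y => G.Arc b x y).card < n) ∧
    (∀ x ∈ S, 20 * (B.filter fun y => G.Arc false x y).card < n) ∧
    (∀ x ∈ T, 20 * (B.filter fun y => G.Arc true x y).card < n)

/-- A partial placement which leaves the roles `ρ` to the free positions, is bordered by vertices
with many neighbours in the right classes, and has no gaps of length one or two. -/
structure IsCore (G : Digraph V) (A B : Finset V) (e ρ : ZMod n → Bool)
    (R : Finset (ZMod n × V)) : Prop extends IsPlacement G e R where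
  alt : ∀ i, i ∉ dom R → i + 1 ∉ dom R → ρ (i + 1) = !ρ i
  many_right : ∀ i x, (i, x) ∈ R → i + 1 ∉ dom R → Many G n A B (e i) x (ρ (i + 1))
  many_left : ∀ i x, (i + 1, x) ∈ R → i ∉ dom R → Many G n A B (!e i) x (ρ i)
  gap : ∀ i, i ∈ dom R → i + 1 ∉ dom R → i + 2 ∉ dom R ∧ i + 3 ∉ dom R

/-- The free positions with role `A` are as many as the unused vertices of `A`. -/
def Balanced [NeZero n] (A : Finset V) (ρ : ZMod n → Bool) (R : Finset (ZMod n × V)) : Prop :=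
  (Finset.univ.filter fun i => ρ i = true).card + (R.filter fun r => r.2 ∈ A).card =
    A.card + (R.filter fun r => ρ r.1 = true).card

theorem mem_cls_iff (hAB : Disjoint A B) {c : Bool} {x : V} (hx : x ∈ cls A B c) :
    x ∈ A ↔ c = true := by
  cases c
  · simp only [cls, Bool.false_eq_true, if_false, iff_false] at hx ⊢
    exact Finset.disjoint_right.1 hAB hx
  · simpa [cls] using hx

theorem card_filter_occupy {P : Finset (ZMod n)} {f : ZMod n → V} (hP : ∀ p ∈ P, p ∉ dom R)
    (q : ZMod n × V → Prop) [DecidablePred q] :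
    ((occupy R P f).filter q).card = (R.filter q).card + (P.filter fun p => q (p, f p)).card := by
  rw [occupy, Finset.filter_union, Finset.card_union_of_disjoint, Finset.filter_image,
    Finset.card_image_of_injOn]
  · intro p _ p' _ hpp
    exact (Prod.mk.inj hpp).1
  · rw [Finset.disjoint_left]
    intro r hr hr'
    obtain ⟨p, hp, rfl⟩ := Finset.mem_image.1 (Finset.mem_filter.1 hr').1
    exact hP p hp (mem_dom.2 ⟨_, (Finset.mem_filter.1 hr).1⟩)

/-- Putting vertices of `A` exactly on positions of role `A` raises both sides of the balance by the
same amount. -/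
theorem Balanced.extend [NeZero n] (h : Balanced A ρ R) {P : Finset (ZMod n)} {f : ZMod n → V}
    (hP : ∀ p ∈ P, p ∉ dom R) (hf : ∀ p ∈ P, f p ∈ A ↔ ρ p = true) :
    Balanced A ρ (occupy R P f) := by
  unfold Balanced at h ⊢
  rw [card_filter_occupy hP, card_filter_occupy hP]
  have : (P.filter fun p => (p, f p).2 ∈ A) = P.filter fun p => ρ (p, f p).1 = true :=
    Finset.filter_congr fun p hp => hf p hp
  rw [this]
  omega

theorem natCast_ne_zero_of_lt {t : ℕ} (h0 : 1 ≤ t) (ht : t < n) : (t : ZMod n) ≠ 0 := by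
  intro h
  have := Nat.le_of_dvd h0 ((ZMod.natCast_eq_zero_iff t n).1 h)
  omega

/-- The new vertices lie in the class of their role, so their neighbours in the other class fit the
alternating roles around them; being far from everything else, they create no short gap. -/
theorem IsCore.extend (h : IsCore G A B e ρ R) (hn : 5 < n) (P : Finset (ZMod n))
    (f : ZMod n → V) (hf : Set.InjOn f P) (hfR : ∀ p ∈ P, f p ∉ ran R)
    (hPR : ∀ p ∈ P, ∀ q ∈ dom R, Far p q) (hPP : ∀ p ∈ P, ∀ q ∈ P, p ≠ q → Far p q)
    (hc : ∀ p ∈ P, f p ∈ cls A B (ρ p))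
    (hmany : ∀ c, ∀ x ∈ cls A B c, ∀ b, Many G n A B b x (!c)) :
    IsCore G A B e ρ (occupy R P f) := by
  have hP : ∀ p ∈ P, p ∉ dom R := fun p hp hpd => by
    have := (hPR p hp p hpd 0 (by omega)).1
    simp at this
  have key : ∀ p ∈ P, ∀ q, q ∈ dom R ∨ q ∈ P → ∀ t : ℕ, 1 ≤ t → t ≤ 5 →
      p + t ≠ q ∧ q + t ≠ p := by
    intro p hp q hq t ht1 ht5
    by_cases hpq : p = q
    · subst hpq
      have := natCast_ne_zero_of_lt ht1 (show t < n by omega)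
      simp [this]
    · have hfar : Far p q := by
        rcases hq with hq | hq
        · exact hPR p hp q hq
        · exact hPP p hp q hq hpq
      exact ⟨fun h => (hfar t ht5).2 h.symm, fun h => (hfar t ht5).1 h.symm⟩
  have key1 : ∀ p ∈ P, ∀ q, q ∈ dom R ∨ q ∈ P → p + 1 ≠ q ∧ q + 1 ≠ p := fun p hp q hq => by
    simpa using key p hp q hq 1 le_rfl (by omega)
  have key2 : ∀ p ∈ P, ∀ q, q ∈ dom R ∨ q ∈ P → p + 2 ≠ q ∧ q + 2 ≠ p := fun p hp q hq => by
    simpa using key p hp q hq 2 (by omega) (by omega)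
  have key3 : ∀ p ∈ P, ∀ q, q ∈ dom R ∨ q ∈ P → p + 3 ≠ q ∧ q + 3 ≠ p := fun p hp q hq => by
    simpa using key p hp q hq 3 (by omega) (by omega)
  refine ⟨h.toIsPlacement.extend hP hf hfR ?_ ?_ ?_, ?_, ?_, ?_, ?_⟩
  · exact fun p hp hp1 => (key1 p hp _ (Or.inr hp1)).1 rfl
  · exact fun p hp y hy => ((key1 p hp _ (Or.inl (mem_dom.2 ⟨y, hy⟩))).1 rfl).elim
  · exact fun i y hp hy => ((key1 _ hp _ (Or.inl (mem_dom.2 ⟨y, hy⟩))).2 rfl).elim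
  · intro i hi hi1
    rw [mem_dom_occupy, not_or] at hi hi1
    exact h.alt i hi.1 hi1.1
  · intro i x hx hi1
    rw [mem_dom_occupy, not_or] at hi1
    rw [mem_occupy] at hx
    rcases hx with hx | ⟨hx1, hx2⟩
    · exact h.many_right i x hx hi1.1
    · simp only at hx1 hx2
      rw [hx2, h.alt i (hP i hx1) hi1.1]
      exact hmany _ _ (hc i hx1) _
  · intro i x hx hi
    rw [mem_dom_occupy, not_or] at hi
    rw [mem_occupy] at hx
    rcases hx with hx | ⟨hx1, hx2⟩
    · exact h.many_left i x hx hi.1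
    · simp only at hx1 hx2
      have h1 := hmany _ _ (hc (i + 1) hx1) (!e i)
      rw [h.alt i hi.1 (hP _ hx1), Bool.not_not] at h1
      rw [hx2]
      exact h1
  · intro i hi hi1
    rw [mem_dom_occupy] at hi
    rw [mem_dom_occupy, not_or] at hi1
    rw [mem_dom_occupy, mem_dom_occupy, not_or, not_or]
    refine ⟨⟨fun h2 => ?_, fun h2 => (key2 _ h2 i hi).2 rfl⟩,
      ⟨fun h3 => ?_, fun h3 => (key3 _ h3 i hi).2 rfl⟩⟩
    · rcases hi with hi | hi
      · exact (h.gap i hi hi1.1).1 h2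
      · exact (key2 i hi _ (Or.inl h2)).1 rfl
    · rcases hi with hi | hi
      · exact (h.gap i hi hi1.1).2 h3
      · exact (key3 i hi _ (Or.inl h3)).1 rfl

theorem IsPlacement.card_filter_univ_sdiff [NeZero n] (h : IsPlacement G e R) (c : Bool) :
    (Finset.univ.filter fun i => i ∉ dom R ∧ ρ i = c).card +
      (R.filter fun r => ρ r.1 = c).card = (Finset.univ.filter fun i => ρ i = c).card := by
  have h1 : (R.filter fun r => ρ r.1 = c).card =
      (Finset.univ.filter fun i => i ∈ dom R ∧ ρ i = c).card := by
    rw [← Finset.card_image_of_injOn (s := R.filter fun r => ρ r.1 = c) (f := Prod.fst)]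
    · congr 1
      ext i
      simp only [Finset.mem_image, Finset.mem_filter, Finset.mem_univ, true_and, mem_dom]
      constructor
      · rintro ⟨⟨i', x⟩, ⟨h1, h2⟩, rfl⟩
        exact ⟨⟨x, h1⟩, h2⟩
      · rintro ⟨⟨x, h1⟩, h2⟩
        exact ⟨(i, x), ⟨h1, h2⟩, rfl⟩
    · intro r hr r' hr' hrr
      exact h.fst_inj r (Finset.mem_filter.1 hr).1 r' (Finset.mem_filter.1 hr').1 hrr
  rw [h1, ← Finset.card_union_of_disjoint]
  · congr 1
    ext i
    simp only [Finset.mem_union, Finset.mem_filter, Finset.mem_univ, true_and]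
    tauto
  · rw [Finset.disjoint_left]
    intro i hi hi'
    exact (Finset.mem_filter.1 hi).2.1 (Finset.mem_filter.1 hi').2.1

theorem IsPlacement.card_sdiff_ran (h : IsPlacement G e R) (A : Finset V) :
    (A.filter fun x => x ∉ ran R).card + (R.filter fun r => r.2 ∈ A).card = A.card := by
  have h1 : (R.filter fun r => r.2 ∈ A).card = (A.filter fun x => x ∈ ran R).card := by
    rw [← Finset.card_image_of_injOn (s := R.filter fun r => r.2 ∈ A) (f := Prod.snd)]
    · congr 1
      ext x
      simp only [Finset.mem_image, Finset.mem_filter, mem_ran]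
      constructor
      · rintro ⟨⟨i, x'⟩, ⟨h1, h2⟩, rfl⟩
        exact ⟨h2, ⟨i, h1⟩⟩
      · rintro ⟨h2, ⟨i, h1⟩⟩
        exact ⟨(i, x), ⟨h1, h2⟩, rfl⟩
    · intro r hr r' hr' hrr
      exact h.snd_inj r (Finset.mem_filter.1 hr).1 r' (Finset.mem_filter.1 hr').1 hrr
  have h2 := Finset.card_filter_add_card_filter_not (s := A) (fun x => x ∈ ran R)
  omega

/-- Exceptional vertices of `A ∪ B` can be added to a core. -/
theorem IsCore.exists_cover [NeZero n] [Nonempty V] (h : IsCore G A B e ρ R)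
    (hbal : Balanced A ρ R) (hAB : Disjoint A B) (hk : 1 ≤ k) (hn : 1000000 * k ≤ n)
    (hA1 : n ≤ 2 * A.card + 2 * k) (hA2 : 2 * A.card ≤ n) (hR : R.card ≤ 10 * k)
    (hmany : ∀ c, ∀ x ∈ cls A B c, ∀ b, Many G n A B b x (!c)) (Z : Finset V)
    (hZ : Z.card ≤ 2 * k) :
    ∃ R', IsCore G A B e ρ R' ∧ Balanced A ρ R' ∧ R ⊆ R' ∧ R'.card ≤ 12 * k ∧
      ∀ z ∈ Z, z ∈ A ∨ z ∈ B → z ∈ ran R' := by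
  let Z' := Z.filter fun z => (z ∈ A ∨ z ∈ B) ∧ z ∉ ran R
  have hZ' : Z'.card ≤ 2 * k := (Finset.card_filter_le _ _).trans hZ
  -- By balance the number of positions of role `A` differs from `|A|` by at most `|R|`, and `|A|`
  -- is within `k` of `n / 2`; so both roles have about `n / 2` free positions.
  have hcount : ∀ c, 40 * k * 12 ≤ (Finset.univ.filter fun i => i ∉ dom R ∧ ρ i = c).card := by
    have h1 := h.card_filter_univ_sdiff (ρ := ρ) true
    have h2 := h.card_filter_univ_sdiff (ρ := ρ) false
    have h3 : (R.filter fun r => ρ r.1 = true).card ≤ R.card := Finset.card_filter_le _ _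
    have h4 : (R.filter fun r => ρ r.1 = false).card ≤ R.card := Finset.card_filter_le _ _
    have h5 : (R.filter fun r => r.2 ∈ A).card ≤ R.card := Finset.card_filter_le _ _
    have h6 := Finset.card_filter_add_card_filter_not (s := (Finset.univ : Finset (ZMod n)))
      (fun i => ρ i = true)
    simp only [Bool.not_eq_true, Finset.card_univ, ZMod.card] at h6
    unfold Balanced at hbal
    intro c
    cases c <;> omega
  obtain ⟨π, hπ1, hπ2, hπ3⟩ := exists_far Z'
    (fun z => Finset.univ.filter fun i => i ∉ dom R ∧ ρ i = decide (z ∈ A)) (dom R) fun z _ => by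
      have := hcount (decide (z ∈ A))
      have := h.card_dom
      omega
  have hinj : Set.InjOn π Z' := by
    intro z hz z' hz' hzz
    by_contra hne
    have := (hπ3 z hz z' hz' hne 0 (by omega)).1
    simp [hzz] at this
  let f := Function.invFunOn π (Z' : Set V)
  have hf : ∀ z ∈ Z', f (π z) = z := fun z hz => hinj.leftInvOn_invFunOn hz
  have hmemP : ∀ p ∈ Z'.image π, ∃ z ∈ Z', π z = p ∧ f p = z := by
    intro p hp
    obtain ⟨z, hz, rfl⟩ := Finset.mem_image.1 hp
    exact ⟨z, hz, rfl, hf z hz⟩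
  have hcls : ∀ p ∈ Z'.image π, f p ∈ cls A B (ρ p) := by
    intro p hp
    obtain ⟨z, hz, rfl, hfz⟩ := hmemP p hp
    rw [hfz, (Finset.mem_filter.1 (hπ1 z hz)).2.2]
    by_cases hzA : z ∈ A
    · simp [cls, hzA]
    · simpa [cls, hzA] using (Finset.mem_filter.1 hz).2.1
  have hPd : ∀ p ∈ Z'.image π, p ∉ dom R := by
    intro p hp
    obtain ⟨z, hz, rfl, -⟩ := hmemP p hp
    exact (Finset.mem_filter.1 (hπ1 z hz)).2.1
  refine ⟨occupy R (Z'.image π) f, h.extend (by omega) _ f ?_ ?_ ?_ ?_ hcls hmany,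
    hbal.extend hPd fun p hp => mem_cls_iff hAB (hcls p hp), Finset.subset_union_left, ?_, ?_⟩
  · intro p hp q hq hpq
    obtain ⟨z, hz, rfl, hfz⟩ := hmemP p hp
    obtain ⟨w, hw, rfl, hfw⟩ := hmemP q hq
    rw [hfz, hfw] at hpq
    rw [hpq]
  · intro p hp
    obtain ⟨z, hz, rfl, hfz⟩ := hmemP p hp
    rw [hfz]
    exact (Finset.mem_filter.1 hz).2.2
  · intro p hp q hq
    obtain ⟨z, hz, rfl, -⟩ := hmemP p hp
    exact hπ2 z hz q hq
  · intro p hp q hq hpq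
    obtain ⟨z, hz, rfl, -⟩ := hmemP p hp
    obtain ⟨w, hw, rfl, -⟩ := hmemP q hq
    exact hπ3 z hz w hw fun hzw => hpq (hzw ▸ rfl)
  · have h1 := Finset.card_union_le R ((Z'.image π).image fun p => (p, f p))
    have h2 := Finset.card_image_le (s := Z'.image π) (f := fun p => (p, f p))
    have h3 := Finset.card_image_le (s := Z') (f := π)
    exact h1.trans (by omega)
  · intro z hz hzAB
    rw [mem_ran_occupy]
    by_cases hzR : z ∈ ran R
    · exact Or.inl hzR
    · have hz' : z ∈ Z' := Finset.mem_filter.2 ⟨hz, hzAB, hzR⟩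
      exact Or.inr ⟨π z, Finset.mem_image_of_mem π hz', hf z hz'⟩

/-- The positions next to a core can be occupied by good vertices. -/
theorem IsCore.exists_border [NeZero n] [Nonempty V] (h : IsCore G A B e ρ R)
    (hbal : Balanced A ρ R) (hAB : Disjoint A B) (hn : 1000000 * k ≤ n)
    (hR : R.card ≤ 12 * k) (Z : Finset V) (hZ : ∀ z ∈ Z, z ∈ A ∨ z ∈ B → z ∈ ran R) :
    ∃ R', IsPlacement G e R' ∧ Balanced A ρ R' ∧ R ⊆ R' ∧ R'.card ≤ 36 * k ∧
      (∀ i x, i ∉ dom R' → (i + 1, x) ∈ R' → x ∈ cls A B (!ρ i) ∧ x ∉ Z) ∧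
      (∀ i x, (i, x) ∈ R' → i + 1 ∉ dom R' → x ∈ cls A B (!ρ (i + 1)) ∧ x ∉ Z) := by
  let N : Finset (ZMod n) := Finset.univ.filter fun i =>
    i ∉ dom R ∧ (i - 1 ∈ dom R ∨ i + 1 ∈ dom R)
  have hN : N.card ≤ 24 * k := by
    have hsub : N ⊆ (dom R).image (fun i => i + 1) ∪ (dom R).image (fun i => i - 1) := by
      intro i hi
      rcases (Finset.mem_filter.1 hi).2.2 with hi | hi
      · exact Finset.mem_union_left _ (Finset.mem_image.2 ⟨_, hi, by simp⟩)
      · exact Finset.mem_union_right _ (Finset.mem_image.2 ⟨_, hi, by simp⟩)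
    have h1 := Finset.card_le_card hsub
    have h2 := Finset.card_union_le ((dom R).image (fun i => i + 1))
      ((dom R).image (fun i => i - 1))
    have h3 := Finset.card_image_le (s := dom R) (f := fun i => i + 1)
    have h4 := Finset.card_image_le (s := dom R) (f := fun i => i - 1)
    have h5 := h.card_dom
    omega
  let cand : ZMod n → Finset V := fun i => (cls A B (ρ i)).filter fun y => y ∉ ran R ∧
    (∀ x, (i - 1, x) ∈ R → G.Arc (e (i - 1)) x y) ∧ (∀ x, (i + 1, x) ∈ R → G.Arc (!e i) x y)
  -- At least `n / 50` neighbours are available, far more than the at most `12 * k` used vertices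
  -- and `24 * k` border positions together; so distinct ones can be picked greedily.
  have hsplit : ∀ i, ∀ s : Finset V, (∀ y ∈ s, y ∉ ran R → y ∈ cand i) → n ≤ 50 * s.card →
      N.card ≤ (cand i).card := by
    intro i s hs hsn
    have h1 : s ⊆ cand i ∪ ran R := by
      intro y hy
      by_cases hyR : y ∈ ran R
      · exact Finset.mem_union_right _ hyR
      · exact Finset.mem_union_left _ (hs y hy hyR)
    have h2 := Finset.card_le_card h1
    have h3 := Finset.card_union_le (cand i) (ran R)
    have h4 := h.card_ran
    omega
  obtain ⟨f, hf, hfc⟩ := exists_injOn_mem_of_card_le N cand fun i hi => by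
    obtain ⟨-, hid, hi⟩ := Finset.mem_filter.1 hi
    by_cases hi1 : i - 1 ∈ dom R
    · obtain ⟨x, hx⟩ := mem_dom.1 hi1
      -- There is no gap of length one, so a border position has a single occupied neighbour and a
      -- single adjacency to satisfy.
      have hi2 : i + 1 ∉ dom R := by
        have := (h.gap (i - 1) hi1 (by simpa using hid)).1
        rwa [show i - 1 + 2 = i + 1 by ring] at this
      have hm := h.many_right (i - 1) x hx (by simpa using hid)
      rw [sub_add_cancel] at hm
      refine hsplit i _ (fun y hy hyR => ?_) hm
      rw [Finset.mem_filter] at hy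
      refine Finset.mem_filter.2 ⟨hy.1, hyR, fun x' hx' => ?_, fun x' hx' => ?_⟩
      · have := congrArg Prod.snd (h.fst_inj _ hx _ hx' rfl)
        simp only at this
        rw [← this]
        exact hy.2
      · exact (hi2 (mem_dom.2 ⟨x', hx'⟩)).elim
    · obtain ⟨x, hx⟩ := mem_dom.1 (hi.resolve_left hi1)
      refine hsplit i _ (fun y hy hyR => ?_) (h.many_left i x hx hid)
      rw [Finset.mem_filter] at hy
      refine Finset.mem_filter.2 ⟨hy.1, hyR, fun x' hx' => ?_, fun x' hx' => ?_⟩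
      · exact (hi1 (mem_dom.2 ⟨x', hx'⟩)).elim
      · have := congrArg Prod.snd (h.fst_inj _ hx _ hx' rfl)
        simp only at this
        rw [← this]
        exact hy.2
  have hmem : ∀ p ∈ N, f p ∈ cls A B (ρ p) ∧ f p ∉ ran R ∧
      (∀ x, (p - 1, x) ∈ R → G.Arc (e (p - 1)) x (f p)) ∧
      (∀ x, (p + 1, x) ∈ R → G.Arc (!e p) x (f p)) :=
    fun p hp => Finset.mem_filter.1 (hfc p hp)
  have hNd : ∀ p ∈ N, p ∉ dom R := fun p hp => (Finset.mem_filter.1 hp).2.1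
  have hnotZ : ∀ p ∈ N, f p ∉ Z := by
    intro p hp hpZ
    refine (hmem p hp).2.1 (hZ _ hpZ ?_)
    have := (hmem p hp).1
    cases hρ : ρ p <;> simp [hρ, cls] at this
    · exact Or.inr this
    · exact Or.inl this
  refine ⟨occupy R N f, h.toIsPlacement.extend hNd hf (fun p hp => (hmem p hp).2.1) ?_ ?_ ?_,
    hbal.extend hNd fun p hp => mem_cls_iff hAB (hmem p hp).1, Finset.subset_union_left, ?_, ?_, ?_⟩
  · intro p hp hp1
    -- Two consecutive border positions would form a gap of length two.
    have h1 : p - 1 ∈ dom R := (Finset.mem_filter.1 hp).2.2.resolve_right (hNd _ hp1)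
    have h2 : p + 1 + 1 ∈ dom R := by
      refine (Finset.mem_filter.1 hp1).2.2.resolve_left ?_
      rw [add_sub_cancel_right]
      exact hNd p hp
    have := (h.gap (p - 1) h1 (by simpa using hNd p hp)).2
    rw [show p - 1 + 3 = p + 1 + 1 by ring] at this
    exact this h2
  · exact fun p hp y hy => arc_not.1 ((hmem p hp).2.2.2 y hy)
  · intro i y hi hy
    have := (hmem _ hi).2.2.1 y (by simpa using hy)
    simpa using this
  · have h1 := Finset.card_union_le R (N.image fun p => (p, f p))
    have h2 := Finset.card_image_le (s := N) (f := fun p => (p, f p))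
    exact h1.trans (by omega)
  · intro i x hi hx
    rw [mem_dom_occupy, not_or] at hi
    rw [mem_occupy] at hx
    rcases hx with hx | ⟨hx1, hx2⟩
    · exact (hi.2 (Finset.mem_filter.2 ⟨Finset.mem_univ _, hi.1,
        Or.inr (mem_dom.2 ⟨x, hx⟩)⟩)).elim
    · simp only at hx1 hx2
      rw [hx2, ← h.alt i hi.1 (hNd _ hx1)]
      exact ⟨(hmem _ hx1).1, hnotZ _ hx1⟩
  · intro i x hx hi
    rw [mem_dom_occupy, not_or] at hi
    rw [mem_occupy] at hx
    rcases hx with hx | ⟨hx1, hx2⟩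
    · refine (hi.2 (Finset.mem_filter.2 ⟨Finset.mem_univ _, hi.1, Or.inl ?_⟩)).elim
      rw [add_sub_cancel_right]
      exact mem_dom.2 ⟨x, hx⟩
    · simp only at hx1 hx2
      rw [hx2, h.alt i (hNd _ hx1) hi.1, Bool.not_not]
      exact ⟨(hmem _ hx1).1, hnotZ _ hx1⟩

theorem Frame.two_mul_A_le [Fintype V] (fr : Frame G n k A B S T) : 2 * A.card ≤ n := by
  have h1 := Finset.card_le_univ (A ∪ B)
  rw [Finset.card_union_of_disjoint fr.disjoint_AB, fr.card_eq] at h1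
  have := fr.A_le_B
  omega

/-- A balanced core of small size which contains `S ∪ T` extends to an embedding of the cycle. -/
theorem IsCore.exists_embedding [Fintype V] [NeZero n] (h : IsCore G A B e ρ R)
    (fr : Frame G n k A B S T) (hbal : Balanced A ρ R) (hR : R.card ≤ 10 * k)
    (hS : ∀ x ∈ S, x ∈ ran R) (hT : ∀ x ∈ T, x ∈ ran R) :
    ∃ f : ZMod n → V, Function.Injective f ∧ ∀ i, G.Arc (e i) (f i) (f (i + 1)) := by
  have hk := fr.one_le
  have hn := fr.large
  have hA1 := fr.A_lower
  have hA2 := fr.two_mul_A_le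
  have : Nonempty V := Fintype.card_pos_iff.1 (by rw [fr.card_eq]; omega)
  obtain ⟨Z, hZ, hgood⟩ := fr.good
  obtain ⟨R₁, h₁, hbal₁, hRR₁, hR₁, hZ₁⟩ := h.exists_cover hbal fr.disjoint_AB hk hn hA1 hA2 hR
    fr.many_cls Z hZ
  obtain ⟨R₂, h₂, hbal₂, hRR₂, hR₂, hr₂, hl₂⟩ := h₁.exists_border hbal₁ fr.disjoint_AB hn hR₁ Z hZ₁
  have halt : ∀ i, i ∉ dom R₂ → i + 1 ∉ dom R₂ → ρ (i + 1) = !ρ i := fun i hi hi1 =>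
    h₁.alt i (fun hd => hi (Finset.image_subset_image hRR₂ hd))
      fun hd => hi1 (Finset.image_subset_image hRR₂ hd)
  have hZ₂ : ∀ z ∈ Z, z ∈ A ∨ z ∈ B → z ∈ ran R₂ := fun z hz hzAB =>
    Finset.image_subset_image hRR₂ (hZ₁ z hz hzAB)
  have hgood' : ∀ c, ∀ x ∈ cls A B c, x ∉ Z → ∀ b, ∀ s : Finset V, s ⊆ cls A B (!c) →
      (s.filter fun y => ¬ G.Arc b x y).card ≤ k := fun c x hx hxZ b s hs =>
    (Finset.card_le_card (Finset.filter_subset_filter _ hs)).trans (hgood c x hx hxZ b)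
  -- The positions of role `A` come first: their occupied neighbours are good vertices of `B`.
  -- Afterwards every free position has role `B`, and its neighbours hold good vertices of `A`.
  let P := Finset.univ.filter fun i : ZMod n => i ∉ dom R₂ ∧ ρ i = true
  let Y := A.filter fun x => x ∉ ran R₂
  have hY : ∀ y ∈ Y, y ∈ A ∧ y ∉ ran R₂ ∧ y ∉ Z := fun y hy => by
    obtain ⟨h1, h2⟩ := Finset.mem_filter.1 hy
    exact ⟨h1, h2, fun hyZ => h2 (hZ₂ y hyZ (Or.inl h1))⟩
  have hP : ∀ p ∈ P, p ∉ dom R₂ ∧ ρ p = true := fun p hp => (Finset.mem_filter.1 hp).2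
  have hPY : P.card = Y.card := by
    have h1 := h₂.card_filter_univ_sdiff (ρ := ρ) true
    have h2 := h₂.card_sdiff_ran A
    unfold Balanced at hbal₂
    simp only [P, Y]
    omega
  have hYcard : A.card ≤ Y.card + 36 * k := by
    have h2 := h₂.card_sdiff_ran A
    have h3 : (R₂.filter fun r => r.2 ∈ A).card ≤ R₂.card := Finset.card_filter_le _ _
    simp only [Y]
    omega
  obtain ⟨f, hR₃, hf, hfY⟩ := h₂.fill (k := k) P Y (B.filter fun x => x ∉ Z) hPY
    (fun p hp => (hP p hp).1) (fun y hy => (hY y hy).2.1)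
    (fun p hp hp1 => by
      have := halt p (hP p hp).1 (hP _ hp1).1
      rw [(hP p hp).2, (hP _ hp1).2] at this
      simp at this)
    (fun p hp x hx => by
      have := hr₂ p x (hP p hp).1 hx
      rw [(hP p hp).2] at this
      exact Finset.mem_filter.2 this)
    (fun i x hp hx => by
      have := hl₂ i x hx (hP _ hp).1
      rw [(hP _ hp).2] at this
      exact Finset.mem_filter.2 this)
    (fun y hy b => hgood' true y (hY y hy).1 (hY y hy).2.2 b _ (Finset.filter_subset _ _))
    (fun w hw b => hgood' false w (Finset.mem_filter.1 hw).1 (Finset.mem_filter.1 hw).2 b _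
      (Finset.filter_subset _ _)) (by omega)
  set R₃ := occupy R₂ P f with hR₃def
  have hR₃card : R₃.card ≤ 36 * k + A.card := by
    have h1 := Finset.card_union_le R₂ (P.image fun p => (p, f p))
    have h2 := Finset.card_image_le (s := P) (f := fun p => (p, f p))
    have h3 : Y.card ≤ A.card := Finset.card_filter_le _ _
    have h4 : R₃.card = (R₂ ∪ P.image fun p => (p, f p)).card := rfl
    omega
  let P' := Finset.univ.filter fun i : ZMod n => i ∉ dom R₃
  let Y' := Finset.univ.filter fun x : V => x ∉ ran R₃
  have hP' : ∀ p ∈ P', p ∉ dom R₂ ∧ ρ p = false := by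
    intro p hp
    have hp' := (Finset.mem_filter.1 hp).2
    rw [hR₃def, mem_dom_occupy, not_or] at hp'
    refine ⟨hp'.1, ?_⟩
    by_contra hρ
    exact hp'.2 (Finset.mem_filter.2 ⟨Finset.mem_univ _, hp'.1, by simpa using hρ⟩)
  have hsub₃ : ∀ x, x ∈ ran R₂ → x ∈ ran R₃ := fun x hx => mem_ran_occupy.2 (Or.inl hx)
  have hsub : ∀ x, x ∈ ran R → x ∈ ran R₃ := fun x hx => hsub₃ x
    (Finset.image_subset_image (hRR₁.trans hRR₂) hx)
  have hY' : ∀ y ∈ Y', y ∈ B ∧ y ∉ ran R₃ ∧ y ∉ Z := by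
    intro y hy
    have hy' := (Finset.mem_filter.1 hy).2
    have hyB : y ∈ B := by
      rcases fr.cover y with hyA | hyB | hyS | hyT
      · exfalso
        have hyY : y ∈ Y := Finset.mem_filter.2 ⟨hyA, fun h2 => hy' (hsub₃ y h2)⟩
        -- Since `|P| = |Y|`, the first filling uses up `A`; as `S ∪ T` is already placed, only
        -- vertices of `B` are left for the second.
        have himg : P.image f = Y := by
          apply Finset.eq_of_subset_of_card_le
          · intro x hx
            obtain ⟨p, hp, rfl⟩ := Finset.mem_image.1 hx
            exact hfY p hp
          · rw [Finset.card_image_of_injOn hf]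
            omega
        rw [← himg] at hyY
        obtain ⟨p, hp, hpy⟩ := Finset.mem_image.1 hyY
        exact hy' (mem_ran_occupy.2 (Or.inr ⟨p, hp, hpy⟩))
      · exact hyB
      · exact (hy' (hsub y (hS y hyS))).elim
      · exact (hy' (hsub y (hT y hyT))).elim
    exact ⟨hyB, hy', fun hyZ => hy' (hsub₃ y (hZ₂ y hyZ (Or.inr hyB)))⟩
  have hPcard' : P'.card + R₃.card = n := by
    have h1 := Finset.card_filter_add_card_filter_not (s := (Finset.univ : Finset (ZMod n)))
      (fun i => i ∈ dom R₃)
    rw [Finset.filter_mem_eq_inter, Finset.univ_inter, hR₃.card_dom, Finset.card_univ,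
      ZMod.card] at h1
    simp only [P']
    omega
  have hYcard' : Y'.card + R₃.card = n := by
    have h1 := Finset.card_filter_add_card_filter_not (s := (Finset.univ : Finset V))
      (fun i => i ∈ ran R₃)
    rw [Finset.filter_mem_eq_inter, Finset.univ_inter, hR₃.card_ran, Finset.card_univ,
      fr.card_eq] at h1
    simp only [Y']
    omega
  have hA₃ : ∀ p x, ((p + 1, x) ∈ R₃ ∧ p ∈ P') ∨ ((p, x) ∈ R₃ ∧ p + 1 ∈ P') →
      x ∈ A.filter fun x => x ∉ Z := by
    rintro p x (⟨hx, hp⟩ | ⟨hx, hp⟩)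
    · rcases mem_occupy.1 hx with hx | ⟨hx1, hx2⟩
      · have := hr₂ p x (hP' p hp).1 hx
        rw [(hP' p hp).2] at this
        exact Finset.mem_filter.2 this
      · have := hY _ (hfY _ hx1)
        simp only at hx2
        rw [hx2]
        exact Finset.mem_filter.2 ⟨this.1, this.2.2⟩
    · rcases mem_occupy.1 hx with hx | ⟨hx1, hx2⟩
      · have := hl₂ p x hx (hP' _ hp).1
        rw [(hP' _ hp).2] at this
        exact Finset.mem_filter.2 this
      · have := hY _ (hfY _ hx1)
        simp only at hx2
        rw [hx2]
        exact Finset.mem_filter.2 ⟨this.1, this.2.2⟩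
  obtain ⟨g, hR₄, -, -⟩ := hR₃.fill (k := k) P' Y' (A.filter fun x => x ∉ Z) (by omega)
    (fun p hp => (Finset.mem_filter.1 hp).2) (fun y hy => (hY' y hy).2.1)
    (fun p hp hp1 => by
      have := halt p (hP' p hp).1 (hP' _ hp1).1
      rw [(hP' p hp).2, (hP' _ hp1).2] at this
      simp at this)
    (fun p hp x hx => hA₃ p x (Or.inl ⟨hx, hp⟩)) (fun p x hp hx => hA₃ p x (Or.inr ⟨hx, hp⟩))
    (fun y hy b => hgood' false y (hY' y hy).1 (hY' y hy).2.2 b _ (Finset.filter_subset _ _))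
    (fun w hw b => hgood' true w (Finset.mem_filter.1 hw).1 (Finset.mem_filter.1 hw).2 b _
      fun y hy => (hY' y hy).1) (by omega)
  have hall : ∀ i, ∃ x, (i, x) ∈ occupy R₃ P' g := by
    intro i
    rw [← mem_dom, mem_dom_occupy]
    by_cases hi : i ∈ dom R₃
    · exact Or.inl hi
    · exact Or.inr (Finset.mem_filter.2 ⟨Finset.mem_univ _, hi⟩)
  choose F hF using hall
  refine ⟨F, fun i j hij => ?_, fun i => hR₄.arc i _ _ (hF i) (hF (i + 1))⟩
  exact congrArg Prod.fst (hR₄.snd_inj _ (hF i) _ (hF j) hij)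

end Core

/-! ### Items, their charges, and the reduction of the embedding to a charge equation. -/

noncomputable section Items

open scoped Classical

variable {V : Type*} {n k : ℕ} {G : Digraph V} {A B S T : Finset V} {e ρ : ZMod n → Bool}

/-- The first vertex of an item, which is a vertex or an edge, when an edge is traversed forwards
(`b = true`) or backwards. -/
def first (b : Bool) : V ⊕ V × V → V
  | Sum.inl v => v
  | Sum.inr p => if b then p.1 else p.2

/-- The last vertex of an item. -/
def second (b : Bool) : V ⊕ V × V → V
  | Sum.inl v => v
  | Sum.inr p => if b then p.2 else p.1

/-- The vertices of an item. -/
def verts (j : V ⊕ V × V) : Finset V :=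
  {first true j, second true j}

theorem first_mem_verts (b : Bool) (j : V ⊕ V × V) : first b j ∈ verts j := by
  rcases j with v | ⟨x, y⟩ <;> cases b <;> simp [verts, first, second]

theorem second_mem_verts (b : Bool) (j : V ⊕ V × V) : second b j ∈ verts j := by
  rcases j with v | ⟨x, y⟩ <;> cases b <;> simp [verts, first, second]

theorem mem_verts (b : Bool) {j : V ⊕ V × V} {x : V} (hx : x ∈ verts j) :
    x = first b j ∨ (j.isRight = true ∧ x = second b j) := by
  rcases j with v | ⟨y, z⟩ <;> cases b <;> simp [verts, first, second] at hx ⊢ <;> tauto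

/-- The item `j` can start at the position `i` if `i` has role `r`; the roles alternate across the
item unless `φ` holds. -/
structure Fits (G : Digraph V) (n : ℕ) (A B : Finset V) (e : ZMod n → Bool) (r : Bool)
    (j : V ⊕ V × V) (i : ZMod n) (φ : Bool) : Prop where
  adj : ∀ p, j = Sum.inr p → G.Adj p.1 p.2
  left : Many G n A B (!e (i - 1)) (first (e i) j) (!r)
  single : j.isRight = false → Many G n A B (e i) (first (e i) j) (xor (!r) φ)
  pair : j.isRight = true → Many G n A B (e (i + 1)) (second (e i) j) (xor r φ)

/-- The sign of a role. -/
def sgn (r : Bool) : ℤ := if r then 1 else -1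

/-- The weight of a vertex: `1` in `A`, `-1` in `B` and `0` elsewhere. -/
def weight (A B : Finset V) (x : V) : ℤ :=
  (if x ∈ A then 1 else 0) - if x ∈ B then 1 else 0

/-- The contribution of an item to `|A| - |B|`. -/
def charge (A B : Finset V) (r φ : Bool) (j : V ⊕ V × V) : ℤ :=
  match j with
  | Sum.inl v => (if φ then 0 else -sgn r) + weight A B v
  | Sum.inr p => (if φ then -sgn r else 0) + weight A B p.1 + weight A B p.2

/-- The partial placement given by the items in `J` at the positions `p`. -/
def place (e : ZMod n → Bool) (J : Finset (V ⊕ V × V)) (p : V ⊕ V × V → ZMod n) :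
    Finset (ZMod n × V) :=
  (J.image fun j => (p j, first (e (p j)) j)) ∪
    (J.filter fun j => j.isRight = true).image fun j => (p j + 1, second (e (p j)) j)

variable {J : Finset (V ⊕ V × V)} {p : V ⊕ V × V → ZMod n} {φ : V ⊕ V × V → Bool}

theorem mem_place {i : ZMod n} {x : V} : (i, x) ∈ place e J p ↔ ∃ j ∈ J,
    (p j = i ∧ first (e (p j)) j = x) ∨
      (j.isRight = true ∧ p j + 1 = i ∧ second (e (p j)) j = x) := by
  simp only [place, Finset.mem_union, Finset.mem_image, Finset.mem_filter, Prod.mk.injEq]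
  constructor
  · rintro (⟨j, hj, h⟩ | ⟨j, ⟨hj, h1⟩, h2⟩)
    · exact ⟨j, hj, Or.inl h⟩
    · exact ⟨j, hj, Or.inr ⟨h1, h2⟩⟩
  · rintro ⟨j, hj, h | ⟨h1, h2⟩⟩
    · exact Or.inl ⟨j, hj, h⟩
    · exact Or.inr ⟨j, ⟨hj, h1⟩, h2⟩

theorem mem_dom_place {i : ZMod n} : i ∈ dom (place e J p) ↔ ∃ j ∈ J,
    p j = i ∨ (j.isRight = true ∧ p j + 1 = i) := by
  rw [mem_dom]
  constructor
  · rintro ⟨x, hx⟩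
    obtain ⟨j, hj, h | h⟩ := mem_place.1 hx
    · exact ⟨j, hj, Or.inl h.1⟩
    · exact ⟨j, hj, Or.inr ⟨h.1, h.2.1⟩⟩
  · rintro ⟨j, hj, h | h⟩
    · exact ⟨_, mem_place.2 ⟨j, hj, Or.inl ⟨h, rfl⟩⟩⟩
    · exact ⟨_, mem_place.2 ⟨j, hj, Or.inr ⟨h.1, h.2, rfl⟩⟩⟩

/-- An item occupies offsets `0` and possibly `1`. Distance six between items is therefore more than
a shift by at most four can bridge, and `n > 6` keeps an item from meeting itself round the cycle.
Shifts by two and three are what excludes short gaps. -/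
theorem eq_of_far (hn : 6 < n) (far : ∀ j ∈ J, ∀ j' ∈ J, j ≠ j' → Far (p j) (p j'))
    {j j' : V ⊕ V × V} (hj : j ∈ J) (hj' : j' ∈ J) {d d' t : ℕ} (hd : d ≤ 1) (hd' : d' ≤ 1)
    (ht : t ≤ 4) (h : p j + d + t = p j' + d') : j = j' ∧ d + t = d' := by
  by_cases hle : d' ≤ d + t
  · have h1 : p j' = p j + (d + t - d' : ℕ) := by
      rw [Nat.cast_sub hle, Nat.cast_add]
      linear_combination -h
    have hjj : j = j' := by
      by_contra hne
      exact (far j hj j' hj' hne (d + t - d') (by omega)).2 h1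
    refine ⟨hjj, ?_⟩
    subst hjj
    by_contra hne
    refine natCast_ne_zero_of_lt (show 1 ≤ d + t - d' by omega) (show d + t - d' < n by omega) ?_
    simpa using h1.symm
  · have hd0 : d = 0 := by omega
    have ht0 : t = 0 := by omega
    have hd1 : d' = 1 := by omega
    subst hd0 ht0 hd1
    simp only [Nat.cast_zero, add_zero, Nat.cast_one] at h
    exfalso
    by_cases hjj : j = j'
    · subst hjj
      have := natCast_ne_zero_of_lt (n := n) le_rfl (by omega)
      simp at h this
      exact this h
    · exact (far j hj j' hj' hjj 1 (by omega)).1 (by simpa using h)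

theorem arc_first_second {b : Bool} {q : V × V} (h : G.Adj q.1 q.2) :
    G.Arc b (first b (Sum.inr q)) (second b (Sum.inr q)) := by
  cases b <;> simpa [Arc, first, second] using h

/-- `Fits` records the neighbours needed just outside an item. Looplessness is needed for the two
ends of an edge item to be distinct. -/
theorem isCore_place (hn : 6 < n) (hG : G.Loopless)
    (far : ∀ j ∈ J, ∀ j' ∈ J, j ≠ j' → Far (p j) (p j'))
    (disj : ∀ j ∈ J, ∀ j' ∈ J, ∀ x, x ∈ verts j → x ∈ verts j' → j = j')
    (fits : ∀ j ∈ J, Fits G n A B e (ρ (p j)) j (p j) (φ j))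
    (hflip : ∀ j ∈ J, ρ (p j + 1) = xor (!ρ (p j)) (φ j))
    (halt : ∀ i, (∀ j ∈ J, p j ≠ i) → ρ (i + 1) = !ρ i) :
    IsCore G A B e ρ (place e J p) := by
  have key : ∀ {i i' : ZMod n} {x x' : V}, (i, x) ∈ place e J p → (i', x') ∈ place e J p →
      ∀ t : ℕ, t ≤ 4 → i + t = i' → ∃ j ∈ J,
        (t = 0 ∧ x = x') ∨
        (t = 1 ∧ j.isRight = true ∧ i = p j ∧ first (e (p j)) j = x ∧
          second (e (p j)) j = x') := by
    intro i i' x x' hi hi' t ht h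
    obtain ⟨j, hj, hji⟩ := mem_place.1 hi
    obtain ⟨j', hj', hji'⟩ := mem_place.1 hi'
    refine ⟨j, hj, ?_⟩
    rcases hji with ⟨h1, h2⟩ | ⟨h0, h1, h2⟩ <;> rcases hji' with ⟨h1', h2'⟩ | ⟨h0', h1', h2'⟩
    · obtain ⟨rfl, h3⟩ := eq_of_far hn far hj hj' (d := 0) (d' := 0) (by omega) (by omega) ht
        (by simp [h1, h1', h])
      exact Or.inl ⟨by omega, h2.symm.trans h2'⟩
    · obtain ⟨rfl, h3⟩ := eq_of_far hn far hj hj' (d := 0) (d' := 1) (by omega) (by omega) ht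
        (by simp [h1, h1', h])
      exact Or.inr ⟨by omega, h0', h1.symm, h2, h2'⟩
    · obtain ⟨rfl, h3⟩ := eq_of_far hn far hj hj' (d := 1) (d' := 0) (by omega) (by omega) ht
        (by simp [h1, h1', h])
      omega
    · obtain ⟨rfl, h3⟩ := eq_of_far hn far hj hj' (d := 1) (d' := 1) (by omega) (by omega) ht
        (by simp [h1, h1', h])
      exact Or.inl ⟨by omega, h2.symm.trans h2'⟩
  have hfs : ∀ j ∈ J, j.isRight = true → ∀ b, first b j ≠ second b j := by
    intro j hj hr b hb
    rcases j with v | q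
    · simp at hr
    · have := (fits _ hj).adj q rfl
      have hq : q.1 = q.2 := by
        cases b <;> simp [first, second] at hb
        · exact hb.symm
        · exact hb
      rw [hq] at this
      exact hG _ this
  have hverts : ∀ {i : ZMod n} {x : V} {j}, ((p j = i ∧ first (e (p j)) j = x) ∨
      (j.isRight = true ∧ p j + 1 = i ∧ second (e (p j)) j = x)) → x ∈ verts j := by
    rintro i x j (⟨-, rfl⟩ | ⟨-, -, rfl⟩)
    · exact first_mem_verts _ j
    · exact second_mem_verts _ j
  refine ⟨⟨?_, ?_, ?_⟩, ?_, ?_, ?_, ?_⟩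
  · rintro ⟨i, x⟩ hr ⟨i', x'⟩ hr' (hii : i = i')
    subst hii
    obtain ⟨j, hj, h | h⟩ := key hr hr' 0 (by omega) (by simp)
    · rw [h.2]
    · omega
  · rintro ⟨i, x⟩ hr ⟨i', x'⟩ hr' (hxx : x = x')
    subst hxx
    obtain ⟨j, hj, hji⟩ := mem_place.1 hr
    obtain ⟨j', hj', hji'⟩ := mem_place.1 hr'
    obtain rfl := disj j hj j' hj' x (hverts hji) (hverts hji')
    refine Prod.ext ?_ rfl
    rcases hji with ⟨h1, h2⟩ | ⟨h0, h1, h2⟩ <;> rcases hji' with ⟨h1', h2'⟩ | ⟨h0', h1', h2'⟩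
    · exact h1.symm.trans h1'
    · exact (hfs j hj h0' _ (h2.trans h2'.symm)).elim
    · exact (hfs j hj h0 _ (h2'.trans h2.symm)).elim
    · exact h1.symm.trans h1'
  · intro i x y hx hy
    obtain ⟨j, hj, h | ⟨-, hr, rfl, rfl, rfl⟩⟩ := key hx hy 1 (by omega) (by simp)
    · omega
    · rcases j with v | q
      · simp at hr
      · exact arc_first_second ((fits _ hj).adj q rfl)
  · intro i hi _
    exact halt i fun j hj hji => hi (mem_dom_place.2 ⟨j, hj, Or.inl hji⟩)
  · intro i x hx hi1
    obtain ⟨j, hj, ⟨rfl, rfl⟩ | ⟨h0, rfl, rfl⟩⟩ := mem_place.1 hx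
    · rw [hflip j hj]
      refine (fits j hj).single ?_
      by_contra hr
      exact hi1 (mem_dom_place.2 ⟨j, hj, Or.inr ⟨by simpa using hr, rfl⟩⟩)
    · have h1 : ρ (p j + 1 + 1) = !ρ (p j + 1) := halt _ fun j' hj' hjj => by
        have := (eq_of_far hn far hj hj' (d := 0) (d' := 0) (t := 1) (by omega) (by omega)
          (by omega) (by simp [hjj])).2
        omega
      rw [h1, hflip j hj]
      have := (fits j hj).pair h0
      cases hρ : ρ (p j) <;> cases hφ : φ j <;> simpa [hρ, hφ] using this
  · intro i x hx hi
    obtain ⟨j, hj, ⟨h1, rfl⟩ | ⟨h0, h1, rfl⟩⟩ := mem_place.1 hx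
    · have h2 := halt i fun j hj hji => hi (mem_dom_place.2 ⟨j, hj, Or.inl hji⟩)
      have h3 := (fits j hj).left
      rw [h1, h2] at h3
      rw [h1]
      simpa using h3
    · have : p j = i := by simpa using h1
      exact (hi (mem_dom_place.2 ⟨j, hj, Or.inl this⟩)).elim
  · intro i hi _
    obtain ⟨x, hx⟩ := mem_dom.1 hi
    constructor
    · intro hi2
      obtain ⟨y, hy⟩ := mem_dom.1 hi2
      obtain ⟨j, hj, h | h⟩ := key hx hy 2 (by omega) (by simp) <;> omega
    · intro hi2
      obtain ⟨y, hy⟩ := mem_dom.1 hi2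
      obtain ⟨j, hj, h | h⟩ := key hx hy 3 (by omega) (by simp) <;> omega

theorem sum_place (hn : 6 < n) (far : ∀ j ∈ J, ∀ j' ∈ J, j ≠ j' → Far (p j) (p j'))
    (g : ZMod n × V → ℤ) :
    ∑ r ∈ place e J p, g r = ∑ j ∈ J, (g (p j, first (e (p j)) j) +
      if j.isRight = true then g (p j + 1, second (e (p j)) j) else 0) := by
  rw [place, Finset.sum_union, Finset.sum_image, Finset.sum_image, Finset.sum_filter,
    Finset.sum_add_distrib]
  · intro j hj j' hj' h
    exact (eq_of_far hn far (Finset.mem_filter.1 hj).1 (Finset.mem_filter.1 hj').1 (d := 0)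
      (d' := 0) (t := 0) (by omega) (by omega) (by omega) (by simpa using (Prod.mk.inj h).1)).1
  · intro j hj j' hj' h
    exact (eq_of_far hn far hj hj' (d := 0)
      (d' := 0) (t := 0) (by omega) (by omega) (by omega) (by simpa using (Prod.mk.inj h).1)).1
  · rw [Finset.disjoint_left]
    intro r hr hr'
    obtain ⟨j, hj, rfl⟩ := Finset.mem_image.1 hr
    obtain ⟨j', hj', h⟩ := Finset.mem_image.1 hr'
    have := (eq_of_far hn far hj (Finset.mem_filter.1 hj').1 (d := 0)
      (d' := 1) (t := 0) (by omega) (by omega) (by omega)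
      (by simpa using (Prod.mk.inj h).1.symm)).2
    omega

/-- Consecutive signs cancel except across a flip, where they agree. Summing `sgn (ρ (i + 1)) + sgn
(ρ i)` round the cycle counts every sign twice. -/
theorem sum_sgn_eq [NeZero n] (hn : 6 < n)
    (far : ∀ j ∈ J, ∀ j' ∈ J, j ≠ j' → Far (p j) (p j'))
    (hflip : ∀ j ∈ J, ρ (p j + 1) = xor (!ρ (p j)) (φ j))
    (halt : ∀ i, (∀ j ∈ J, p j ≠ i) → ρ (i + 1) = !ρ i) :
    ∑ i, sgn (ρ i) = ∑ j ∈ J, if φ j then sgn (ρ (p j)) else 0 := by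
  have h1 : ∀ i, sgn (ρ (i + 1)) + sgn (ρ i) =
      ∑ j ∈ J, if p j = i then (if φ j then 2 * sgn (ρ (p j)) else 0) else 0 := by
    intro i
    by_cases hi : ∃ j ∈ J, p j = i
    · obtain ⟨j, hj, rfl⟩ := hi
      rw [Finset.sum_eq_single_of_mem j hj, hflip j hj]
      · cases ρ (p j) <;> cases φ j <;> simp [sgn]
      · intro j' hj' hne
        rw [if_neg]
        intro hp
        exact hne (eq_of_far hn far hj' hj (d := 0) (d' := 0) (t := 0) (by omega) (by omega)
          (by omega) (by simpa using hp)).1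
    · push Not at hi
      rw [halt i hi, Finset.sum_eq_zero fun j hj => if_neg (hi j hj)]
      cases ρ i <;> simp [sgn]
  have h2 : ∑ i, sgn (ρ (i + 1)) = ∑ i, sgn (ρ i) :=
    Equiv.sum_comp (Equiv.addRight (1 : ZMod n)) fun i => sgn (ρ i)
  have h3 : ∑ i, (sgn (ρ (i + 1)) + sgn (ρ i)) =
      ∑ j ∈ J, if φ j then 2 * sgn (ρ (p j)) else 0 := by
    rw [Finset.sum_congr rfl fun i _ => h1 i, Finset.sum_comm]
    refine Finset.sum_congr rfl fun j _ => ?_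
    rw [Finset.sum_ite_eq]
    simp
  rw [Finset.sum_add_distrib, h2] at h3
  have h4 : ∑ j ∈ J, (if φ j then 2 * sgn (ρ (p j)) else 0) =
      2 * ∑ j ∈ J, if φ j then sgn (ρ (p j)) else 0 := by
    rw [Finset.mul_sum]
    refine Finset.sum_congr rfl fun j _ => ?_
    split_ifs <;> simp
  linarith

theorem sum_sgn_filter {α : Type*} (s : Finset α) (g : α → Bool) :
    ∑ i ∈ s, sgn (g i) = 2 * ((s.filter fun i => g i = true).card : ℤ) - s.card := by
  have : ∀ i, sgn (g i) = 2 * (if g i = true then 1 else 0) - 1 := by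
    intro i
    cases g i <;> simp [sgn]
  rw [Finset.sum_congr rfl fun i _ => this i, Finset.sum_sub_distrib, ← Finset.mul_sum,
    Finset.sum_boole]
  simp

theorem Frame.card_add [Fintype V] (fr : Frame G n k A B S T) :
    A.card + B.card + S.card + T.card = n := by
  rw [← fr.card_eq, ← Finset.card_univ, ← Finset.card_union_of_disjoint fr.disjoint_AB,
    ← Finset.card_union_of_disjoint, ← Finset.card_union_of_disjoint]
  · congr 1
    ext x
    have := fr.cover x
    simp only [Finset.mem_union, Finset.mem_univ, iff_true]
    tauto
  · exact Finset.disjoint_union_left.2 ⟨Finset.disjoint_union_left.2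
      ⟨fr.disjoint_AT, fr.disjoint_BT⟩, fr.disjoint_ST⟩
  · exact Finset.disjoint_union_left.2 ⟨fr.disjoint_AS, fr.disjoint_BS⟩

/-- Items whose charges add up to `|A| - |B|` and which cover `S ∪ T` yield an embedding. -/
theorem exists_embedding_of_items [Fintype V] [NeZero n] (fr : Frame G n k A B S T)
    (far : ∀ j ∈ J, ∀ j' ∈ J, j ≠ j' → Far (p j) (p j'))
    (disj : ∀ j ∈ J, ∀ j' ∈ J, ∀ x, x ∈ verts j → x ∈ verts j' → j = j')
    (fits : ∀ j ∈ J, Fits G n A B e (ρ (p j)) j (p j) (φ j))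
    (hflip : ∀ j ∈ J, ρ (p j + 1) = xor (!ρ (p j)) (φ j))
    (halt : ∀ i, (∀ j ∈ J, p j ≠ i) → ρ (i + 1) = !ρ i)
    (hS : ∀ x ∈ S, ∃ j ∈ J, x ∈ verts j) (hT : ∀ x ∈ T, ∃ j ∈ J, x ∈ verts j)
    (hJ : J.card ≤ 5 * k)
    (hcharge : ∑ j ∈ J, charge A B (ρ (p j)) (φ j) j = (A.card : ℤ) - B.card) :
    ∃ f : ZMod n → V, Function.Injective f ∧ ∀ i, G.Arc (e i) (f i) (f (i + 1)) := by
  have hn : 6 < n := by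
    have := fr.one_le
    have := fr.large
    omega
  have hcore := isCore_place hn fr.loopless far disj fits hflip halt
  have hran : ∀ x, (∃ j ∈ J, x ∈ verts j) → x ∈ ran (place e J p) := by
    rintro x ⟨j, hj, hx⟩
    rw [mem_ran]
    rcases mem_verts (e (p j)) hx with h | h
    · exact ⟨_, mem_place.2 ⟨j, hj, Or.inl ⟨rfl, h.symm⟩⟩⟩
    · exact ⟨_, mem_place.2 ⟨j, hj, Or.inr ⟨h.1, rfl, h.2.symm⟩⟩⟩
  refine hcore.exists_embedding fr ?_ ?_ (fun x hx => hran x (hS x hx)) fun x hx =>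
    hran x (hT x hx)
  · set R := place e J p with hR
    have h1 := sum_sgn_eq hn far hflip halt
    -- A charge consists of the sign contributed by a flip, minus the signs of the positions
    -- occupied, plus the weights of the vertices used.
    have h2 : ∑ j ∈ J, charge A B (ρ (p j)) (φ j) j =
        ∑ i, sgn (ρ i) - ∑ r ∈ R, sgn (ρ r.1) + ∑ r ∈ R, weight A B r.2 := by
      rw [h1, hR, sum_place hn far, sum_place hn far, ← Finset.sum_sub_distrib,
        ← Finset.sum_add_distrib]
      refine Finset.sum_congr rfl fun j hj => ?_
      simp only [hflip j hj]
      rcases j with v | ⟨x, y⟩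
      · simp only [charge, first, Sum.isRight_inl, Bool.false_eq_true, if_false]
        split_ifs <;> ring
      · simp only [charge, first, second, Sum.isRight_inr, if_true]
        cases ρ (p (Sum.inr (x, y))) <;> cases φ (Sum.inr (x, y)) <;>
          cases e (p (Sum.inr (x, y))) <;> simp [sgn] <;> ring
    rw [hcharge, sum_sgn_filter, sum_sgn_filter] at h2
    have h3 : ∑ r ∈ R, weight A B r.2 = ((R.filter fun r => r.2 ∈ A).card : ℤ) -
        (R.filter fun r => r.2 ∈ B).card := by
      simp only [weight, Finset.sum_sub_distrib, Finset.sum_boole]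
    have hfull : ∀ X : Finset V, (∀ x ∈ X, ∃ j ∈ J, x ∈ verts j) →
        (R.filter fun r => r.2 ∈ X).card = X.card := by
      intro X hX
      have h4 := hcore.card_sdiff_ran X
      rw [Finset.filter_false_of_mem] at h4
      · simpa using h4
      · exact fun x hx h => h (hran x (hX x hx))
    have h5 : R.card = (R.filter fun r => r.2 ∈ A).card + (R.filter fun r => r.2 ∈ B).card +
        (R.filter fun r => r.2 ∈ S).card + (R.filter fun r => r.2 ∈ T).card := by
      rw [← Finset.card_union_of_disjoint, ← Finset.card_union_of_disjoint,
        ← Finset.card_union_of_disjoint]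
      · congr 1
        ext r
        have := fr.cover r.2
        simp only [Finset.mem_union, Finset.mem_filter]
        tauto
      all_goals
        rw [Finset.disjoint_left]
        intro r hr hr'
        simp only [Finset.mem_union, Finset.mem_filter] at hr hr'
      · rcases hr with (hr | hr) | hr
        · exact Finset.disjoint_left.1 fr.disjoint_AT hr.2 hr'.2
        · exact Finset.disjoint_left.1 fr.disjoint_BT hr.2 hr'.2
        · exact Finset.disjoint_left.1 fr.disjoint_ST hr.2 hr'.2
      · rcases hr with hr | hr
        · exact Finset.disjoint_left.1 fr.disjoint_AS hr.2 hr'.2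
        · exact Finset.disjoint_left.1 fr.disjoint_BS hr.2 hr'.2
      · exact Finset.disjoint_left.1 fr.disjoint_AB hr.2 hr'.2
    have h6 := fr.card_add
    rw [hfull S hS, hfull T hT] at h5
    rw [h3] at h2
    simp only [Finset.card_univ, ZMod.card] at h2
    unfold Balanced
    omega
  · have h1 := Finset.card_union_le (J.image fun j => (p j, first (e (p j)) j))
      ((J.filter fun j => j.isRight = true).image fun j => (p j + 1, second (e (p j)) j))
    have h2 := Finset.card_image_le (s := J) (f := fun j => (p j, first (e (p j)) j))
    have h3 := Finset.card_image_le (s := J.filter fun j => j.isRight = true)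
      (f := fun j => (p j + 1, second (e (p j)) j))
    have h4 := Finset.card_filter_le J fun j => j.isRight = true
    exact h1.trans (by omega)

end Items

/-! ### Roles determined by a set of flips, and the choice of flip positions. -/

noncomputable section Roles

open scoped Classical

variable {V : Type*} {n k : ℕ} {G : Digraph V} {A B S T : Finset V} {e : ZMod n → Bool}

/-- The roles along a path which starts with role `!c` and whose roles alternate except after the
positions in `P`. -/
def role (c : Bool) (P : Finset ℕ) (i : ℕ) : Bool :=
  xor c (decide ((i + (P.filter fun q => q < i).card) % 2 = 1))

theorem role_succ (c : Bool) (P : Finset ℕ) (i : ℕ) :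
    role c P (i + 1) = xor (!role c P i) (decide (i ∈ P)) := by
  have h : (P.filter fun q => q < i + 1).card =
      (P.filter fun q => q < i).card + if i ∈ P then 1 else 0 := by
    have h1 : (P.filter fun q => q < i + 1) =
        (P.filter fun q => q < i) ∪ P.filter fun q => q = i := by
      ext q
      simp only [Finset.mem_filter, Finset.mem_union]
      constructor
      · rintro ⟨h1, h2⟩
        rcases Nat.lt_succ_iff_lt_or_eq.1 h2 with h | h
        · exact Or.inl ⟨h1, h⟩
        · exact Or.inr ⟨h1, h⟩
      · rintro (⟨h1, h2⟩ | ⟨h1, h2⟩)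
        · exact ⟨h1, by omega⟩
        · exact ⟨h1, by omega⟩
    rw [h1, Finset.card_union_of_disjoint, Finset.filter_eq']
    · split_ifs <;> simp
    · rw [Finset.disjoint_left]
      intro q hq hq'
      have := (Finset.mem_filter.1 hq).2
      have := (Finset.mem_filter.1 hq').2
      omega
  unfold role
  rw [h]
  by_cases hi : i ∈ P
  · have h2 : (i + 1 + ((P.filter fun q => q < i).card + 1)) % 2 =
        (i + (P.filter fun q => q < i).card) % 2 := by omega
    simp [hi, h2]
  · simp only [hi, if_false, add_zero, decide_false, Bool.xor_false]
    rcases Nat.mod_two_eq_zero_or_one (i + (P.filter fun q => q < i).card) with h2 | h2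
    · have h3 : (i + 1 + (P.filter fun q => q < i).card) % 2 = 1 := by omega
      simp [h2, h3]
    · have h3 : (i + 1 + (P.filter fun q => q < i).card) % 2 = 0 := by omega
      simp [h2, h3]

theorem role_congr {c : Bool} {P P' : Finset ℕ} {i : ℕ}
    (h : ∀ q, q < i → (q ∈ P ↔ q ∈ P')) : role c P i = role c P' i := by
  unfold role
  rw [show (P.filter fun q => q < i) = P'.filter fun q => q < i from ?_]
  ext q
  simp only [Finset.mem_filter]
  constructor
  · rintro ⟨h1, h2⟩
    exact ⟨(h q h2).1 h1, h2⟩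
  · rintro ⟨h1, h2⟩
    exact ⟨(h q h2).2 h1, h2⟩

/-- The only step not covered by `role_succ` is the one from `n - 1` back to `0`; the parity
condition makes the role computed at `n` agree with that at `0`. -/
theorem role_val_succ [NeZero n] {c : Bool} {P : Finset ℕ} (hP : ∀ q ∈ P, q < n)
    (hpar : (n + P.card) % 2 = 0) (i : ZMod n) :
    role c P (i + 1).val = xor (!role c P i.val) (decide (i.val ∈ P)) := by
  rw [← role_succ]
  have hi := ZMod.val_lt i
  by_cases hn : n = 1
  · subst hn
    have h0 : i.val = 0 := by omega
    have h1 : (i + 1).val = 0 := by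
      have := ZMod.val_lt (i + 1)
      omega
    have h2 : (P.filter fun q => q < 0 + 1) = P :=
      Finset.filter_true_of_mem fun q hq => by simpa using hP q hq
    rw [h0, h1]
    unfold role
    rw [h2]
    have h3 : (0 + 1 + P.card) % 2 = 0 := by omega
    simp [h3]
  · have h1 : (1 : ZMod n).val = 1 := by
      have : Fact (1 < n) := ⟨by have := NeZero.ne n; omega⟩
      exact ZMod.val_one n
    by_cases hlt : i.val + 1 < n
    · rw [ZMod.val_add_of_lt (by rwa [h1]), h1]
    · have h2 : i.val + 1 = n := by omega
      have h3 : (i + 1).val = 0 := by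
        rw [ZMod.val_add, h1, h2, Nat.mod_self]
      rw [h2, h3]
      unfold role
      rw [Finset.filter_true_of_mem hP]
      simp [hpar]

/-- Exceptional positions can be chosen one after another, each depending on the roles which
result from the previous ones. -/
theorem exists_positions {α : Type*} (J : Finset α) (c : Bool) (l u : ℕ → ℕ)
    (hlu : ∀ b b', b < b' → b' < J.card → u b + 6 ≤ l b') (Q : α → ℕ → Bool → Prop)
    (hQ : ∀ j ∈ J, ∀ b < J.card, ∀ r, ∃ p, l b ≤ p ∧ p ≤ u b ∧
      Q j p (xor r (decide (p % 2 = 1)))) :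
    ∃ q : α → ℕ, (∀ j ∈ J, ∃ b < J.card, l b ≤ q j ∧ q j ≤ u b) ∧
      (∀ j ∈ J, Q j (q j) (role c (J.image q) (q j))) ∧
      ∀ j ∈ J, ∀ j' ∈ J, j ≠ j' → q j + 6 ≤ q j' ∨ q j' + 6 ≤ q j := by
  let idx : α → ℕ := fun j => if h : j ∈ J then (J.equivFin ⟨j, h⟩ : ℕ) else 0
  have hidx : ∀ j ∈ J, idx j < J.card := fun j hj => by
    simp only [idx, hj, dif_pos]
    exact (J.equivFin ⟨j, hj⟩).2
  have hinj : Set.InjOn idx J := by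
    intro j hj j' hj' h
    have hj1 : j ∈ J := hj
    have hj2 : j' ∈ J := hj'
    simp only [idx, hj1, hj2, dif_pos] at h
    simpa using J.equivFin.injective (Fin.ext h)
  have hsurj : ∀ b < J.card, ∃ j ∈ J, idx j = b := fun b hb => by
    refine ⟨(J.equivFin.symm ⟨b, hb⟩ : J), (J.equivFin.symm ⟨b, hb⟩).2, ?_⟩
    simp [idx]
  -- The item in window `b` is preceded by exactly `b` flips, wherever these lie in their windows.
  -- Its role depends only on `c` and the parities of `b` and `p`, so the windows can be treated
  -- independently.
  have hex : ∀ j, ∃ p, j ∈ J → l (idx j) ≤ p ∧ p ≤ u (idx j) ∧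
      Q j p (xor (xor c (decide (idx j % 2 = 1))) (decide (p % 2 = 1))) := fun j => by
    by_cases hj : j ∈ J
    · obtain ⟨p, hp⟩ := hQ j hj (idx j) (hidx j hj) (xor c (decide (idx j % 2 = 1)))
      exact ⟨p, fun _ => hp⟩
    · exact ⟨0, fun h => (hj h).elim⟩
  choose q hq using hex
  have hmono : ∀ j ∈ J, ∀ j' ∈ J, idx j < idx j' → q j + 6 ≤ q j' := by
    intro j hj j' hj' h
    have h1 := hlu _ _ h (hidx j' hj')
    have h2 := (hq j hj).2.1
    have h3 := (hq j' hj').1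
    omega
  have hsep : ∀ j ∈ J, ∀ j' ∈ J, j ≠ j' → q j + 6 ≤ q j' ∨ q j' + 6 ≤ q j := by
    intro j hj j' hj' hne
    rcases lt_trichotomy (idx j) (idx j') with h | h | h
    · exact Or.inl (hmono j hj j' hj' h)
    · exact (hne (hinj hj hj' h)).elim
    · exact Or.inr (hmono j' hj' j hj h)
  refine ⟨q, fun j hj => ⟨idx j, hidx j hj, (hq j hj).1, (hq j hj).2.1⟩, ?_, hsep⟩
  intro j hj
  have hcard : ((J.image q).filter fun p => p < q j).card = idx j := by
    have h1 : ((J.image q).filter fun p => p < q j) =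
        (J.filter fun j' => idx j' < idx j).image q := by
      ext p
      simp only [Finset.mem_filter, Finset.mem_image]
      constructor
      · rintro ⟨⟨j', hj', rfl⟩, hlt⟩
        refine ⟨j', ⟨hj', ?_⟩, rfl⟩
        by_contra hcon
        rcases lt_or_eq_of_le (not_lt.1 hcon) with h | h
        · have := hmono j hj j' hj' h
          omega
        · rw [hinj hj hj' h] at hlt
          omega
      · rintro ⟨j', ⟨hj', h⟩, rfl⟩
        have := hmono j' hj' j hj h
        exact ⟨⟨j', hj', rfl⟩, by omega⟩
    have h2 : (J.filter fun j' => idx j' < idx j).image idx = Finset.range (idx j) := by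
      ext b
      simp only [Finset.mem_filter, Finset.mem_image, Finset.mem_range]
      constructor
      · rintro ⟨j', ⟨-, h⟩, rfl⟩
        exact h
      · intro hb
        obtain ⟨j', hj', rfl⟩ := hsurj b (hb.trans (hidx j hj))
        exact ⟨j', ⟨hj', hb⟩, rfl⟩
    rw [h1, Finset.card_image_of_injOn, ← Finset.card_image_of_injOn (f := idx), h2,
      Finset.card_range]
    · exact hinj.mono fun x hx => (Finset.mem_filter.1 hx).1
    · intro x hx y hy hxy
      by_contra hne
      have := hsep x (Finset.mem_filter.1 hx).1 y (Finset.mem_filter.1 hy).1 hne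
      omega
  have h := (hq j hj).2.2
  unfold role
  rw [hcard]
  convert h using 1
  rcases Nat.mod_two_eq_zero_or_one (idx j) with h1 | h1 <;>
    rcases Nat.mod_two_eq_zero_or_one (q j) with h2 | h2
  · simp [h1, h2, show (q j + idx j) % 2 = 0 by omega]
  · simp [h1, h2, show (q j + idx j) % 2 = 1 by omega]
  · simp [h1, h2, show (q j + idx j) % 2 = 1 by omega]
  · simp [h1, h2, show (q j + idx j) % 2 = 0 by omega]

/-- The second bound keeps `q` away from the end of the cycle, so that the distance is also large
the other way round. -/
theorem far_natCast {p q : ℕ} (hpq : p + 6 ≤ q) (hq : q + 6 ≤ n) :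
    Far (p : ZMod n) (q : ZMod n) := by
  intro t ht
  constructor
  · intro h
    refine natCast_ne_zero_of_lt (n := n) (t := q - p + t) (by omega) (by omega) ?_
    rw [Nat.cast_add, Nat.cast_sub (by omega), h]
    ring
  · intro h
    refine natCast_ne_zero_of_lt (n := n) (t := q - p - t) (by omega) (by omega) ?_
    rw [Nat.cast_sub (by omega), Nat.cast_sub (by omega), h]
    ring

/-- Items at exceptional positions, and items which have many possible positions with the same
charge, together yield an embedding. -/
theorem exists_embedding_of_flips [Fintype V] [NeZero n] (fr : Frame G n k A B S T) (c : Bool)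
    (JF JN : Finset (V ⊕ V × V)) (q : V ⊕ V × V → ℕ) (cand : V ⊕ V × V → Finset (ZMod n))
    (κ : V ⊕ V × V → ℤ)
    (hpar : (n + JF.card) % 2 = 0)
    (hsep : ∀ j ∈ JF, ∀ j' ∈ JF, j ≠ j' → q j + 6 ≤ q j' ∨ q j' + 6 ≤ q j)
    (hqn : ∀ j ∈ JF, q j + 6 ≤ n)
    (hdisj : ∀ j ∈ JF ∪ JN, ∀ j' ∈ JF ∪ JN, ∀ x, x ∈ verts j → x ∈ verts j' → j = j')
    (hFN : Disjoint JF JN)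
    (fitsF : ∀ j ∈ JF, Fits G n A B e (role c (JF.image q) (q j)) j (q j) true)
    (fitsN : ∀ j ∈ JN, ∀ i ∈ cand j, Fits G n A B e (role c (JF.image q) i.val) j i false ∧
      charge A B (role c (JF.image q) i.val) false j = κ j)
    (hcand : ∀ j ∈ JN, 60 * k ≤ (cand j).card)
    (hS : ∀ x ∈ S, ∃ j ∈ JF ∪ JN, x ∈ verts j) (hT : ∀ x ∈ T, ∃ j ∈ JF ∪ JN, x ∈ verts j)
    (hcard : JF.card + JN.card ≤ 5 * k)
    (hcharge : ∑ j ∈ JF, charge A B (role c (JF.image q) (q j)) true j + ∑ j ∈ JN, κ j =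
      (A.card : ℤ) - B.card) :
    ∃ f : ZMod n → V, Function.Injective f ∧ ∀ i, G.Arc (e i) (f i) (f (i + 1)) := by
  -- The flips already fix all roles, so the other items can be added greedily. At most `5 * k`
  -- items, each blocking twelve positions, account for the bound `60 * k`.
  obtain ⟨π, hπ1, hπ2, hπ3⟩ := exists_far JN cand (JF.image fun j => (q j : ZMod n)) fun j hj => by
    have h1 := hcand j hj
    have h2 := Finset.card_image_le (s := JF) (f := fun j => (q j : ZMod n))
    omega
  have hval : ∀ j ∈ JF, ((q j : ℕ) : ZMod n).val = q j := fun j hj =>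
    ZMod.val_cast_of_lt (by have := hqn j hj; omega)
  have hFN' : ∀ j ∈ JF, j ∉ JN := fun j hj => Finset.disjoint_left.1 hFN hj
  have hcardP : (JF.image q).card = JF.card := Finset.card_image_of_injOn fun j hj j' hj' h => by
    by_contra hne
    have := hsep j hj j' hj' hne
    omega
  have hρ := role_val_succ (n := n) (c := c) (P := JF.image q)
    (fun i hi => by
      obtain ⟨j, hj, rfl⟩ := Finset.mem_image.1 hi
      have := hqn j hj
      omega) (by rw [hcardP]; exact hpar)
  let p : V ⊕ V × V → ZMod n := fun j => if j ∈ JF then (q j : ZMod n) else π j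
  have hpF : ∀ j ∈ JF, p j = q j := fun j hj => if_pos hj
  have hpN : ∀ j ∈ JN, p j = π j := fun j hj => if_neg fun h => hFN' j h hj
  have hnot : ∀ j ∈ JN, (π j).val ∉ JF.image q := by
    intro j hj hmem
    obtain ⟨j', hj', h⟩ := Finset.mem_image.1 hmem
    have h1 := (hπ2 j hj _ (Finset.mem_image_of_mem _ hj') 0 (by omega)).1
    simp [h] at h1
  refine exists_embedding_of_items (J := JF ∪ JN) (p := p) (φ := fun j => decide (j ∈ JF))
    (ρ := fun i => role c (JF.image q) i.val) fr ?_ hdisj ?_ ?_ ?_ hS hT ?_ ?_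
  · intro j hj j' hj' hne
    rcases Finset.mem_union.1 hj with hj | hj <;> rcases Finset.mem_union.1 hj' with hj' | hj'
    · rw [hpF j hj, hpF j' hj']
      rcases hsep j hj j' hj' hne with h | h
      · exact far_natCast h (hqn j' hj')
      · exact (far_natCast h (hqn j hj)).symm
    · rw [hpF j hj, hpN j' hj']
      exact (hπ2 j' hj' _ (Finset.mem_image_of_mem _ hj)).symm
    · rw [hpN j hj, hpF j' hj']
      exact hπ2 j hj _ (Finset.mem_image_of_mem _ hj')
    · rw [hpN j hj, hpN j' hj']
      exact hπ3 j hj j' hj' hne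
  · intro j hj
    rcases Finset.mem_union.1 hj with hj | hj
    · have := fitsF j hj
      simp only [hpF j hj, hval j hj, hj, decide_true]
      exact this
    · have := (fitsN j hj _ (hπ1 j hj)).1
      simp only [hpN j hj, show j ∉ JF from fun h => hFN' j h hj, decide_false]
      exact this
  · intro j hj
    simp only [hρ]
    congr 2
    rcases Finset.mem_union.1 hj with hj | hj
    · simp only [hpF j hj, hval j hj, hj, eq_iff_iff, iff_true]
      exact Finset.mem_image_of_mem q hj
    · simp only [hpN j hj, show j ∉ JF from fun h => hFN' j h hj, eq_iff_iff, iff_false]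
      exact hnot j hj
  · intro i hi
    simp only [hρ]
    rw [decide_eq_false, Bool.xor_false]
    intro hmem
    obtain ⟨j, hj, h⟩ := Finset.mem_image.1 hmem
    refine hi j (Finset.mem_union_left _ hj) ?_
    rw [hpF j hj, h, ZMod.natCast_zmod_val]
  · exact (Finset.card_union_le _ _).trans hcard
  · rw [← hcharge, Finset.sum_union hFN]
    congr 1
    · refine Finset.sum_congr rfl fun j hj => ?_
      simp only [hpF j hj, hval j hj, hj, decide_true]
    · refine Finset.sum_congr rfl fun j hj => ?_
      simp only [hpN j hj, show j ∉ JF from fun h => hFN' j h hj, decide_false]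
      exact (fitsN j hj _ (hπ1 j hj)).2

end Roles

/-! ### Where vertices of `S ∪ T` and edges fit into the cycle. -/

noncomputable section Fitting

open scoped Classical

variable {V : Type*} {n k : ℕ} {G : Digraph V} {A B S T : Finset V} {e : ZMod n → Bool}

/-- At a source only outneighbours matter, at a sink only inneighbours. So a vertex of `S` stands in
for `A` at a source and for `B` at a sink, and a vertex of `T` conversely. -/
theorem fits_turn [Fintype V] (fr : Frame G n k A B S T) {v : V} {i : ZMod n} {r : Bool}
    (he : e (i - 1) = !e i) (hv : (v ∈ S ∧ r = e i) ∨ (v ∈ T ∧ r = !e i)) :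
    Fits G n A B e r (Sum.inl v) i false := by
  refine ⟨by simp, ?_, fun _ => ?_, by simp⟩
  · rcases hv with ⟨hv, rfl⟩ | ⟨hv, rfl⟩
    · simpa [first, he] using fr.many_S v hv (e i)
    · simpa [first, he] using fr.many_T v hv (e i)
  · rcases hv with ⟨hv, rfl⟩ | ⟨hv, rfl⟩
    · simpa [first] using fr.many_S v hv (e i)
    · simpa [first] using fr.many_T v hv (e i)

/-- A directed path enters and leaves `v` through different classes. The two neighbouring positions
then have different roles, which forces a flip. -/
theorem fits_through [Fintype V] (fr : Frame G n k A B S T) {v : V} {i : ZMod n} {r : Bool}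
    (he : e (i - 1) = e i) (hv : (v ∈ S ∧ r = !e i) ∨ (v ∈ T ∧ r = e i)) :
    Fits G n A B e r (Sum.inl v) i true := by
  refine ⟨by simp, ?_, fun _ => ?_, by simp⟩
  · rcases hv with ⟨hv, rfl⟩ | ⟨hv, rfl⟩
    · simpa [first, he] using fr.many_S v hv (!e i)
    · simpa [first, he] using fr.many_T v hv (!e i)
  · rcases hv with ⟨hv, rfl⟩ | ⟨hv, rfl⟩
    · simpa [first] using fr.many_S v hv (e i)
    · simpa [first] using fr.many_T v hv (e i)

theorem Frame.many_B [Fintype V] (fr : Frame G n k A B S T) {v : V} (hv : v ∈ B) (b : Bool) :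
    Many G n A B b v true :=
  fr.many_cls false v (by simpa [cls] using hv) b

/-- Vertices of `B` have many neighbours in `A` in both directions, so the orientation of the cycle
is irrelevant here. -/
theorem fits_edge [Fintype V] (fr : Frame G n k A B S T) {x y : V} {i : ZMod n}
    (hxy : G.Adj x y) (hx : x ∈ B) (hy : y ∈ B) :
    Fits G n A B e false (Sum.inr (x, y)) i true := by
  refine ⟨by simpa using hxy, ?_, by simp, fun _ => ?_⟩
  · apply fr.many_B
    cases e i <;> simpa [first]
  · apply fr.many_B
    cases e i <;> simpa [second]

/-- With turns at both ends, `x` is a source and `y` a sink. Thus `x` may also lie in `T` and `y` in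
`S`. -/
theorem fits_special {x y : V} {i : ZMod n} (hxy : G.Adj x y) (hx : Many G n A B true x true)
    (hy : Many G n A B false y true) (he : e (i - 1) = !e i) (he' : e (i + 1) = !e i) :
    Fits G n A B e false (Sum.inr (x, y)) i true := by
  refine ⟨by simpa using hxy, ?_, by simp, fun _ => ?_⟩
  · rw [he]
    cases e i <;> simpa [first]
  · rw [he']
    cases e i <;> simpa [second]

/-- The pattern is a directed path from `B` through `x` to `y`, read in either direction along the
cycle: `x` takes a position of role `A`, and nothing flips. -/
theorem fits_alternating [Fintype V] (fr : Frame G n k A B S T) {x y : V} {i : ZMod n} {r : Bool}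
    (hxy : G.Adj x y) (hx : x ∈ T) (hy : y ∈ B)
    (he : (e i = true ∧ e (i - 1) = true ∧ r = true) ∨
      (e i = false ∧ e (i + 1) = false ∧ r = false)) :
    Fits G n A B e r (Sum.inr (x, y)) i false := by
  rcases he with ⟨h1, h2, rfl⟩ | ⟨h1, h2, rfl⟩
  · refine ⟨by simpa using hxy, ?_, by simp, fun _ => ?_⟩
    · simpa [first, h1, h2] using fr.many_T x hx false
    · simpa [second, h1] using fr.many_B hy _
  · refine ⟨by simpa using hxy, ?_, by simp, fun _ => ?_⟩
    · simpa [first, h1] using fr.many_B hy _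
    · simpa [second, h1, h2] using fr.many_T x hx false

/-- Up to reversal the pattern is `A ← x → y → B`: the outer roles differ with two positions between
them, as alternation demands. -/
theorem fits_crossing [Fintype V] (fr : Frame G n k A B S T) {x y : V} {i : ZMod n} {r : Bool}
    (hxy : G.Adj x y) (hx : x ∈ T) (hy : y ∈ S)
    (he : e (i - 1) = false ∧ e i = !r ∧ e (i + 1) = true) :
    Fits G n A B e r (Sum.inr (x, y)) i false := by
  obtain ⟨h1, h2, h3⟩ := he
  cases r
  · refine ⟨by simpa using hxy, ?_, by simp, fun _ => ?_⟩
    · simpa [first, h1, h2] using fr.many_T x hx true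
    · simpa [second, h2, h3] using fr.many_S y hy true
  · refine ⟨by simpa using hxy, ?_, by simp, fun _ => ?_⟩
    · simpa [first, h1, h2] using fr.many_S y hy true
    · simpa [second, h2, h3] using fr.many_T x hx true

theorem Frame.weight_B [Fintype V] (fr : Frame G n k A B S T) {x : V} (hx : x ∈ B) :
    weight A B x = -1 := by
  simp [weight, hx, Finset.disjoint_right.1 fr.disjoint_AB hx]

theorem Frame.weight_S [Fintype V] (fr : Frame G n k A B S T) {x : V} (hx : x ∈ S) :
    weight A B x = 0 := by
  simp [weight, Finset.disjoint_right.1 fr.disjoint_AS hx, Finset.disjoint_right.1 fr.disjoint_BS hx]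

theorem Frame.weight_T [Fintype V] (fr : Frame G n k A B S T) {x : V} (hx : x ∈ T) :
    weight A B x = 0 := by
  simp [weight, Finset.disjoint_right.1 fr.disjoint_AT hx, Finset.disjoint_right.1 fr.disjoint_BT hx]

/-- If the exceptional items have been placed and there are many turns in the required worlds, then
the remaining vertices of `S ∪ T` can be placed at turns. -/
theorem exists_embedding_of_turns [Fintype V] [NeZero n] (fr : Frame G n k A B S T) (c : Bool)
    (JF : Finset (V ⊕ V × V)) (q : V ⊕ V × V → ℕ)
    (hpar : (n + JF.card) % 2 = 0)
    (hsep : ∀ j ∈ JF, ∀ j' ∈ JF, j ≠ j' → q j + 6 ≤ q j' ∨ q j' + 6 ≤ q j)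
    (hqn : ∀ j ∈ JF, q j + 6 ≤ n)
    (hdisj : ∀ j ∈ JF, ∀ j' ∈ JF, ∀ x, x ∈ verts j → x ∈ verts j' → j = j')
    (fitsF : ∀ j ∈ JF, Fits G n A B e (role c (JF.image q) (q j)) j (q j) true)
    (Z : Finset V) (hZ : ∀ x, x ∈ Z ↔ (x ∈ S ∨ x ∈ T) ∧ ∀ j ∈ JF, x ∉ verts j)
    (hcandS : S.Nonempty → ∀ b, 60 * k ≤ (Finset.univ.filter fun i : ZMod n =>
      e (i - 1) = !e i ∧ e i = b ∧ role c (JF.image q) i.val = e i).card)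
    (hcandT : T.Nonempty → ∀ b, 60 * k ≤ (Finset.univ.filter fun i : ZMod n =>
      e (i - 1) = !e i ∧ e i = b ∧ role c (JF.image q) i.val = !e i).card)
    (hcard : JF.card ≤ 4 * k) (m : ℕ) (hm : m ≤ Z.card)
    (hcharge : ∑ j ∈ JF, charge A B (role c (JF.image q) (q j)) true j =
      (A.card : ℤ) - B.card + 2 * m - Z.card) :
    ∃ f : ZMod n → V, Function.Injective f ∧ ∀ i, G.Arc (e i) (f i) (f (i + 1)) := by
  -- The `m` vertices of `Y` get charge `-1` and the others charge `1`, by choosing between sources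
  -- and sinks; in total this is `|Z| - 2 * m`.
  obtain ⟨Y, hYZ, hY⟩ := Finset.exists_subset_card_eq hm
  have hZcard : Z.card ≤ k := by
    have h1 : Z ⊆ S ∪ T := fun x hx => Finset.mem_union.2 ((hZ x).1 hx).1
    have h2 := Finset.card_le_card h1
    have h3 := Finset.card_union_le S T
    have := fr.ST_le
    omega
  have hmemN : ∀ j ∈ Z.image (Sum.inl : V → V ⊕ V × V), ∃ v ∈ Z, j = Sum.inl v := by
    intro j hj
    obtain ⟨v, hv, rfl⟩ := Finset.mem_image.1 hj
    exact ⟨v, hv, rfl⟩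
  have hverts : ∀ v x : V, x ∈ verts (Sum.inl v : V ⊕ V × V) ↔ x = v := by
    intro v x
    simp [verts, first, second]
  have hTS : ∀ v ∈ T, v ∉ S := fun v hv => Finset.disjoint_right.1 fr.disjoint_ST hv
  have hcover : ∀ x, x ∈ S ∨ x ∈ T →
      ∃ j ∈ JF ∪ Z.image (Sum.inl : V → V ⊕ V × V), x ∈ verts j := by
    intro x hx
    by_cases hxZ : x ∈ Z
    · exact ⟨Sum.inl x, Finset.mem_union_right _ (Finset.mem_image_of_mem _ hxZ),
        (hverts x x).2 rfl⟩
    · rw [hZ] at hxZ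
      push Not at hxZ
      obtain ⟨j, hj, hxj⟩ := hxZ hx
      exact ⟨j, Finset.mem_union_left _ hj, hxj⟩
  let cand : V → Finset (ZMod n) := fun v => Finset.univ.filter fun i : ZMod n =>
    e (i - 1) = !e i ∧ e i = (if v ∈ S then decide (v ∈ Y) else !decide (v ∈ Y)) ∧
      role c (JF.image q) i.val = if v ∈ S then e i else !e i
  let κ : V → ℤ := fun v => if v ∈ Y then -1 else 1
  refine exists_embedding_of_flips (e := e) fr c JF (Z.image Sum.inl) q
    (fun j => cand (first true j)) (fun j => κ (first true j)) hpar hsep hqn ?_ ?_ fitsF ?_ ?_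
    (fun x hx => hcover x (Or.inl hx)) (fun x hx => hcover x (Or.inr hx)) ?_ ?_
  · intro j hj j' hj' x hx hx'
    rcases Finset.mem_union.1 hj with hj | hj <;> rcases Finset.mem_union.1 hj' with hj' | hj'
    · exact hdisj j hj j' hj' x hx hx'
    · obtain ⟨v, hv, rfl⟩ := hmemN j' hj'
      rw [hverts] at hx'
      subst hx'
      exact (((hZ x).1 hv).2 j hj hx).elim
    · obtain ⟨v, hv, rfl⟩ := hmemN j hj
      rw [hverts] at hx
      subst hx
      exact (((hZ x).1 hv).2 j' hj' hx').elim
    · obtain ⟨v, hv, rfl⟩ := hmemN j hj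
      obtain ⟨v', hv', rfl⟩ := hmemN j' hj'
      rw [hverts] at hx hx'
      rw [← hx, ← hx']
  · rw [Finset.disjoint_right]
    intro j hj hjF
    obtain ⟨v, hv, rfl⟩ := hmemN j hj
    exact ((hZ v).1 hv).2 _ hjF ((hverts v v).2 rfl)
  · intro j hj i hi
    obtain ⟨v, hv, rfl⟩ := hmemN j hj
    have hi' : i ∈ cand v := hi
    change _ ∧ _ = κ v
    obtain ⟨-, h1, h2, h3⟩ := Finset.mem_filter.1 hi'
    rcases ((hZ v).1 hv).1 with hvS | hvT
    · rw [if_pos hvS] at h2 h3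
      refine ⟨fits_turn fr h1 (Or.inl ⟨hvS, h3⟩), ?_⟩
      rw [h3, h2]
      simp only [charge, fr.weight_S hvS]
      by_cases hvY : v ∈ Y <;> simp [hvY, sgn, κ]
    · rw [if_neg (hTS v hvT)] at h2 h3
      refine ⟨fits_turn fr h1 (Or.inr ⟨hvT, h3⟩), ?_⟩
      rw [h3, h2]
      simp only [charge, fr.weight_T hvT]
      by_cases hvY : v ∈ Y <;> simp [hvY, sgn, κ]
  · intro j hj
    obtain ⟨v, hv, rfl⟩ := hmemN j hj
    change _ ≤ (cand v).card
    rcases ((hZ v).1 hv).1 with hvS | hvT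
    · simp only [cand, if_pos hvS]
      exact hcandS ⟨v, hvS⟩ _
    · simp only [cand, if_neg (hTS v hvT)]
      exact hcandT ⟨v, hvT⟩ _
  · have := Finset.card_image_le (s := Z) (f := (Sum.inl : V → V ⊕ V × V))
    omega
  · rw [hcharge, Finset.sum_image fun _ _ _ _ h => Sum.inl_injective h]
    change _ + ∑ v ∈ Z, κ v = _
    have h1 : ∀ v, κ v = 1 - 2 * if v ∈ Y then 1 else 0 := by
      intro v
      simp only [κ]
      split_ifs <;> norm_num
    rw [Finset.sum_congr rfl fun v _ => h1 v, Finset.sum_sub_distrib, ← Finset.mul_sum,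
      Finset.sum_boole, Finset.filter_mem_eq_inter, Finset.inter_eq_right.2 hYZ, hY]
    simp

end Fitting

/-! ### Counting turns by kind (source or sink) and world (role equal to the direction or not). -/

section Turns

open scoped Classical

variable {n : ℕ} {e : ZMod n → Bool}

theorem card_filter_val_mem_Ico [NeZero n] {l u : ℕ} (hu : u ≤ n) :
    (Finset.univ.filter fun i : ZMod n => l ≤ i.val ∧ i.val < u).card = u - l := by
  rw [← Nat.card_Ico, ← Finset.card_image_of_injective _ (ZMod.val_injective n)]
  congr 1
  ext m
  simp only [Finset.mem_image, Finset.mem_filter, Finset.mem_univ, true_and, Finset.mem_Ico]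
  constructor
  · rintro ⟨i, h, rfl⟩
    exact h
  · intro h
    have : ((m : ℕ) : ZMod n).val = m := ZMod.val_cast_of_lt (by omega)
    exact ⟨(m : ZMod n), by rwa [this], this⟩

/-- Where roles alternate and few positions are not turns, sources and sinks of the same world are
about equally many. -/
theorem card_turn_le [NeZero n] (ρ : ZMod n → Bool) (F : Finset (ZMod n))
    (hF : ∀ i, i ∉ F → ρ (i + 1) = !ρ i) (b d : Bool) :
    (Finset.univ.filter fun i => e (i - 1) = !e i ∧ e i = b ∧ ρ i = xor (e i) d).card ≤
    (Finset.univ.filter fun i => e (i - 1) = !e i ∧ e i = !b ∧ ρ i = xor (e i) d).card +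
      (Finset.univ.filter fun i => e (i - 1) = e i).card + F.card := by
  -- After a turn, where the role alternates, comes either a through position or a turn of the other
  -- kind in the same world, as direction and role change together.
  have hsub : ((Finset.univ.filter fun i => e (i - 1) = !e i ∧ e i = b ∧
      ρ i = xor (e i) d).image fun i => i + 1) ⊆
      (Finset.univ.filter fun i => e (i - 1) = !e i ∧ e i = !b ∧ ρ i = xor (e i) d) ∪
      (Finset.univ.filter fun i => e (i - 1) = e i) ∪ F.image fun i => i + 1 := by
    intro i hi
    obtain ⟨i, hi', rfl⟩ := Finset.mem_image.1 hi
    obtain ⟨-, h1, h2, h3⟩ := Finset.mem_filter.1 hi'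
    simp only [Finset.mem_union, Finset.mem_filter, Finset.mem_univ, true_and, add_sub_cancel_right]
    by_cases hiF : i ∈ F
    · exact Or.inr (Finset.mem_image_of_mem _ hiF)
    · by_cases he : e i = e (i + 1)
      · exact Or.inl (Or.inr he)
      · have h4 : e (i + 1) = !e i := by
          cases h : e i <;> cases h' : e (i + 1) <;> simp_all
        refine Or.inl (Or.inl ⟨by simp [h4], by rw [h4, h2], ?_⟩)
        rw [hF i hiF, h3, h4]
        simp
  have h1 := Finset.card_le_card hsub
  rw [Finset.card_image_of_injective _ (add_left_injective 1)] at h1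
  have h2 := Finset.card_union_le ((Finset.univ.filter fun i => e (i - 1) = !e i ∧ e i = !b ∧
    ρ i = xor (e i) d) ∪ (Finset.univ.filter fun i => e (i - 1) = e i)) (F.image fun i => i + 1)
  have h3 := Finset.card_union_le (Finset.univ.filter fun i => e (i - 1) = !e i ∧ e i = !b ∧
    ρ i = xor (e i) d) (Finset.univ.filter fun i => e (i - 1) = e i)
  have h4 := Finset.card_image_le (s := F) (f := fun i => i + 1)
  omega

/-- Sources and sinks of one world nearly balance, so each kind makes up about half of that world.
-/
theorem le_card_turn [NeZero n] (ρ : ZMod n → Bool) (F : Finset (ZMod n))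
    (hF : ∀ i, i ∉ F → ρ (i + 1) = !ρ i) (d : Bool) {N : ℕ}
    (hN : N ≤ (Finset.univ.filter fun i => e (i - 1) = !e i ∧ ρ i = xor (e i) d).card) (b : Bool) :
    N ≤ 2 * (Finset.univ.filter fun i => e (i - 1) = !e i ∧ e i = b ∧ ρ i = xor (e i) d).card +
      (Finset.univ.filter fun i => e (i - 1) = e i).card + F.card := by
  have h1 := card_turn_le (e := e) ρ F hF (!b) d
  rw [Bool.not_not] at h1
  have h2 : (Finset.univ.filter fun i => e (i - 1) = !e i ∧ ρ i = xor (e i) d) ⊆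
      (Finset.univ.filter fun i => e (i - 1) = !e i ∧ e i = b ∧ ρ i = xor (e i) d) ∪
      (Finset.univ.filter fun i => e (i - 1) = !e i ∧ e i = !b ∧ ρ i = xor (e i) d) := by
    intro i hi
    simp only [Finset.mem_union, Finset.mem_filter, Finset.mem_univ, true_and] at hi ⊢
    by_cases hb : e i = b
    · exact Or.inl ⟨hi.1, hb, hi.2⟩
    · exact Or.inr ⟨hi.1, by cases b <;> simpa using hb, hi.2⟩
  have h3 := Finset.card_le_card h2
  have h4 := Finset.card_union_le
    (Finset.univ.filter fun i => e (i - 1) = !e i ∧ e i = b ∧ ρ i = xor (e i) d)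
    (Finset.univ.filter fun i => e (i - 1) = !e i ∧ e i = !b ∧ ρ i = xor (e i) d)
  omega

/-- If few positions are not turns, every window contains an edge with role `B` at its start both
of whose ends are turns. -/
theorem exists_antidirected [NeZero n] (c : Bool) (P : Finset ℕ) (L m : ℕ)
    (hP : ∀ p ∈ P, p < L) (hm : (Finset.univ.filter fun i => e (i - 1) = e i).card < m)
    (hL : L + 4 * m ≤ n) :
    ∃ x, L ≤ x ∧ x < L + 4 * m ∧ role c P x = false ∧ e ((x : ZMod n) - 1) = !e x ∧
      e ((x : ZMod n) + 1) = !e x := by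
  by_contra hcon
  push Not at hcon
  -- Cut the window into blocks of four. One of the first two positions of a block has role `B`; if
  -- it does not serve, it or its successor is a through position. Different blocks give different
  -- ones, which is more than there are.
  have hex : ∀ j, ∃ t, j < m → t ≤ 2 ∧
      e (((L + 4 * j + t : ℕ) : ZMod n) - 1) = e ((L + 4 * j + t : ℕ) : ZMod n) := by
    intro j
    by_cases hj : j < m
    · obtain ⟨s, hs, hrole⟩ : ∃ s ≤ 1, role c P (L + 4 * j + s) = false := by
        by_cases h0 : role c P (L + 4 * j) = false
        · exact ⟨0, by omega, h0⟩
        · refine ⟨1, le_rfl, ?_⟩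
          have hnot : L + 4 * j ∉ P := fun h => by
            have := hP _ h
            omega
          rw [role_succ, decide_eq_false hnot]
          simpa using h0
      by_cases h1 : e (((L + 4 * j + s : ℕ) : ZMod n) - 1) = e ((L + 4 * j + s : ℕ) : ZMod n)
      · exact ⟨s, fun _ => ⟨by omega, h1⟩⟩
      · have h1' : e (((L + 4 * j + s : ℕ) : ZMod n) - 1) = !e ((L + 4 * j + s : ℕ) : ZMod n) := by
          revert h1
          cases e (((L + 4 * j + s : ℕ) : ZMod n) - 1) <;>
            cases e ((L + 4 * j + s : ℕ) : ZMod n) <;> simp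
        have h2 := hcon (L + 4 * j + s) (by omega) (by omega) hrole h1'
        refine ⟨s + 1, fun _ => ⟨by omega, ?_⟩⟩
        have h3 : ((L + 4 * j + (s + 1) : ℕ) : ZMod n) = ((L + 4 * j + s : ℕ) : ZMod n) + 1 := by
          push_cast
          ring
        rw [h3, add_sub_cancel_right]
        revert h2
        cases e (((L + 4 * j + s : ℕ) : ZMod n) + 1) <;>
          cases e ((L + 4 * j + s : ℕ) : ZMod n) <;> simp
    · exact ⟨0, fun h => (hj h).elim⟩
  choose t ht using hex
  have hle : (Finset.range m).card ≤ (Finset.univ.filter fun i => e (i - 1) = e i).card := by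
    refine Finset.card_le_card_of_injOn (fun j => ((L + 4 * j + t j : ℕ) : ZMod n)) ?_ ?_
    · intro j hj
      exact Finset.mem_filter.2 ⟨Finset.mem_univ _, (ht j (Finset.mem_range.1 hj)).2⟩
    · intro j hj j' hj' h
      have h1 := (ht j (Finset.mem_range.1 hj)).1
      have h2 := (ht j' (Finset.mem_range.1 hj')).1
      have h3 := Finset.mem_range.1 hj
      have h4 := Finset.mem_range.1 hj'
      have h5 := congrArg ZMod.val h
      simp only at h5
      rw [ZMod.val_cast_of_lt (by omega), ZMod.val_cast_of_lt (by omega)] at h5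
      omega
  rw [Finset.card_range] at hle
  omega

theorem role_insert_of_le {c : Bool} {P : Finset ℕ} {x i : ℕ} (hi : i ≤ x) :
    role c (insert x P) i = role c P i :=
  role_congr fun q hq => by
    rw [Finset.mem_insert]
    constructor
    · rintro (h | h)
      · omega
      · exact h
    · exact Or.inr

/-- A new flip exchanges the two worlds on everything after it. -/
theorem role_insert_of_lt {c : Bool} {P : Finset ℕ} {x i : ℕ} (hx : x ∉ P) (hi : x < i) :
    role c (insert x P) i = !role c P i := by
  unfold role
  have h : ((insert x P).filter fun q => q < i).card = (P.filter fun q => q < i).card + 1 := by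
    rw [Finset.filter_insert, if_pos hi, Finset.card_insert_of_notMem]
    exact fun h => hx (Finset.mem_filter.1 h).1
  rw [h]
  rcases Nat.mod_two_eq_zero_or_one (i + (P.filter fun q => q < i).card) with h2 | h2
  · have h3 : (i + ((P.filter fun q => q < i).card + 1)) % 2 = 1 := by omega
    simp [h2, h3]
  · have h3 : (i + ((P.filter fun q => q < i).card + 1)) % 2 = 0 := by omega
    simp [h2, h3]

theorem role_not (c : Bool) (P : Finset ℕ) (i : ℕ) : role (!c) P i = !role c P i := by
  unfold role
  cases c <;> simp

/-- Treating the wrap-around at `n - 1` as exceptional avoids any parity condition; this costs one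
position in the turn counts. -/
theorem role_val_succ_of_notMem [NeZero n] {c : Bool} {P : Finset ℕ} {i : ZMod n} (hn : 1 < n)
    (hi : i.val ∉ insert (n - 1) P) : role c P (i + 1).val = !role c P i.val := by
  rw [Finset.mem_insert, not_or] at hi
  have h1 : (1 : ZMod n).val = 1 := by
    have : Fact (1 < n) := ⟨hn⟩
    exact ZMod.val_one n
  have h2 := ZMod.val_lt i
  have h3 : i.val + 1 < n := by omega
  rw [ZMod.val_add_of_lt (by rwa [h1]), h1, role_succ, decide_eq_false hi.2, Bool.xor_false]

theorem card_filter_val_mem_le [NeZero n] (P : Finset ℕ) :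
    (Finset.univ.filter fun i : ZMod n => i.val ∈ P).card ≤ P.card :=
  Finset.card_le_card_of_injOn ZMod.val (fun _ hi => (Finset.mem_filter.1 hi).2)
    fun _ _ _ _ h => ZMod.val_injective n h

end Turns

/-! ### Cycles with few through positions: one special edge as the last flip. -/

noncomputable section FewThrough

open scoped Classical

variable {V : Type*} {n k : ℕ} {G : Digraph V} {A B S T : Finset V} {e : ZMod n → Bool}

theorem le_card_turn_interval [NeZero n] (ρ : ZMod n → Bool) {l u : ℕ} (hu : u ≤ n) :
    u - l ≤ (Finset.univ.filter fun i : ZMod n =>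
        e (i - 1) = !e i ∧ (l ≤ i.val ∧ i.val < u) ∧ ρ i = xor (e i) true).card +
      (Finset.univ.filter fun i : ZMod n =>
        e (i - 1) = !e i ∧ (l ≤ i.val ∧ i.val < u) ∧ ρ i = xor (e i) false).card +
      (Finset.univ.filter fun i => e (i - 1) = e i).card := by
  rw [← card_filter_val_mem_Ico hu (l := l)]
  have hsub : (Finset.univ.filter fun i : ZMod n => l ≤ i.val ∧ i.val < u) ⊆
      (Finset.univ.filter fun i : ZMod n =>
        e (i - 1) = !e i ∧ (l ≤ i.val ∧ i.val < u) ∧ ρ i = xor (e i) true) ∪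
      (Finset.univ.filter fun i : ZMod n =>
        e (i - 1) = !e i ∧ (l ≤ i.val ∧ i.val < u) ∧ ρ i = xor (e i) false) ∪
      (Finset.univ.filter fun i => e (i - 1) = e i) := by
    intro i hi
    have h1 := (Finset.mem_filter.1 hi).2
    simp only [Finset.mem_union, Finset.mem_filter, Finset.mem_univ, true_and]
    cases e (i - 1) <;> cases e i <;> cases ρ i <;> simp [h1]
  refine (Finset.card_le_card hsub).trans ((Finset.card_union_le _ _).trans ?_)
  exact Nat.add_le_add_right (Finset.card_union_le _ _) _

/-- The worlds before and after inserting a flip may correspond differently on two stretches, so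
each stretch has its own `d₁` or `d₂`. -/
theorem turn_intervals_le [NeZero n] {ρ ρ' : ZMod n → Bool} {l u l' u' : ℕ} (d d₁ d₂ : Bool)
    (hul : u ≤ l') (h₁ : ∀ i : ZMod n, l ≤ i.val → i.val < u → ρ i = xor (e i) d₁ →
      ρ' i = xor (e i) d)
    (h₂ : ∀ i : ZMod n, l' ≤ i.val → i.val < u' → ρ i = xor (e i) d₂ → ρ' i = xor (e i) d) :
    (Finset.univ.filter fun i : ZMod n =>
        e (i - 1) = !e i ∧ (l ≤ i.val ∧ i.val < u) ∧ ρ i = xor (e i) d₁).card +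
      (Finset.univ.filter fun i : ZMod n =>
        e (i - 1) = !e i ∧ (l' ≤ i.val ∧ i.val < u') ∧ ρ i = xor (e i) d₂).card ≤
      (Finset.univ.filter fun i : ZMod n => e (i - 1) = !e i ∧ ρ' i = xor (e i) d).card := by
  rw [← Finset.card_union_of_disjoint]
  · refine Finset.card_le_card fun i hi => ?_
    simp only [Finset.mem_union, Finset.mem_filter, Finset.mem_univ, true_and] at hi ⊢
    rcases hi with ⟨h1, h2, h3⟩ | ⟨h1, h2, h3⟩
    · exact ⟨h1, h₁ i h2.1 h2.2 h3⟩
    · exact ⟨h1, h₂ i h2.1 h2.2 h3⟩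
  · rw [Finset.disjoint_left]
    intro i hi hi'
    have h1 := (Finset.mem_filter.1 hi).2.2.1
    have h2 := (Finset.mem_filter.1 hi').2.2.1
    omega

/-- An exceptional edge can be placed so that turns of all kinds remain frequent. -/
theorem exists_special_position [NeZero n] (hn : 10000 ≤ n)
    (few : 1000 * (Finset.univ.filter fun i => e (i - 1) = e i).card ≤ n) (c : Bool)
    (P : Finset ℕ) (h : ℕ) (hP : ∀ p ∈ P, p < h) (hh : 40 * h ≤ n) :
    ∃ x : ℕ, h ≤ x ∧ x + 6 ≤ n ∧ role c P x = false ∧ e ((x : ZMod n) - 1) = !e x ∧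
      e ((x : ZMod n) + 1) = !e x ∧ ∀ b d, n ≤ 40 * (Finset.univ.filter fun i : ZMod n =>
        e (i - 1) = !e i ∧ e i = b ∧ role c (insert x P) i.val = xor (e i) d).card := by
  -- Two candidates: a flip near the beginning exchanges the worlds on both stretches counted below,
  -- a flip near the middle only on the second.
  obtain ⟨x₁, hx₁, hx₁', hrole₁, he₁, he₁'⟩ := exists_antidirected (e := e) c P h (n / 1000 + 1) hP
    (by omega) (by omega)
  obtain ⟨x₂, hx₂, hx₂', hrole₂, he₂, he₂'⟩ := exists_antidirected (e := e) c P (n / 2) (n / 1000 + 1)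
    (fun p hp => by have := hP p hp; omega) (by omega) (by omega)
  have hPc : P.card ≤ h := by
    have : P ⊆ Finset.range h := fun p hp => Finset.mem_range.2 (hP p hp)
    simpa using Finset.card_le_card this
  have hnotP : ∀ x, h ≤ x → x ∉ P := fun x hx hxP => by
    have := hP x hxP
    omega
  have hfin : ∀ x d, n ≤ 8 * (Finset.univ.filter fun i : ZMod n => e (i - 1) = !e i ∧
      role c (insert x P) i.val = xor (e i) d).card → ∀ b,
      n ≤ 40 * (Finset.univ.filter fun i : ZMod n =>
        e (i - 1) = !e i ∧ e i = b ∧ role c (insert x P) i.val = xor (e i) d).card := by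
    intro x d hN b
    have h1 := le_card_turn (e := e) (fun i => role c (insert x P) i.val)
      (Finset.univ.filter fun i : ZMod n => i.val ∈ insert (n - 1) (insert x P))
      (fun i hi => role_val_succ_of_notMem (by omega) (by simpa using hi)) d le_rfl b
    have h2 := card_filter_val_mem_le (n := n) (insert (n - 1) (insert x P))
    have h3 := Finset.card_insert_le (n - 1) (insert x P)
    have h4 := Finset.card_insert_le x P
    omega
  have hα := le_card_turn_interval (e := e) (fun i => role c P i.val)
    (show n / 2 ≤ n by omega) (l := n / 10)
  have hβ := le_card_turn_interval (e := e) (fun i => role c P i.val)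
    (le_refl n) (l := n / 2 + n / 10)
  have hN₁ : ∀ d, _ := fun d => turn_intervals_le (e := e) (ρ := fun i => role c P i.val)
    (ρ' := fun i => role c (insert x₁ P) i.val) (l := n / 10) (u := n / 2) (l' := n / 2 + n / 10)
    (u' := n) d (!d) (!d) (by omega)
    (fun i h1 h2 h3 => by
      rw [role_insert_of_lt (hnotP _ hx₁) (by omega), h3]
      cases e i <;> cases d <;> rfl)
    (fun i h1 h2 h3 => by
      rw [role_insert_of_lt (hnotP _ hx₁) (by omega), h3]
      cases e i <;> cases d <;> rfl)
  have hN₂ : ∀ d, _ := fun d => turn_intervals_le (e := e) (ρ := fun i => role c P i.val)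
    (ρ' := fun i => role c (insert x₂ P) i.val) (l := n / 10) (u := n / 2) (l' := n / 2 + n / 10)
    (u' := n) d d (!d) (by omega)
    (fun i h1 h2 h3 => by
      rw [role_insert_of_le (by omega), h3])
    (fun i h1 h2 h3 => by
      rw [role_insert_of_lt (hnotP _ (by omega)) (by omega), h3]
      cases e i <;> cases d <;> rfl)
  have hT₁ := hN₁ true
  have hF₁ := hN₁ false
  have hT₂ := hN₂ true
  have hF₂ := hN₂ false
  simp only [Bool.not_true, Bool.not_false] at hT₁ hF₁ hT₂ hF₂
  -- If the early flip leaves one world too small, the turns on both stretches lie mostly in a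
  -- single world; flipping between the stretches then gives each world one of them.
  by_cases hcase : ∀ d, n ≤ 8 * (Finset.univ.filter fun i : ZMod n => e (i - 1) = !e i ∧
      role c (insert x₁ P) i.val = xor (e i) d).card
  · exact ⟨x₁, hx₁, by omega, hrole₁, he₁, he₁', fun b d => hfin x₁ d (hcase d) b⟩
  · refine ⟨x₂, by omega, by omega, hrole₂, he₂, he₂', fun b d => hfin x₂ d ?_ b⟩
    push Not at hcase
    obtain ⟨d', hd'⟩ := hcase
    cases d' <;> cases d <;> omega

/-- An edge from `B ∪ T` to `B ∪ S` as the last exceptional item. -/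
theorem exists_embedding_of_special [Fintype V] [NeZero n] (fr : Frame G n k A B S T)
    (few : 1000 * (Finset.univ.filter fun i => e (i - 1) = e i).card ≤ n) (c : Bool)
    (J : Finset (V ⊕ V × V)) (q : V ⊕ V × V → ℕ) {h : ℕ} (hh : 40 * h ≤ n)
    (hsep : ∀ j ∈ J, ∀ j' ∈ J, j ≠ j' → q j + 6 ≤ q j' ∨ q j' + 6 ≤ q j)
    (hqh : ∀ j ∈ J, q j + 6 ≤ h)
    (hdisj : ∀ j ∈ J, ∀ j' ∈ J, ∀ x, x ∈ verts j → x ∈ verts j' → j = j')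
    (fits : ∀ j ∈ J, Fits G n A B e (role c (J.image q) (q j)) j (q j) true)
    {x y : V} (hxy : G.Adj x y) (hx : Many G n A B true x true) (hy : Many G n A B false y true)
    (hxJ : ∀ j ∈ J, x ∉ verts j) (hyJ : ∀ j ∈ J, y ∉ verts j)
    (hpar : (n + J.card + 1) % 2 = 0) (hJ : J.card + 1 ≤ 4 * k) (Z : Finset V)
    (hZ : ∀ z, z ∈ Z ↔ (z ∈ S ∨ z ∈ T) ∧ z ≠ x ∧ z ≠ y ∧ ∀ j ∈ J, z ∉ verts j)
    (m : ℕ) (hm : m ≤ Z.card)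
    (hcharge : ∑ j ∈ J, charge A B (role c (J.image q) (q j)) true j +
      (1 + weight A B x + weight A B y) = (A.card : ℤ) - B.card + 2 * m - Z.card) :
    ∃ f : ZMod n → V, Function.Injective f ∧ ∀ i, G.Arc (e i) (f i) (f (i + 1)) := by
  have hk := fr.one_le
  have hn := fr.large
  obtain ⟨p, hhp, hpn, hrole, he, he', hturn⟩ := exists_special_position (e := e) (by omega) few c
    (J.image q) h (fun i hi => by
      obtain ⟨j, hj, rfl⟩ := Finset.mem_image.1 hi
      have := hqh j hj
      omega) hh
  have hverts : ∀ z, z ∈ verts (Sum.inr (x, y)) ↔ z = x ∨ z = y := by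
    intro z
    simp [verts, first, second]
  have hnot : (Sum.inr (x, y) : V ⊕ V × V) ∉ J := fun hmem =>
    hxJ _ hmem ((hverts x).2 (Or.inl rfl))
  have hne : ∀ j ∈ J, j ≠ Sum.inr (x, y) := fun j hj h => hnot (h ▸ hj)
  let q' : V ⊕ V × V → ℕ := Function.update q (Sum.inr (x, y)) p
  have hq'1 : q' (Sum.inr (x, y)) = p := Function.update_self _ _ _
  have hq'2 : ∀ j ∈ J, q' j = q j := fun j hj => Function.update_of_ne (hne j hj) _ _
  have himage : (insert (Sum.inr (x, y)) J).image q' = insert p (J.image q) := by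
    rw [Finset.image_insert, hq'1]
    congr 1
    exact Finset.image_congr fun j hj => hq'2 j hj
  -- The special edge comes after all other flips, so their roles are unaffected.
  have hrole' : ∀ j ∈ J, role c (insert p (J.image q)) (q j) = role c (J.image q) (q j) :=
    fun j hj => role_insert_of_le (by have := hqh j hj; omega)
  have hcardJ : (insert (Sum.inr (x, y)) J).card = J.card + 1 :=
    Finset.card_insert_of_notMem hnot
  refine exists_embedding_of_turns (e := e) fr c (insert (Sum.inr (x, y)) J) q' ?_ ?_ ?_ ?_ ?_ Z ?_
    ?_ ?_ ?_ m hm ?_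
  · rw [hcardJ]
    omega
  · intro j hj j' hj' hjj
    rcases Finset.mem_insert.1 hj with h1 | h1 <;> rcases Finset.mem_insert.1 hj' with h2 | h2
    · exact (hjj (h1.trans h2.symm)).elim
    · rw [h1, hq'1, hq'2 j' h2]
      have := hqh j' h2
      omega
    · rw [h2, hq'1, hq'2 j h1]
      have := hqh j h1
      omega
    · rw [hq'2 j h1, hq'2 j' h2]
      exact hsep j h1 j' h2 hjj
  · intro j hj
    rcases Finset.mem_insert.1 hj with h1 | h1
    · rw [h1, hq'1]
      exact hpn
    · rw [hq'2 j h1]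
      have := hqh j h1
      omega
  · intro j hj j' hj' z hz hz'
    rcases Finset.mem_insert.1 hj with h1 | h1 <;> rcases Finset.mem_insert.1 hj' with h2 | h2
    · exact h1.trans h2.symm
    · rw [h1, hverts] at hz
      rcases hz with rfl | rfl
      · exact (hxJ j' h2 hz').elim
      · exact (hyJ j' h2 hz').elim
    · rw [h2, hverts] at hz'
      rcases hz' with rfl | rfl
      · exact (hxJ j h1 hz).elim
      · exact (hyJ j h1 hz).elim
    · exact hdisj j h1 j' h2 z hz hz'
  · intro j hj
    rw [himage]
    rcases Finset.mem_insert.1 hj with h1 | h1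
    · rw [h1, hq'1, role_insert_of_le le_rfl, hrole]
      exact fits_special hxy hx hy he he'
    · rw [hq'2 j h1, hrole' j h1]
      exact fits j h1
  · intro z
    rw [hZ]
    constructor
    · rintro ⟨h1, h2, h3, h4⟩
      refine ⟨h1, fun j hj => ?_⟩
      rcases Finset.mem_insert.1 hj with h5 | h5
      · rw [h5, hverts]
        tauto
      · exact h4 j h5
    · rintro ⟨h1, h2⟩
      have h3 := h2 _ (Finset.mem_insert_self _ _)
      rw [hverts, not_or] at h3
      exact ⟨h1, h3.1, h3.2, fun j hj => h2 j (Finset.mem_insert_of_mem hj)⟩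
  · intro _ b
    have := hturn b false
    simp only [Bool.xor_false] at this
    rw [himage]
    omega
  · intro _ b
    have := hturn b true
    simp only [Bool.xor_true] at this
    rw [himage]
    omega
  · rw [hcardJ]
    exact hJ
  · rw [himage, Finset.sum_insert hnot, hq'1, role_insert_of_le le_rfl, hrole, ← hcharge]
    have h1 : ∑ j ∈ J, charge A B (role c (insert p (J.image q)) (q' j)) true j =
        ∑ j ∈ J, charge A B (role c (J.image q) (q j)) true j :=
      Finset.sum_congr rfl fun j hj => by rw [hq'2 j hj, hrole' j hj]
    rw [h1]
    simp only [charge, sgn]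
    norm_num
    ring

/-- Disjoint edges in `B` and one edge from `B ∪ T` to `B ∪ S` as the exceptional items. -/
theorem exists_embedding_of_edges [Fintype V] [NeZero n] (fr : Frame G n k A B S T)
    (few : 1000 * (Finset.univ.filter fun i => e (i - 1) = e i).card ≤ n)
    (M : Finset (V × V)) (hM : ∀ r ∈ M, r.1 ∈ B ∧ r.2 ∈ B ∧ G.Adj r.1 r.2)
    (hMd : ∀ r ∈ M, ∀ r' ∈ M, r ≠ r' →
      r.1 ≠ r'.1 ∧ r.1 ≠ r'.2 ∧ r.2 ≠ r'.1 ∧ r.2 ≠ r'.2)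
    {x y : V} (hxy : G.Adj x y) (hx : Many G n A B true x true) (hy : Many G n A B false y true)
    (hxM : ∀ r ∈ M, x ≠ r.1 ∧ x ≠ r.2) (hyM : ∀ r ∈ M, y ≠ r.1 ∧ y ≠ r.2)
    (hpar : (n + M.card + 1) % 2 = 0) (hMk : M.card + 1 ≤ 4 * k) (Z : Finset V)
    (hZ : ∀ z, z ∈ Z ↔ (z ∈ S ∨ z ∈ T) ∧ z ≠ x ∧ z ≠ y)
    (m : ℕ) (hm : m ≤ Z.card)
    (hcharge : 1 + weight A B x + weight A B y - M.card =
      (A.card : ℤ) - B.card + 2 * m - Z.card) :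
    ∃ f : ZMod n → V, Function.Injective f ∧ ∀ i, G.Arc (e i) (f i) (f (i + 1)) := by
  have hk := fr.one_le
  have hn := fr.large
  have hJcard : (M.image (Sum.inr : V × V → V ⊕ V × V)).card = M.card :=
    Finset.card_image_of_injective _ Sum.inr_injective
  have hmem : ∀ j ∈ M.image (Sum.inr : V × V → V ⊕ V × V), ∃ r ∈ M, j = Sum.inr r := by
    intro j hj
    obtain ⟨r, hr, rfl⟩ := Finset.mem_image.1 hj
    exact ⟨r, hr, rfl⟩
  have hverts : ∀ (r : V × V) z, z ∈ verts (Sum.inr r) ↔ z = r.1 ∨ z = r.2 := by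
    intro r z
    simp [verts, first, second]
  -- Two consecutive positions per window suffice: one of them gets role `B`, and an edge inside `B`
  -- asks for nothing else.
  obtain ⟨q, hq1, hq2, hq3⟩ := exists_positions (M.image (Sum.inr : V × V → V ⊕ V × V)) true
    (fun b => 10 * b) (fun b => 10 * b + 1) (fun b b' hb _ => by omega)
    (fun _ _ r => r = false) (fun j _ b _ r => by
      cases r
      · exact ⟨10 * b, le_rfl, by omega, by simp [show 10 * b % 2 = 0 by omega]⟩
      · exact ⟨10 * b + 1, by omega, le_rfl, by simp [show (10 * b + 1) % 2 = 1 by omega]⟩)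
  refine exists_embedding_of_special (e := e) fr few true (M.image Sum.inr) q
    (h := 40 * k + 10) (by omega) hq3 ?_ ?_ ?_ hxy hx hy ?_ ?_ (by rwa [hJcard]) (by rwa [hJcard])
    Z ?_ m hm ?_
  · intro j hj
    obtain ⟨b, hb, h1, h2⟩ := hq1 j hj
    rw [hJcard] at hb
    omega
  · intro j hj j' hj' z hz hz'
    obtain ⟨r, hr, rfl⟩ := hmem j hj
    obtain ⟨r', hr', rfl⟩ := hmem j' hj'
    rw [hverts] at hz hz'
    by_contra hne
    have := hMd r hr r' hr' fun h => hne (h ▸ rfl)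
    rcases hz with rfl | rfl <;> rcases hz' with h | h <;> tauto
  · intro j hj
    rw [hq2 j hj]
    obtain ⟨r, hr, rfl⟩ := hmem j hj
    exact fits_edge fr (hM r hr).2.2 (hM r hr).1 (hM r hr).2.1
  · intro j hj hxj
    obtain ⟨r, hr, rfl⟩ := hmem j hj
    rw [hverts] at hxj
    have := hxM r hr
    tauto
  · intro j hj hxj
    obtain ⟨r, hr, rfl⟩ := hmem j hj
    rw [hverts] at hxj
    have := hyM r hr
    tauto
  · intro z
    rw [hZ]
    constructor
    · rintro ⟨h1, h2, h3⟩
      refine ⟨h1, h2, h3, fun j hj hz => ?_⟩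
      obtain ⟨r, hr, rfl⟩ := hmem j hj
      have hzB : z ∈ B := by
        rcases (hverts r z).1 hz with rfl | rfl
        · exact (hM r hr).1
        · exact (hM r hr).2.1
      rcases h1 with h1 | h1
      · exact Finset.disjoint_left.1 fr.disjoint_BS hzB h1
      · exact Finset.disjoint_left.1 fr.disjoint_BT hzB h1
    · rintro ⟨h1, h2, h3, -⟩
      exact ⟨h1, h2, h3⟩
  · rw [← hcharge, Finset.sum_congr rfl fun j hj => show _ = (-1 : ℤ) from ?_]
    · rw [Finset.sum_const, hJcard]
      simp
      ring
    · rw [hq2 j hj]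
      obtain ⟨r, hr, rfl⟩ := hmem j hj
      simp [charge, fr.weight_B (hM r hr).1, fr.weight_B (hM r hr).2.1, sgn]

/-- Renumbering the positions allows a given through position to be moved to `0`, in front of all
other items. -/
theorem exists_embedding_of_rotate (s : ZMod n)
    (h : ∃ f : ZMod n → V, Function.Injective f ∧
      ∀ i, G.Arc (e (i + s)) (f i) (f (i + 1))) :
    ∃ f : ZMod n → V, Function.Injective f ∧ ∀ i, G.Arc (e i) (f i) (f (i + 1)) := by
  obtain ⟨f, hf, hfe⟩ := h
  refine ⟨fun i => f (i - s), fun i j hij => sub_left_injective (hf hij), fun i => ?_⟩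
  have := hfe (i - s)
  rwa [sub_add_cancel, sub_add_eq_add_sub] at this

theorem card_filter_rotate [NeZero n] (s : ZMod n) :
    (Finset.univ.filter fun i => e (i - 1 + s) = e (i + s)).card =
      (Finset.univ.filter fun i => e (i - 1) = e i).card := by
  rw [← Finset.card_image_of_injective _ (add_left_injective s)]
  congr 1
  ext i
  simp only [Finset.mem_image, Finset.mem_filter, Finset.mem_univ, true_and]
  constructor
  · rintro ⟨j, hj, rfl⟩
    rwa [add_sub_right_comm]
  · intro hi
    exact ⟨i - s, by rwa [sub_add_cancel, sub_right_comm, sub_add_cancel], by simp⟩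

/-- A vertex of `T` inside a directed path and one edge from `B ∪ T` to `B ∪ S` as the exceptional
items. -/
theorem exists_embedding_of_through [Fintype V] [NeZero n] (fr : Frame G n k A B S T)
    (few : 1000 * (Finset.univ.filter fun i => e (i - 1) = e i).card ≤ n)
    (hth : ∃ i, e (i - 1) = e i) {v x y : V} (hv : v ∈ T)
    (hxy : G.Adj x y) (hx : Many G n A B true x true) (hy : Many G n A B false y true)
    (hvx : v ≠ x) (hvy : v ≠ y) (hpar : n % 2 = 0) (Z : Finset V)
    (hZ : ∀ z, z ∈ Z ↔ (z ∈ S ∨ z ∈ T) ∧ z ≠ x ∧ z ≠ y ∧ z ≠ v)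
    (m : ℕ) (hm : m ≤ Z.card)
    (hcharge : 1 + weight A B x + weight A B y = (A.card : ℤ) - B.card + 2 * m - Z.card) :
    ∃ f : ZMod n → V, Function.Injective f ∧ ∀ i, G.Arc (e i) (f i) (f (i + 1)) := by
  have hk := fr.one_le
  have hn := fr.large
  obtain ⟨s, hs⟩ := hth
  apply exists_embedding_of_rotate s
  have hverts : ∀ z, z ∈ verts (Sum.inl v : V ⊕ V × V) ↔ z = v := by
    intro z
    simp [verts, first, second]
  -- A vertex of `T` inside a directed path needs its role to equal the direction. No flip precedes
  -- position `0`, so the role there is `c` itself and can be prescribed.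
  obtain ⟨c, hc⟩ : ∃ c, role c {0} 0 = e s := by
    by_cases h : role true {0} 0 = e s
    · exact ⟨true, h⟩
    · refine ⟨!true, ?_⟩
      rw [role_not]
      cases hes : e s <;> simpa [hes] using h
  refine exists_embedding_of_special (e := fun i => e (i + s)) fr
    (by rw [card_filter_rotate]; exact few) c {Sum.inl v} (fun _ => 0)
    (h := 10) (by omega) ?_ ?_ ?_ ?_ hxy hx hy ?_ ?_ (by simp; omega) (by simp; omega) Z ?_ m hm ?_
  · intro j hj j' hj' hne
    rw [Finset.mem_singleton] at hj hj'
    exact (hne (hj.trans hj'.symm)).elim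
  · intro j _
    omega
  · intro j hj j' hj' _ _ _
    rw [Finset.mem_singleton] at hj hj'
    exact hj.trans hj'.symm
  · intro j hj
    rw [Finset.mem_singleton] at hj
    subst hj
    rw [Finset.image_singleton, hc]
    refine fits_through fr ?_ (Or.inr ⟨hv, by simp⟩)
    simp only [Nat.cast_zero, zero_add, zero_sub]
    rw [neg_add_eq_sub]
    exact hs
  · intro j hj
    rw [Finset.mem_singleton] at hj
    rw [hj, hverts]
    exact hvx.symm
  · intro j hj
    rw [Finset.mem_singleton] at hj
    rw [hj, hverts]
    exact hvy.symm
  · intro z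
    rw [hZ]
    simp only [Finset.mem_singleton, forall_eq, hverts]
  · rw [← hcharge, Finset.sum_singleton]
    simp [charge, fr.weight_T hv]

end FewThrough

/-! ### Edges forced by the semidegree condition, and the case analysis for few through positions.
-/

noncomputable section Edges

open scoped Classical

variable {V : Type*} {n k : ℕ} {G : Digraph V} {A B S T : Finset V} {e : ZMod n → Bool}

theorem Frame.two_mul_B_ge [Fintype V] (fr : Frame G n k A B S T) : n ≤ 2 * B.card + 2 * k := by
  have h1 := fr.A_lower
  have h2 := fr.A_le_B
  omega

theorem Frame.notMem_of_mem_T [Fintype V] (fr : Frame G n k A B S T) {x : V} (hx : x ∈ T) :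
    x ∉ A ∧ x ∉ B ∧ x ∉ S :=
  ⟨Finset.disjoint_right.1 fr.disjoint_AT hx, Finset.disjoint_right.1 fr.disjoint_BT hx,
    Finset.disjoint_right.1 fr.disjoint_ST hx⟩

theorem Frame.notMem_of_mem_S [Fintype V] (fr : Frame G n k A B S T) {x : V} (hx : x ∈ S) :
    x ∉ A ∧ x ∉ B ∧ x ∉ T :=
  ⟨Finset.disjoint_right.1 fr.disjoint_AS hx, Finset.disjoint_right.1 fr.disjoint_BS hx,
    Finset.disjoint_left.1 fr.disjoint_ST hx⟩

theorem Frame.card_filter_arc [Fintype V] (fr : Frame G n k A B S T) (y : V) :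
    n ≤ 2 * ((B ∪ T).filter fun x => G.Arc false y x).card +
      2 * ((A ∪ S).filter fun x => G.Arc false y x).card := by
  have h1 := fr.degree y false
  have h2 : (Finset.univ.filter fun x => G.Arc false y x) ⊆
      ((B ∪ T).filter fun x => G.Arc false y x) ∪ ((A ∪ S).filter fun x => G.Arc false y x) := by
    intro x hx
    have h3 := fr.cover x
    simp only [Finset.mem_union, Finset.mem_filter, Finset.mem_univ, true_and] at hx ⊢
    tauto
  have h4 := Finset.card_le_card h2
  have h5 := Finset.card_union_le ((B ∪ T).filter fun x => G.Arc false y x)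
    ((A ∪ S).filter fun x => G.Arc false y x)
  omega

theorem Frame.card_in_BT [Fintype V] (fr : Frame G n k A B S T) (y : V) :
    n ≤ 2 * ((B ∪ T).filter fun x => G.Arc false y x).card + 2 * (A.card + S.card) := by
  have h1 := fr.card_filter_arc y
  have h2 := Finset.card_filter_le (A ∪ S) fun x => G.Arc false y x
  have h3 := Finset.card_union_le A S
  omega

theorem Frame.card_in_B [Fintype V] (fr : Frame G n k A B S T) (y : V) :
    2 * B.card ≤ 2 * (B.filter fun x => G.Arc false y x).card + n := by
  have h1 := fr.degree y false
  have h2 : (Finset.univ.filter fun x => G.Arc false y x) ⊆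
      (B.filter fun x => G.Arc false y x) ∪ (Finset.univ \ B) := by
    intro x hx
    simp only [Finset.mem_union, Finset.mem_filter, Finset.mem_univ, true_and,
      Finset.mem_sdiff] at hx ⊢
    tauto
  have h3 := Finset.card_le_card h2
  have h4 := Finset.card_union_le (B.filter fun x => G.Arc false y x) (Finset.univ \ B)
  have h5 := Finset.card_sdiff_add_card_eq_card (Finset.subset_univ B)
  rw [Finset.card_univ, fr.card_eq] at h5
  omega

/-- The number of disjoint edges into `B` is at least twice a lower bound for the indegrees. -/
theorem Frame.exists_disjoint_edges [Fintype V] (fr : Frame G n k A B S T) (hAB : A.card < B.card)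
    (X : Finset V) (hX : X ⊆ B ∪ T) (D : ℕ)
    (hD : ∀ y ∈ B, D ≤ 2 * (X.filter fun x => G.Arc false y x).card) :
    ∃ M : Finset (V × V), M.card = D ∧ (∀ r ∈ M, r.1 ∈ X ∧ r.2 ∈ B ∧ G.Adj r.1 r.2) ∧
      ∀ r ∈ M, ∀ r' ∈ M, r ≠ r' → r.1 ≠ r'.1 ∧ r.1 ≠ r'.2 ∧ r.2 ≠ r'.1 ∧ r.2 ≠ r'.2 := by
  let E := (X ×ˢ B).filter fun r => G.Adj r.1 r.2
  obtain ⟨hB, -, hT⟩ := fr.unbalanced hAB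
  have hTk : T.card ≤ k := by
    have := fr.ST_le
    omega
  have hE : D * B.card ≤ 2 * E.card := by
    have h1 : E.card = ∑ y ∈ B, (X.filter fun x => G.Arc false y x).card := by
      rw [Finset.card_eq_sum_card_fiberwise (f := Prod.snd) (t := B)]
      · refine Finset.sum_congr rfl fun y hy => ?_
        rw [← Finset.card_image_of_injective (X.filter fun x => G.Arc false y x)
          (Prod.mk_left_injective y)]
        congr 1
        ext ⟨x, y'⟩
        simp only [E, Finset.mem_filter, Finset.mem_product, Finset.mem_image, Prod.mk.injEq, Arc,
          Bool.false_eq_true, if_false]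
        constructor
        · rintro ⟨⟨⟨h1, h2⟩, h3⟩, rfl⟩
          exact ⟨x, ⟨h1, h3⟩, rfl, rfl⟩
        · rintro ⟨x', ⟨h1, h3⟩, rfl, rfl⟩
          exact ⟨⟨⟨h1, hy⟩, h3⟩, rfl⟩
      · intro r hr
        exact (Finset.mem_product.1 (Finset.mem_filter.1 hr).1).2
    rw [h1, Finset.mul_sum, mul_comm, ← smul_eq_mul]
    exact Finset.card_nsmul_le_sum _ _ _ hD
  have hout : ∀ v, (E.filter fun p => p.1 = v).card ≤ (B.filter fun y => G.Arc true v y).card := by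
    intro v
    refine Finset.card_le_card_of_injOn Prod.snd (fun r hr => ?_) fun r hr r' hr' h => ?_
    · obtain ⟨h1, rfl⟩ := Finset.mem_filter.1 hr
      obtain ⟨h2, h3⟩ := Finset.mem_filter.1 h1
      exact Finset.mem_filter.2 ⟨(Finset.mem_product.1 h2).2, by simpa [Arc] using h3⟩
    · exact Prod.ext ((Finset.mem_filter.1 hr).2.trans (Finset.mem_filter.1 hr').2.symm) h
  have hin : ∀ v, (E.filter fun p => p.2 = v).card ≤
      (B.filter fun y => G.Arc false v y).card + k := by
    intro v
    have h1 : (E.filter fun p => p.2 = v).card ≤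
        ((B.filter fun y => G.Arc false v y) ∪ T).card := by
      refine Finset.card_le_card_of_injOn Prod.fst (fun r hr => ?_) fun r hr r' hr' h => ?_
      · obtain ⟨h1, rfl⟩ := Finset.mem_filter.1 hr
        obtain ⟨h2, h3⟩ := Finset.mem_filter.1 h1
        have h4 : G.Arc false r.2 r.1 := by simpa [Arc] using h3
        rcases Finset.mem_union.1 (hX (Finset.mem_product.1 h2).1) with h5 | h5
        · exact Finset.mem_union_left _ (Finset.mem_filter.2 ⟨h5, h4⟩)
        · exact Finset.mem_union_right _ h5
      · exact Prod.ext h ((Finset.mem_filter.1 hr).2.trans (Finset.mem_filter.1 hr').2.symm)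
    have h2 := Finset.card_union_le (B.filter fun y => G.Arc false v y) T
    omega
  -- Degrees into and out of `v` within `B` are below `n / 20`; edges from `T` add at most `k`, and
  -- a vertex of `T` is never a head.
  have hdeg : ∀ v, (v ∈ B ∨ v ∈ T) →
      (E.filter fun p => p.1 = v ∨ p.2 = v).card ≤ n / 10 + k := by
    intro v hv
    have h1 : (E.filter fun p => p.1 = v ∨ p.2 = v).card ≤
        (E.filter fun p => p.1 = v).card + (E.filter fun p => p.2 = v).card := by
      rw [Finset.filter_or]
      exact Finset.card_union_le _ _
    have h2 := hout v
    have h3 := hin v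
    rcases hv with hv | hv
    · have h4 := hB v hv true
      have h5 := hB v hv false
      omega
    · have h4 := hT v hv
      have h5 : (E.filter fun p => p.2 = v).card = 0 := by
        rw [Finset.card_eq_zero, Finset.filter_eq_empty_iff]
        intro r hr h
        have := (Finset.mem_product.1 (Finset.mem_filter.1 hr).1).2
        rw [h] at this
        exact (fr.notMem_of_mem_T hv).2.1 this
      omega
  have hEX : ∀ r ∈ E, r.1 ∈ X ∧ r.2 ∈ B ∧ G.Adj r.1 r.2 := fun r hr => by
    obtain ⟨h1, h2⟩ := Finset.mem_filter.1 hr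
    exact ⟨(Finset.mem_product.1 h1).1, (Finset.mem_product.1 h1).2, h2⟩
  obtain ⟨M, hME, hMD, hM⟩ := exists_disjoint_pairs E (n / 10 + k) D
    (fun r hr => ⟨hdeg _ (Finset.mem_union.1 (hX (hEX r hr).1)), hdeg _ (Or.inl (hEX r hr).2.1)⟩)
    -- With `Δ = n / 10 + k` one has `4 * Δ < |B|`. For `j < D` this gives `4 * Δ * j ≤ j * |B| < (j
    -- + 1) * |B| ≤ D * |B| ≤ 2 * |E|`, so the greedy choice reaches `D` edges.
    (fun j hj => by
      have h1 := fr.two_mul_B_ge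
      have h2 := fr.large
      have h3 := fr.one_le
      have h4 : (j + 1) * B.card ≤ 2 * E.card := (Nat.mul_le_mul_right _ hj).trans hE
      have h5 : 4 * (n / 10 + k) < B.card := by omega
      have h6 : 4 * (n / 10 + k) * j ≤ B.card * j := Nat.mul_le_mul_right _ h5.le
      have h7 : 2 * (2 * (n / 10 + k) * j) = 4 * (n / 10 + k) * j := by ring
      have h8 : (j + 1) * B.card = B.card * j + B.card := by ring
      omega)
  exact ⟨M, hMD, fun r hr => hEX r (hME hr), hM⟩

theorem Frame.exists_adj_of_lt [Fintype V] (fr : Frame G n k A B S T) (y : V)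
    (h : 2 * (A.card + S.card) < n) : ∃ x, (x ∈ B ∨ x ∈ T) ∧ G.Adj x y := by
  have h1 := fr.card_in_BT y
  have h2 : 0 < ((B ∪ T).filter fun x => G.Arc false y x).card := by omega
  obtain ⟨x, hx⟩ := Finset.card_pos.1 h2
  obtain ⟨h3, h4⟩ := Finset.mem_filter.1 hx
  exact ⟨x, Finset.mem_union.1 h3, by simpa [Arc] using h4⟩

/-- A weak inequality suffices because `y` is not its own inneighbour, so `A ∪ S` supplies at most
`|A| + |S| - 1` inneighbours. -/
theorem Frame.exists_adj_of_mem_S [Fintype V] (fr : Frame G n k A B S T) {y : V} (hy : y ∈ S)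
    (h : 2 * (A.card + S.card) ≤ n) : ∃ x, (x ∈ B ∨ x ∈ T) ∧ G.Adj x y := by
  have h1 := fr.card_filter_arc y
  have h2 : ((A ∪ S).filter fun x => G.Arc false y x).card < A.card + S.card := by
    refine lt_of_lt_of_le (Finset.card_lt_card ?_) (Finset.card_union_le A S)
    refine Finset.filter_ssubset.2 ⟨y, Finset.mem_union_right _ hy, ?_⟩
    simpa [Arc] using fr.loopless y
  have h3 : 0 < ((B ∪ T).filter fun x => G.Arc false y x).card := by omega
  obtain ⟨x, hx⟩ := Finset.card_pos.1 h3
  obtain ⟨h4, h5⟩ := Finset.mem_filter.1 hx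
  exact ⟨x, Finset.mem_union.1 h4, by simpa [Arc] using h5⟩

theorem Frame.many_out [Fintype V] (fr : Frame G n k A B S T) {x : V} (hx : x ∈ B ∨ x ∈ T) :
    Many G n A B true x true := by
  rcases hx with hx | hx
  · exact fr.many_B hx true
  · exact fr.many_T x hx true

theorem Frame.many_in [Fintype V] (fr : Frame G n k A B S T) {x : V} (hx : x ∈ B ∨ x ∈ S) :
    Many G n A B false x true := by
  rcases hx with hx | hx
  · exact fr.many_B hx false
  · exact fr.many_S x hx false

/-- The unbalanced case of a cycle with few directed paths of length two. -/
theorem exists_embedding_of_lt [Fintype V] [NeZero n] (fr : Frame G n k A B S T)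
    (few : 1000 * (Finset.univ.filter fun i => e (i - 1) = e i).card ≤ n)
    (hB : n < 2 * B.card) :
    ∃ f : ZMod n → V, Function.Injective f ∧ ∀ i, G.Arc (e i) (f i) (f (i + 1)) := by
  have hcard := fr.card_add
  have hBk := fr.B_le
  -- Each vertex of `B` has at least `|B| - n / 2` inneighbours in `B`. The resulting `2 * |B| - n`
  -- flips have the parity of `n`, and with charge `-1` for them and for all of `S ∪ T` the total is
  -- `|A| - |B|`.
  obtain ⟨M, hMc, hM, hMd⟩ := fr.exists_disjoint_edges (by omega) B Finset.subset_union_left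
    (2 * B.card - n) (fun y _ => by have := fr.card_in_B y; omega)
  obtain ⟨⟨x, y⟩, hr⟩ := Finset.card_pos.1 (show 0 < M.card by omega)
  have hx := (hM _ hr).1
  have hy := (hM _ hr).2.1
  have hMe : (M.erase (x, y)).card + 1 = 2 * B.card - n := by
    rw [Finset.card_erase_add_one hr, hMc]
  have hST : (S ∪ T).card = S.card + T.card := Finset.card_union_of_disjoint fr.disjoint_ST
  refine exists_embedding_of_edges (e := e) fr few (M.erase (x, y))
    (fun r hr' => hM r (Finset.mem_of_mem_erase hr'))
    (fun r h1 r' h2 => hMd r (Finset.mem_of_mem_erase h1) r' (Finset.mem_of_mem_erase h2))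
    (hM _ hr).2.2 (fr.many_B hx true) (fr.many_B hy false) ?_ ?_ (by omega) (by omega)
    (S ∪ T) ?_ (S.card + T.card) (by omega) ?_
  · intro r hr'
    have := hMd _ hr r (Finset.mem_of_mem_erase hr') (Finset.ne_of_mem_erase hr').symm
    exact ⟨this.1, this.2.1⟩
  · intro r hr'
    have := hMd _ hr r (Finset.mem_of_mem_erase hr') (Finset.ne_of_mem_erase hr').symm
    exact ⟨this.2.2.1, this.2.2.2⟩
  · intro z
    rw [Finset.mem_union]
    constructor
    · intro hz
      refine ⟨hz, ?_, ?_⟩ <;> rintro rfl <;> rcases hz with hz | hz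
      · exact (fr.notMem_of_mem_S hz).2.1 hx
      · exact (fr.notMem_of_mem_T hz).2.1 hx
      · exact (fr.notMem_of_mem_S hz).2.1 hy
      · exact (fr.notMem_of_mem_T hz).2.1 hy
    · exact fun h => h.1
  · rw [fr.weight_B hx, fr.weight_B hy, hST]
    omega

/-- The odd case of a cycle with few directed paths of length two. -/
theorem exists_embedding_of_odd [Fintype V] [NeZero n] (fr : Frame G n k A B S T)
    (few : 1000 * (Finset.univ.filter fun i => e (i - 1) = e i).card ≤ n)
    (hB : 2 * B.card ≤ n) (hodd : n % 2 = 1) :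
    ∃ f : ZMod n → V, Function.Injective f ∧ ∀ i, G.Arc (e i) (f i) (f (i + 1)) := by
  have hcard := fr.card_add
  have hAB := fr.A_le_B
  have hST := fr.S_le_T
  have hk := fr.one_le
  have hn := fr.large
  have hBl := fr.two_mul_B_ge
  have hSTc : (S ∪ T).card = S.card + T.card := Finset.card_union_of_disjoint fr.disjoint_ST
  obtain ⟨y, hy⟩ := Finset.card_pos.1 (show 0 < B.card by omega)
  -- As `n` is odd, `|A| + |S| ≤ |B| + |T|` must be strict.
  obtain ⟨x, hx, hxy⟩ := fr.exists_adj_of_lt y (by omega)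
  have hyST : y ∉ S ∧ y ∉ T :=
    ⟨fun h => (fr.notMem_of_mem_S h).2.1 hy, fun h => (fr.notMem_of_mem_T h).2.1 hy⟩
  have hZ : ∀ Z : Finset V, (∀ z, z ∈ Z ↔ (z ∈ S ∨ z ∈ T) ∧ z ≠ x) →
      ∀ z, z ∈ Z ↔ (z ∈ S ∨ z ∈ T) ∧ z ≠ x ∧ z ≠ y := by
    intro Z hZ z
    rw [hZ]
    constructor
    · rintro ⟨h1, h2⟩
      refine ⟨h1, h2, ?_⟩
      rintro rfl
      tauto
    · rintro ⟨h1, h2, -⟩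
      exact ⟨h1, h2⟩
  by_cases hxB : x ∈ B
  -- The value of `m` solves the charge equation; its numerator is even since `n` is odd, and `m` is
  -- in range since `2 * |B| ≤ n`.
  · refine exists_embedding_of_edges (e := e) fr few ∅ (by simp) (by simp) hxy (fr.many_out hx)
      (fr.many_B hy false) (by simp) (by simp) (by simp; omega) (by simp; omega) (S ∪ T)
      (hZ _ fun z => ?_) ((S.card + T.card + B.card - A.card - 1) / 2) (by omega) ?_
    · rw [Finset.mem_union]
      constructor
      · intro hz
        refine ⟨hz, ?_⟩
        rintro rfl
        rcases hz with hz | hz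
        · exact (fr.notMem_of_mem_S hz).2.1 hxB
        · exact (fr.notMem_of_mem_T hz).2.1 hxB
      · exact fun h => h.1
    · rw [fr.weight_B hxB, fr.weight_B hy, hSTc, Finset.card_empty]
      omega
  · have hxT := hx.resolve_left hxB
    have hc : ((S ∪ T).erase x).card + 1 = S.card + T.card := by
      rw [Finset.card_erase_add_one (Finset.mem_union_right _ hxT), hSTc]
    refine exists_embedding_of_edges (e := e) fr few ∅ (by simp) (by simp) hxy (fr.many_out hx)
      (fr.many_B hy false) (by simp) (by simp) (by simp; omega) (by simp; omega) ((S ∪ T).erase x)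
      (hZ _ fun z => ?_) ((S.card + T.card + B.card - A.card - 1) / 2) (by omega) ?_
    · rw [Finset.mem_erase, Finset.mem_union]
      tauto
    · rw [fr.weight_T hxT, fr.weight_B hy, Finset.card_empty]
      omega

/-- The case `S = ∅` for an even cycle with few directed paths of length two. -/
theorem exists_embedding_of_S_empty [Fintype V] [NeZero n] (fr : Frame G n k A B S T)
    (few : 1000 * (Finset.univ.filter fun i => e (i - 1) = e i).card ≤ n)
    (hB : 2 * B.card ≤ n) (heven : n % 2 = 0) (hS : S.card = 0) :
    ∃ f : ZMod n → V, Function.Injective f ∧ ∀ i, G.Arc (e i) (f i) (f (i + 1)) := by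
  have hcard := fr.card_add
  have hAB := fr.A_le_B
  have hk := fr.one_le
  have hn := fr.large
  have hS' : S = ∅ := Finset.card_eq_zero.1 hS
  -- Replacing `c` by `!c` exchanges the two worlds. As `S` is empty only one of them is needed, and
  -- no flip is used.
  obtain ⟨c, hc⟩ : ∃ c, n ≤ 4 * (Finset.univ.filter fun i : ZMod n =>
      e (i - 1) = !e i ∧ role c ∅ i.val = xor (e i) true).card := by
    by_contra hcon
    push Not at hcon
    have h1 := hcon true
    have h2 := hcon false
    have hsub : (Finset.univ : Finset (ZMod n)) ⊆
        (Finset.univ.filter fun i : ZMod n =>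
          e (i - 1) = !e i ∧ role true ∅ i.val = xor (e i) true) ∪
        (Finset.univ.filter fun i : ZMod n =>
          e (i - 1) = !e i ∧ role false ∅ i.val = xor (e i) true) ∪
        (Finset.univ.filter fun i => e (i - 1) = e i) := by
      intro i _
      have h3 := role_not true ∅ i.val
      rw [Bool.not_true] at h3
      simp only [Finset.mem_union, Finset.mem_filter, Finset.mem_univ, true_and, h3]
      cases e (i - 1) <;> cases e i <;> cases role true ∅ i.val <;> simp
    have h3 := (Finset.card_le_card hsub).trans ((Finset.card_union_le _ _).trans
      (Nat.add_le_add_right (Finset.card_union_le _ _) _))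
    rw [Finset.card_univ, ZMod.card] at h3
    omega
  have hturn : ∀ b, 60 * k ≤ (Finset.univ.filter fun i : ZMod n =>
      e (i - 1) = !e i ∧ e i = b ∧ role c ∅ i.val = xor (e i) true).card := by
    intro b
    have h1 := le_card_turn (e := e) (fun i => role c ∅ i.val)
      (Finset.univ.filter fun i : ZMod n => i.val ∈ insert (n - 1) (∅ : Finset ℕ))
      (fun i hi => role_val_succ_of_notMem (by omega) (by simpa using hi)) true le_rfl b
    have h2 := card_filter_val_mem_le (n := n) (insert (n - 1) (∅ : Finset ℕ))
    have h3 := Finset.card_insert_le (n - 1) (∅ : Finset ℕ)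
    rw [Finset.card_empty] at h3
    omega
  refine exists_embedding_of_turns (e := e) fr c ∅ (fun _ => 0) (by simpa using heven) (by simp)
    (by simp) (by simp) (by simp) T ?_ ?_ ?_ (by simp) ((T.card + B.card - A.card) / 2)
    (by omega) ?_
  · intro z
    simp [hS']
  · rintro ⟨z, hz⟩
    simp [hS'] at hz
  · intro _ b
    have := hturn b
    simp only [Bool.xor_true] at this
    rw [Finset.image_empty]
    convert this
  · rw [Finset.sum_empty]
    omega

/-- Otherwise `false` propagates in steps of two, and by going round the cycle `e` has period two. A
single through position then makes `e` constant, so all positions are through positions. -/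
theorem exists_source_through [NeZero n] (hth : ∃ i, e (i - 1) = e i)
    (few : (Finset.univ.filter fun i => e (i - 1) = e i).card < n) :
    ∃ i, e (i - 1) = false ∧ e (i + 1) = true := by
  by_contra hcon
  push Not at hcon
  have h1 : ∀ j, e j = false → e (j + 2) = false := by
    intro j hj
    have := hcon (j + 1) (by simpa using hj)
    rw [show j + 1 + 1 = j + 2 by ring] at this
    simpa using this
  have h2 : ∀ (m : ℕ) j, e j = false → e (j + 2 * m) = false := by
    intro m
    induction m with
    | zero => simp
    | succ m ih =>
      intro j hj
      have := h1 _ (ih j hj)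
      rwa [show j + 2 * ((m + 1 : ℕ) : ZMod n) = j + 2 * (m : ZMod n) + 2 by push_cast; ring]
  have h3 : ∀ j, e (j + 2) = e j := by
    intro j
    cases hj : e j
    · exact h1 j hj
    · by_contra hne
      -- After `n` double steps from `j` one is back at `j`; the first of them has already been
      -- made.
      have h4 := h2 (n - 1) (j + 2) (by simpa using hne)
      rw [Nat.cast_sub (NeZero.one_le), ZMod.natCast_self, Nat.cast_one,
        show j + 2 + 2 * (0 - 1) = j by ring, hj] at h4
      simp at h4
  obtain ⟨s, hs⟩ := hth
  have h4 : ∀ m : ℕ, e (s - 1 + m) = e s ∧ e (s + m) = e s := by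
    intro m
    induction m with
    | zero => simpa using hs
    | succ m ih =>
      constructor
      · rw [← ih.2]
        congr 1
        push_cast
        ring
      · refine Eq.trans ?_ ((h3 (s - 1 + m)).trans ih.1)
        congr 1
        push_cast
        ring
  have h5 : ∀ i, e i = e s := by
    intro i
    have := (h4 (i - s).val).2
    rwa [ZMod.natCast_zmod_val, add_sub_cancel] at this
  rw [Finset.filter_true_of_mem fun i _ => by rw [h5 (i - 1), h5 i], Finset.card_univ,
    ZMod.card] at few
  exact lt_irrefl _ few

/-- The case that the only edge from `B ∪ T` to the single vertex of `S` starts in `T`. -/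
theorem exists_embedding_of_crossing [Fintype V] [NeZero n] (fr : Frame G n k A B S T)
    (hpar : n % 2 = 0) (hAB : A.card = B.card) (hS : S.card = 1) (hT : T.card = 1)
    {x y : V} (hx : x ∈ T) (hy : y ∈ S) (hxy : G.Adj x y)
    (hi : ∃ i, e (i - 1) = false ∧ e (i + 1) = true) :
    ∃ f : ZMod n → V, Function.Injective f ∧ ∀ i, G.Arc (e i) (f i) (f (i + 1)) := by
  have hk := fr.one_le
  obtain ⟨i, h1, h2⟩ := hi
  obtain ⟨c, hc⟩ : ∃ c, role c ∅ i.val = !e i := by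
    by_cases h : role true ∅ i.val = !e i
    · exact ⟨true, h⟩
    · refine ⟨!true, ?_⟩
      rw [role_not]
      cases hes : e i <;> simpa [hes] using h
  have hverts : ∀ z, z ∈ verts (Sum.inr (x, y)) ↔ z = x ∨ z = y := by
    intro z
    simp [verts, first, second]
  have hstep : ∀ i : ZMod n, role c ∅ (i + 1).val = !role c ∅ i.val := fun i => by
    have := role_val_succ (n := n) (c := c) (P := ∅) (by simp) (by simpa using hpar) i
    simpa using this
  refine exists_embedding_of_items (e := e) (ρ := fun i => role c ∅ i.val)
    (J := {Sum.inr (x, y)}) (p := fun _ => i) (φ := fun _ => false) fr ?_ ?_ ?_ ?_ ?_ ?_ ?_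
    (by simp; omega) ?_
  · intro j hj j' hj' hne
    rw [Finset.mem_singleton] at hj hj'
    exact (hne (hj.trans hj'.symm)).elim
  · intro j hj j' hj' _ _ _
    rw [Finset.mem_singleton] at hj hj'
    exact hj.trans hj'.symm
  · intro j hj
    rw [Finset.mem_singleton] at hj
    subst hj
    exact fits_crossing fr hxy hx hy ⟨h1, by rw [hc, Bool.not_not], h2⟩
  · intro j _
    rw [hstep, Bool.xor_false]
  · exact fun i _ => hstep i
  · intro z hz
    obtain ⟨w, hw⟩ := Finset.card_eq_one.1 hS
    rw [hw, Finset.mem_singleton] at hz hy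
    exact ⟨_, Finset.mem_singleton_self _, (hverts z).2 (Or.inr (hz.trans hy.symm))⟩
  · intro z hz
    obtain ⟨w, hw⟩ := Finset.card_eq_one.1 hT
    rw [hw, Finset.mem_singleton] at hz hx
    exact ⟨_, Finset.mem_singleton_self _, (hverts z).2 (Or.inl (hz.trans hx.symm))⟩
  · rw [Finset.sum_singleton]
    simp [charge, fr.weight_T hx, fr.weight_S hy, hAB]

/-- An edge inside `B` and a vertex of `T` as the exceptional items. -/
theorem exists_embedding_of_adj_B [Fintype V] [NeZero n] (fr : Frame G n k A B S T)
    (few : 1000 * (Finset.univ.filter fun i => e (i - 1) = e i).card ≤ n)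
    (hth : ∃ i, e (i - 1) = e i) (hB : 2 * B.card ≤ n) (heven : n % 2 = 0)
    {x y v : V} (hx : x ∈ B) (hy : y ∈ B) (hv : v ∈ T) (hxy : G.Adj x y)
    (hST : 2 ≤ S.card + T.card) :
    ∃ f : ZMod n → V, Function.Injective f ∧ ∀ i, G.Arc (e i) (f i) (f (i + 1)) := by
  have hcard := fr.card_add
  have hAB := fr.A_le_B
  have hSTc : (S ∪ T).card = S.card + T.card := Finset.card_union_of_disjoint fr.disjoint_ST
  have hc : ((S ∪ T).erase v).card + 1 = S.card + T.card := by
    rw [Finset.card_erase_add_one (Finset.mem_union_right _ hv), hSTc]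
  have hne : ∀ z ∈ B, ∀ w, (w ∈ S ∨ w ∈ T) → w ≠ z := by
    rintro z hz w hw rfl
    rcases hw with hw | hw
    · exact (fr.notMem_of_mem_S hw).2.1 hz
    · exact (fr.notMem_of_mem_T hw).2.1 hz
  refine exists_embedding_of_through (e := e) fr few hth hv hxy (fr.many_B hx true)
    (fr.many_B hy false) (hne x hx v (Or.inr hv)) (hne y hy v (Or.inr hv)) heven
    ((S ∪ T).erase v) (fun z => ?_) ((S.card + T.card + B.card - A.card - 2) / 2) (by omega) ?_
  · rw [Finset.mem_erase, Finset.mem_union]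
    constructor
    · rintro ⟨h1, h2⟩
      exact ⟨h2, hne x hx z h2, hne y hy z h2, h1⟩
    · rintro ⟨h1, -, -, h2⟩
      exact ⟨h2, h1⟩
  · rw [fr.weight_B hx, fr.weight_B hy]
    omega

/-- An edge between `B` and `S ∪ T` and a vertex of `T` as the exceptional items. -/
theorem exists_embedding_of_adj_BT [Fintype V] [NeZero n] (fr : Frame G n k A B S T)
    (few : 1000 * (Finset.univ.filter fun i => e (i - 1) = e i).card ≤ n)
    (hth : ∃ i, e (i - 1) = e i) (hB : 2 * B.card + 2 ≤ n) (heven : n % 2 = 0)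
    {x y v : V} (hxy : G.Adj x y) (h : (x ∈ T ∧ y ∈ B) ∨ (x ∈ B ∧ y ∈ S)) (hv : v ∈ T)
    (hvx : v ≠ x) :
    ∃ f : ZMod n → V, Function.Injective f ∧ ∀ i, G.Arc (e i) (f i) (f (i + 1)) := by
  have hcard := fr.card_add
  have hAB := fr.A_le_B
  have hSTc : (S ∪ T).card = S.card + T.card := Finset.card_union_of_disjoint fr.disjoint_ST
  have hc : ((S ∪ T).erase v).card + 1 = S.card + T.card := by
    rw [Finset.card_erase_add_one (Finset.mem_union_right _ hv), hSTc]
  have hne : ∀ z ∈ B, ∀ w, (w ∈ S ∨ w ∈ T) → w ≠ z := by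
    rintro z hz w hw rfl
    rcases hw with hw | hw
    · exact (fr.notMem_of_mem_S hw).2.1 hz
    · exact (fr.notMem_of_mem_T hw).2.1 hz
  rcases h with ⟨hx, hy⟩ | ⟨hx, hy⟩
  · have hc2 : (((S ∪ T).erase v).erase x).card + 1 = ((S ∪ T).erase v).card :=
      Finset.card_erase_add_one (Finset.mem_erase.2 ⟨hvx.symm, Finset.mem_union_right _ hx⟩)
    refine exists_embedding_of_through (e := e) fr few hth hv hxy (fr.many_out (Or.inr hx))
      (fr.many_B hy false) hvx (hne y hy v (Or.inr hv)) heven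
      (((S ∪ T).erase v).erase x) (fun z => ?_) ((S.card + T.card + B.card - A.card - 2) / 2)
      (by omega) ?_
    · rw [Finset.mem_erase, Finset.mem_erase, Finset.mem_union]
      constructor
      · rintro ⟨h1, h2, h3⟩
        exact ⟨h3, h1, hne y hy z h3, h2⟩
      · rintro ⟨h1, h2, -, h3⟩
        exact ⟨h2, h3, h1⟩
    · rw [fr.weight_T hx, fr.weight_B hy]
      omega
  · have hvy : v ≠ y := fun h => (fr.notMem_of_mem_T hv).2.2 (h ▸ hy)
    have hc2 : (((S ∪ T).erase v).erase y).card + 1 = ((S ∪ T).erase v).card :=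
      Finset.card_erase_add_one (Finset.mem_erase.2 ⟨hvy.symm, Finset.mem_union_left _ hy⟩)
    refine exists_embedding_of_through (e := e) fr few hth hv hxy (fr.many_B hx true)
      (fr.many_in (Or.inr hy)) hvx hvy heven
      (((S ∪ T).erase v).erase y) (fun z => ?_) ((S.card + T.card + B.card - A.card - 2) / 2)
      (by omega) ?_
    · rw [Finset.mem_erase, Finset.mem_erase, Finset.mem_union]
      constructor
      · rintro ⟨h1, h2, h3⟩
        exact ⟨h3, hne x hx z h3, h1, h2⟩
      · rintro ⟨h1, -, h2, h3⟩
        exact ⟨h2, h3, h1⟩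
    · rw [fr.weight_B hx, fr.weight_S hy]
      omega

/-- An edge from `T` to `S` and a vertex of `T` as the exceptional items. -/
theorem exists_embedding_of_adj_TS [Fintype V] [NeZero n] (fr : Frame G n k A B S T)
    (few : 1000 * (Finset.univ.filter fun i => e (i - 1) = e i).card ≤ n)
    (hth : ∃ i, e (i - 1) = e i) (heven : n % 2 = 0)
    (hAB : A.card = B.card) (hST : 4 ≤ S.card + T.card)
    {x y v : V} (hxy : G.Adj x y) (hx : x ∈ T) (hy : y ∈ S) (hv : v ∈ T) (hvx : v ≠ x) :
    ∃ f : ZMod n → V, Function.Injective f ∧ ∀ i, G.Arc (e i) (f i) (f (i + 1)) := by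
  have hcard := fr.card_add
  have hSTc : (S ∪ T).card = S.card + T.card := Finset.card_union_of_disjoint fr.disjoint_ST
  have hc : ((S ∪ T).erase v).card + 1 = S.card + T.card := by
    rw [Finset.card_erase_add_one (Finset.mem_union_right _ hv), hSTc]
  have hvy : v ≠ y := fun h => (fr.notMem_of_mem_T hv).2.2 (h ▸ hy)
  have hxy' : x ≠ y := fun h => (fr.notMem_of_mem_T hx).2.2 (h ▸ hy)
  have hc2 : (((S ∪ T).erase v).erase x).card + 1 = ((S ∪ T).erase v).card :=
    Finset.card_erase_add_one (Finset.mem_erase.2 ⟨hvx.symm, Finset.mem_union_right _ hx⟩)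
  have hc3 : ((((S ∪ T).erase v).erase x).erase y).card + 1 = (((S ∪ T).erase v).erase x).card :=
    Finset.card_erase_add_one (Finset.mem_erase.2 ⟨hxy'.symm,
      Finset.mem_erase.2 ⟨hvy.symm, Finset.mem_union_left _ hy⟩⟩)
  refine exists_embedding_of_through (e := e) fr few hth hv hxy (fr.many_out (Or.inr hx))
    (fr.many_in (Or.inr hy)) hvx hvy heven
    ((((S ∪ T).erase v).erase x).erase y) (fun z => ?_) ((S.card + T.card - 2) / 2)
    (by omega) ?_
  · rw [Finset.mem_erase, Finset.mem_erase, Finset.mem_erase, Finset.mem_union]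
    tauto
  · rw [fr.weight_T hx, fr.weight_S hy]
    omega

/-- Cycles with few directed paths of length two which are not antidirected. -/
theorem exists_embedding_of_few [Fintype V] [NeZero n] (fr : Frame G n k A B S T)
    (few : 1000 * (Finset.univ.filter fun i => e (i - 1) = e i).card ≤ n)
    (hth : ∃ i, e (i - 1) = e i) :
    ∃ f : ZMod n → V, Function.Injective f ∧ ∀ i, G.Arc (e i) (f i) (f (i + 1)) := by
  have hcard := fr.card_add
  have hAB := fr.A_le_B
  have hST := fr.S_le_T
  have hk := fr.one_le
  have hn := fr.large
  have hBl := fr.two_mul_B_ge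
  rcases lt_or_ge n (2 * B.card) with hB | hB
  · exact exists_embedding_of_lt fr few hB
  rcases Nat.mod_two_eq_zero_or_one n with heven | hodd
  swap
  · exact exists_embedding_of_odd fr few hB hodd
  rcases Nat.eq_zero_or_pos S.card with hS | hS
  · exact exists_embedding_of_S_empty fr few hB heven hS
  obtain ⟨v, hv⟩ := Finset.card_pos.1 (show 0 < T.card by omega)
  by_cases hlt : 2 * (A.card + S.card) < n
  -- If `2 * |B| = n`, an edge from `T` to `B` would leave too few vertices at turns to compensate
  -- `|B| - |A| = |S| + |T|`. But then there are `2 * |T|` disjoint edges, of which at most `|T|`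
  -- start in `T`.
  · by_cases hBn : 2 * B.card = n
    · obtain ⟨M, hMc, hM, hMd⟩ := fr.exists_disjoint_edges (by omega) (B ∪ T) subset_rfl
        (n - 2 * (A.card + S.card)) (fun y _ => by have := fr.card_in_BT y; omega)
      obtain ⟨r, hr, hrB⟩ : ∃ r ∈ M, r.1 ∈ B := by
        by_contra hcon
        push Not at hcon
        have : M.card ≤ T.card := by
          refine Finset.card_le_card_of_injOn Prod.fst (fun r hr => ?_) fun r hr r' hr' h => ?_
          · exact (Finset.mem_union.1 (hM r hr).1).resolve_left (hcon r hr)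
          · by_contra hne
            exact (hMd r hr r' hr' hne).1 h
        omega
      exact exists_embedding_of_adj_B fr few hth hB heven hrB (hM r hr).2.1 hv (hM r hr).2.2
        (by omega)
    · obtain ⟨y, hy⟩ := Finset.card_pos.1 (show 0 < B.card by omega)
      obtain ⟨x, hx, hxy⟩ := fr.exists_adj_of_lt y hlt
      by_cases hxB : x ∈ B
      · exact exists_embedding_of_adj_B fr few hth hB heven hxB hy hv hxy (by omega)
      -- If `|T| = 1`, then `|S| = 1`, hence `|A| < |B|`, against `2 * |B| + 2 ≤ n`.
      · obtain ⟨w, hw, hwx⟩ := Finset.exists_mem_ne (show 1 < T.card by omega) x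
        exact exists_embedding_of_adj_BT fr few hth (by omega) heven hxy
          (Or.inl ⟨hx.resolve_left hxB, hy⟩) hw hwx
  -- Here `|A| = |B|` and `|S| = |T|`.
  · obtain ⟨y, hy⟩ := Finset.card_pos.1 hS
    obtain ⟨x, hx, hxy⟩ := fr.exists_adj_of_mem_S hy (by omega)
    by_cases hxB : x ∈ B
    · refine exists_embedding_of_adj_BT fr few hth (by omega) heven hxy (Or.inr ⟨hxB, hy⟩) hv ?_
      rintro rfl
      exact (fr.notMem_of_mem_T hv).2.1 hxB
    · have hxT := hx.resolve_left hxB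
      rcases Nat.lt_or_ge 1 T.card with hT | hT
      · obtain ⟨w, hw, hwx⟩ := Finset.exists_mem_ne hT x
        exact exists_embedding_of_adj_TS fr few hth heven (by omega) (by omega) hxy hxT hy hw hwx
      · exact exists_embedding_of_crossing fr heven (by omega) (by omega) (by omega) hxT hy hxy
          (exists_source_through hth (by omega))

end Edges

/-! ### Cycles with many through positions. -/

noncomputable section ManyThrough

open scoped Classical

variable {V : Type*} {n k : ℕ} {G : Digraph V} {A B S T : Finset V} {e : ZMod n → Bool}

theorem exists_card_filter_lt_eq (X : Finset ℕ) {m : ℕ} (hm : m ≤ X.card) :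
    ∃ w, (X.filter fun p => p < w).card = m := by
  have hex : ∃ w, m ≤ (X.filter fun p => p < w).card := by
    refine ⟨X.sup id + 1, ?_⟩
    rwa [Finset.filter_true_of_mem]
    exact fun p hp => Nat.lt_succ_of_le (Finset.le_sup (f := id) hp)
  refine ⟨Nat.find hex, le_antisymm ?_ (Nat.find_spec hex)⟩
  rcases Nat.eq_zero_or_pos (Nat.find hex) with h | h
  · rw [h]
    simp
  · have h1 := Nat.find_min hex (Nat.sub_lt h one_pos)
    have h2 : (X.filter fun p => p < Nat.find hex) ⊆
        insert (Nat.find hex - 1) (X.filter fun p => p < Nat.find hex - 1) := by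
      intro p hp
      rw [Finset.mem_filter] at hp
      rw [Finset.mem_insert, Finset.mem_filter]
      by_cases hpw : p = Nat.find hex - 1
      · exact Or.inl hpw
      · exact Or.inr ⟨hp.1, by omega⟩
    have h3 := (Finset.card_le_card h2).trans (Finset.card_insert_le _ _)
    omega

/-- Well separated pairs of consecutive elements of a large set of natural numbers. -/
theorem exists_consecutive (X : Finset ℕ) (m : ℕ) (hm : 10 * m ≤ X.card) :
    ∃ l u : ℕ → ℕ, (∀ b b', b < b' → b' < m → u b + 6 ≤ l b') ∧
      ∀ b < m, l b ∈ X ∧ u b ∈ X ∧ l b < u b ∧ ∀ p, l b < p → p < u b → p ∉ X := by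
  let q := X.orderEmbOfFin rfl
  let f : ℕ → ℕ := fun i => if h : i < X.card then q ⟨i, h⟩ else 0
  have hf : ∀ i j, i < j → j < X.card → f i < f j := fun i j hij hj => by
    simp only [f, hj, hij.trans hj, dif_pos]
    exact q.strictMono hij
  have hmem : ∀ i < X.card, f i ∈ X := fun i hi => by
    simp only [f, hi, dif_pos]
    exact X.orderEmbOfFin_mem rfl _
  have hgap : ∀ d i, i + d < X.card → f i + d ≤ f (i + d) := by
    intro d
    induction d with
    | zero => simp
    | succ d ih =>
      intro i hi
      have h1 := ih i (by omega)
      have h2 := hf (i + d) (i + (d + 1)) (by omega) hi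
      omega
  -- Entries `10 * b` and `10 * b + 1` of the increasing enumeration; from one pair to the next the
  -- index rises by nine, which gives the separation.
  refine ⟨fun b => f (10 * b), fun b => f (10 * b + 1), ?_, ?_⟩
  · intro b b' hb hb'
    have := hgap (10 * b' - (10 * b + 1)) (10 * b + 1) (by omega)
    rw [show 10 * b + 1 + (10 * b' - (10 * b + 1)) = 10 * b' by omega] at this
    show f (10 * b + 1) + 6 ≤ f (10 * b')
    omega
  · intro b hb
    refine ⟨hmem _ (by omega), hmem _ (by omega), hf _ _ (by omega) (by omega), ?_⟩
    intro p hp hp' hpX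
    have : p ∈ Set.range q := by
      rw [Finset.range_orderEmbOfFin]
      exact hpX
    obtain ⟨⟨i, hi⟩, rfl⟩ := this
    have hfi : f i = q ⟨i, hi⟩ := by simp [f, hi]
    rw [← hfi] at hp hp'
    beta_reduce at hp hp'
    rcases Nat.lt_or_ge (10 * b) i with h | h
    · rcases Nat.eq_or_lt_of_le (Nat.succ_le_of_lt h) with h' | h'
      · simp only [← h'] at hp'
        exact lt_irrefl _ hp'
      · have := hf (10 * b + 1) i h' hi
        omega
    · rcases Nat.eq_or_lt_of_le h with h' | h'
      · rw [h'] at hp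
        exact lt_irrefl _ hp
      · have := hf i (10 * b) h' (by omega)
        omega

/-- The parities of consecutive through positions, relative to the directions there, differ. -/
theorem xor_parity_of_consecutive {p p' : ℕ} (hlt : p < p')
    (hturn : ∀ i, p < i → i < p' → e ((i : ZMod n) - 1) = !e i)
    (hthrough : e ((p' : ZMod n) - 1) = e p') :
    xor (e p') (decide (p' % 2 = 1)) = !xor (e p) (decide (p % 2 = 1)) := by
  have h : ∀ d, p + d < p' → e ((p + d : ℕ) : ZMod n) = xor (e p) (decide (d % 2 = 1)) := by
    intro d
    induction d with
    | zero => simp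
    | succ d ih =>
      intro hd
      have h1 := ih (by omega)
      have h2 := hturn (p + (d + 1)) (by omega) hd
      rw [show ((p + (d + 1) : ℕ) : ZMod n) - 1 = ((p + d : ℕ) : ZMod n) by push_cast; ring,
        h1] at h2
      rcases Nat.mod_two_eq_zero_or_one d with h3 | h3
      · rw [show decide ((d + 1) % 2 = 1) = true by simp; omega]
        simp only [h3] at h2
        simp only [zero_ne_one, decide_false, Bool.xor_false] at h2
        simp [h2]
      · rw [show decide ((d + 1) % 2 = 1) = false by simp; omega]
        simp only [h3, decide_true, Bool.xor_true] at h2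
        rw [Bool.xor_false]
        exact (Bool.not_inj h2).symm
  have h1 := h (p' - p - 1) (by omega)
  rw [show ((p + (p' - p - 1) : ℕ) : ZMod n) = (p' : ZMod n) - 1 by
    rw [show p + (p' - p - 1) = p' - 1 by omega, Nat.cast_sub (by omega), Nat.cast_one],
    hthrough] at h1
  rw [h1]
  rcases Nat.mod_two_eq_zero_or_one p with h2 | h2 <;>
    rcases Nat.mod_two_eq_zero_or_one p' with h3 | h3
  · simp [h2, h3, show (p' - p - 1) % 2 = 1 by omega]
  · simp [h2, h3, show (p' - p - 1) % 2 = 0 by omega]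
  · simp [h2, h3, show (p' - p - 1) % 2 = 0 by omega]
  · simp [h2, h3, show (p' - p - 1) % 2 = 1 by omega]

theorem role_eq_of_le {c : Bool} {P : Finset ℕ} {i w : ℕ} (hP : ∀ p ∈ P, w ≤ p) (hi : i ≤ w) :
    role c P i = xor c (decide (i % 2 = 1)) := by
  unfold role
  rw [Finset.filter_false_of_mem fun p hp => by have := hP p hp; omega, Finset.card_empty,
    add_zero]

/-- Many through positions provide many candidates for edges which start in `T`. -/
theorem exists_candidates (X : Finset ℕ) (hX : ∀ p ∈ X, 1 ≤ p ∧ p < n)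
    (hthrough : ∀ p ∈ X, e ((p : ZMod n) - 1) = e p) {m w : ℕ} (hm : 2 * m ≤ X.card)
    (hw : ∀ p ∈ X, p ≤ w) :
    ∃ c, ∃ cand : Finset (ZMod n), m ≤ cand.card ∧ ∀ P : Finset ℕ, (∀ p ∈ P, w ≤ p) →
      ∀ i ∈ cand, (e i = true ∧ e (i - 1) = true ∧ role c P i.val = true) ∨
        (e i = false ∧ e (i + 1) = false ∧ role c P i.val = false) := by
  -- Before the first flip the role depends on the parity alone, so one value of `c` gives role `A`
  -- to at least half of `X`.
  obtain ⟨c, hc⟩ : ∃ c, m ≤ (X.filter fun p => xor c (decide (p % 2 = 1)) = true).card := by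
    have h1 := Finset.card_filter_add_card_filter_not (s := X)
      fun p => xor true (decide (p % 2 = 1)) = true
    by_cases h : m ≤ (X.filter fun p => xor true (decide (p % 2 = 1)) = true).card
    · exact ⟨true, h⟩
    · refine ⟨false, ?_⟩
      have h2 : (X.filter fun p => ¬ xor true (decide (p % 2 = 1)) = true) =
          X.filter fun p => xor false (decide (p % 2 = 1)) = true := by
        refine Finset.filter_congr fun p _ => ?_
        cases decide (p % 2 = 1) <;> simp
      rw [h2] at h1
      omega
  -- The start of the edge is chosen so that its end in `T` lies on the through position `p`.
  let g : ℕ → ℕ := fun p => if e p = true then p else p - 1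
  have hval : ∀ p < n, ((p : ℕ) : ZMod n).val = p := fun p hp => ZMod.val_cast_of_lt hp
  have hg : ∀ p ∈ X, g p < n := fun p hp => by
    have := hX p hp
    show (if e p = true then p else p - 1) < n
    split_ifs <;> omega
  refine ⟨c, (X.filter fun p => xor c (decide (p % 2 = 1)) = true).image
    fun p => ((g p : ℕ) : ZMod n), ?_, ?_⟩
  · rwa [Finset.card_image_of_injOn]
    intro p hp p' hp' h
    obtain ⟨h1, h2⟩ := Finset.mem_filter.1 (Finset.mem_coe.1 hp)
    obtain ⟨h1', h2'⟩ := Finset.mem_filter.1 (Finset.mem_coe.1 hp')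
    have h3 : g p = g p' := by
      have := congrArg ZMod.val h
      simpa only [hval _ (hg p h1), hval _ (hg p' h1')] using this
    -- `g` moves a position by at most one, so it is injective on positions of equal parity.
    have h4 : decide (p % 2 = 1) = decide (p' % 2 = 1) := by
      cases c <;> simp_all
    rw [decide_eq_decide] at h4
    have := hX p h1
    have := hX p' h1'
    simp only [g] at h3
    split_ifs at h3 <;> omega
  · intro P hP i hi
    obtain ⟨p, hp, rfl⟩ := Finset.mem_image.1 hi
    obtain ⟨h1, h2⟩ := Finset.mem_filter.1 hp
    have h3 := hX p h1
    have h4 := hthrough p h1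
    rw [hval _ (hg p h1)]
    by_cases he : e p = true
    · have h5 : g p = p := if_pos he
      rw [h5]
      refine Or.inl ⟨he, by rw [h4, he], ?_⟩
      rw [role_eq_of_le hP (hw p h1), h2]
    · have h5 : g p = p - 1 := if_neg he
      have h6 : e p = false := by simpa using he
      have h7 := hw p h1
      rw [h5]
      refine Or.inr ⟨?_, ?_, ?_⟩
      · rw [Nat.cast_sub h3.1, Nat.cast_one, h4, h6]
      · rw [Nat.cast_sub h3.1, Nat.cast_one, sub_add_cancel, h6]
      · have h8 := role_succ c P (p - 1)
        have h9 : p - 1 ∉ P := fun h => by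
          have := hP _ h
          omega
        rw [show p - 1 + 1 = p by omega, role_eq_of_le hP h7, h2] at h8
        simpa [h9] using h8

-- The `|B| - |A|` disjoint edges from `B ∪ T` to `B` have charge `-1` each. Those starting in `T`
-- are placed without a flip, those inside `B` and the uncovered vertices of `S ∪ T` as flips. The
-- number of flips is `|S| + |T| + |B| - |A|` minus twice the number of edges from `T`, hence of the
-- parity of `n`.
set_option maxHeartbeats 1000000 in
theorem exists_embedding_of_many [Fintype V] [NeZero n] (fr : Frame G n k A B S T)
    (many : n < 1000 * (Finset.univ.filter fun i => e (i - 1) = e i).card) :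
    ∃ f : ZMod n → V, Function.Injective f ∧ ∀ i, G.Arc (e i) (f i) (f (i + 1)) := by
  have hcard := fr.card_add
  have hAB := fr.A_le_B
  have hST := fr.S_le_T
  have hk := fr.one_le
  have hn := fr.large
  have hBk := fr.B_le
  have hSTk := fr.ST_le
  -- disjoint edges from `B ∪ T` to `B`
  obtain ⟨M, hMc, hM, hMd⟩ : ∃ M : Finset (V × V), M.card = B.card - A.card ∧
      (∀ r ∈ M, r.1 ∈ B ∪ T ∧ r.2 ∈ B ∧ G.Adj r.1 r.2) ∧
      ∀ r ∈ M, ∀ r' ∈ M, r ≠ r' → r.1 ≠ r'.1 ∧ r.1 ≠ r'.2 ∧ r.2 ≠ r'.1 ∧ r.2 ≠ r'.2 := by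
    rcases hAB.eq_or_lt with h | h
    · exact ⟨∅, by simp; omega, by simp, by simp⟩
    · refine fr.exists_disjoint_edges h (B ∪ T) le_rfl _ fun y _ => ?_
      have := fr.card_in_BT y
      omega
  let MT := M.filter fun r => r.1 ∈ T
  let MB := M.filter fun r => ¬ r.1 ∈ T
  have hMTB : MT.card + MB.card = M.card := Finset.card_filter_add_card_filter_not _
  let U := (S ∪ T) \ MT.image Prod.fst
  have hMTsub : MT.image Prod.fst ⊆ S ∪ T := by
    intro v hv
    obtain ⟨r, hr, rfl⟩ := Finset.mem_image.1 hv
    exact Finset.mem_union_right _ (Finset.mem_filter.1 hr).2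
  have hMTc : (MT.image Prod.fst).card = MT.card := Finset.card_image_of_injOn fun r hr r' hr' h => by
    by_contra hne
    exact (hMd r (Finset.mem_filter.1 hr).1 r' (Finset.mem_filter.1 hr').1 hne).1 h
  have hUc : U.card + MT.card = S.card + T.card := by
    rw [← Finset.card_union_of_disjoint fr.disjoint_ST, ← hMTc]
    exact Finset.card_sdiff_add_card_eq_card hMTsub
  let JF : Finset (V ⊕ V × V) := U.image Sum.inl ∪ MB.image Sum.inr
  let JN : Finset (V ⊕ V × V) := MT.image Sum.inr
  have hJNc : JN.card = MT.card := Finset.card_image_of_injective _ Sum.inr_injective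
  have hJFc : JF.card = U.card + MB.card := by
    rw [Finset.card_union_of_disjoint, Finset.card_image_of_injective _ Sum.inl_injective,
      Finset.card_image_of_injective _ Sum.inr_injective]
    rw [Finset.disjoint_left]
    intro j hj hj'
    obtain ⟨v, -, rfl⟩ := Finset.mem_image.1 hj
    obtain ⟨r, -, h⟩ := Finset.mem_image.1 hj'
    simp at h
  have hJF : ∀ j ∈ JF, (∃ v, (v ∈ S ∨ v ∈ T) ∧ j = Sum.inl v) ∨
      ∃ x y, x ∈ B ∧ y ∈ B ∧ G.Adj x y ∧ j = Sum.inr (x, y) := by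
    intro j hj
    rcases Finset.mem_union.1 hj with hj | hj
    · obtain ⟨v, hv, rfl⟩ := Finset.mem_image.1 hj
      exact Or.inl ⟨v, Finset.mem_union.1 (Finset.mem_sdiff.1 hv).1, rfl⟩
    · obtain ⟨⟨x, y⟩, hr, rfl⟩ := Finset.mem_image.1 hj
      obtain ⟨h1, h2⟩ := Finset.mem_filter.1 hr
      obtain ⟨h3, h4, h5⟩ := hM _ h1
      exact Or.inr ⟨x, y, (Finset.mem_union.1 h3).resolve_right h2, h4, h5, rfl⟩
  -- through positions
  let X := (Finset.Ico 10 (n - 10)).filter fun p : ℕ => e ((p : ZMod n) - 1) = e p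
  have hXmem : ∀ p ∈ X, 10 ≤ p ∧ p < n - 10 ∧ e ((p : ZMod n) - 1) = e p := fun p hp => by
    obtain ⟨h1, h2⟩ := Finset.mem_filter.1 hp
    rw [Finset.mem_Ico] at h1
    exact ⟨h1.1, h1.2, h2⟩
  have hXc : 200 * k ≤ X.card := by
    have h1 : (Finset.univ.filter fun i : ZMod n => e (i - 1) = e i).image ZMod.val ⊆
        X ∪ (Finset.range 10 ∪ Finset.Ico (n - 10) n) := by
      intro p hp
      obtain ⟨i, hi, rfl⟩ := Finset.mem_image.1 hp
      have h2 := ZMod.val_lt i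
      simp only [X, Finset.mem_union, Finset.mem_filter, Finset.mem_Ico, Finset.mem_range,
        ZMod.natCast_zmod_val]
      have h3 := (Finset.mem_filter.1 hi).2
      by_cases h4 : i.val < 10
      · exact Or.inr (Or.inl h4)
      · by_cases h5 : i.val < n - 10
        · exact Or.inl ⟨⟨by omega, h5⟩, h3⟩
        · exact Or.inr (Or.inr ⟨by omega, h2⟩)
    have h2 := (Finset.card_le_card h1).trans ((Finset.card_union_le _ _).trans
      (Nat.add_le_add_left (Finset.card_union_le _ _) _))
    rw [Finset.card_image_of_injective _ (ZMod.val_injective n), Finset.card_range,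
      Nat.card_Ico] at h2
    omega
  -- The first `130 * k` through positions serve the edges from `T`; all flips come later, so roles
  -- there depend only on `c`. At least `70 * k` remain, ten for each of the at most `2 * k` flips.
  obtain ⟨w, hw⟩ := exists_card_filter_lt_eq X (m := 130 * k) (by omega)
  obtain ⟨c, cand, hcandc, hcand⟩ := exists_candidates (e := e) (X.filter fun p => p < w) (m := 60 * k)
    (w := w)
    (fun p hp => by
      have := hXmem p (Finset.mem_filter.1 hp).1
      omega)
    (fun p hp => (hXmem p (Finset.mem_filter.1 hp).1).2.2) (by omega)
    (fun p hp => (Finset.mem_filter.1 hp).2.le)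
  have hX' := Finset.card_filter_add_card_filter_not (s := X) fun p => p < w
  obtain ⟨l, u, hlu, hX⟩ := exists_consecutive (X.filter fun p => ¬ p < w) JF.card (by omega)
  have hXl : ∀ p ∈ X.filter fun p => ¬ p < w,
      w ≤ p ∧ 10 ≤ p ∧ p < n - 10 ∧ e ((p : ZMod n) - 1) = e p := fun p hp =>
    ⟨not_lt.1 (Finset.mem_filter.1 hp).2, hXmem p (Finset.mem_filter.1 hp).1⟩
  let κ : V ⊕ V × V → ℤ := fun j => if j.isRight = true then -1 else 0
  obtain ⟨q, hq1, hq2, hq3⟩ := exists_positions JF c l u hlu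
    (fun j p r => Fits G n A B e r j p true ∧ charge A B r true j = κ j) (by
      intro j hj b hb r
      obtain ⟨h1, h2, h3, h4⟩ := hX b hb
      obtain ⟨hl1, hl2, hl3, hl4⟩ := hXl _ h1
      obtain ⟨hu1, hu2, hu3, hu4⟩ := hXl _ h2
      rcases hJF j hj with ⟨v, hv, rfl⟩ | ⟨x, y, hx, hy, hxy, rfl⟩
      -- The vertex `v` needs one particular parity relative to the direction. Consecutive through
      -- positions have opposite ones, so an end of the window is suitable.
      · have h5 := xor_parity_of_consecutive (e := e) h3 (fun i hi hi' => by
          have h6 := h4 i hi hi'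
          rw [Finset.mem_filter, not_and] at h6
          have h7 : i ∉ X := fun h => h6 h (by omega)
          rw [Finset.mem_filter, Finset.mem_Ico, not_and] at h7
          have h8 := h7 (by omega)
          cases h9 : e ((i : ZMod n) - 1) <;> cases h10 : e (i : ZMod n) <;> simp_all) hu4
        have hw : weight A B v = 0 := hv.elim fr.weight_S fr.weight_T
        have hcharge : ∀ r, charge A B r true (Sum.inl v) = κ (Sum.inl v) := by
          simp [charge, κ, hw]
        obtain ⟨d, hd⟩ : ∃ d, (v ∈ S ∧ d = true) ∨ (v ∈ T ∧ d = false) := by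
          rcases hv with h | h
          · exact ⟨true, Or.inl ⟨h, rfl⟩⟩
          · exact ⟨false, Or.inr ⟨h, rfl⟩⟩
        have hfit : ∀ p : ℕ, e ((p : ZMod n) - 1) = e p →
            xor (e p) (decide (p % 2 = 1)) = xor r d →
            Fits G n A B e (xor r (decide (p % 2 = 1))) (Sum.inl v) p true := by
          intro p hp hpr
          refine fits_through fr hp ?_
          rcases hd with ⟨hv, rfl⟩ | ⟨hv, rfl⟩
          · refine Or.inl ⟨hv, ?_⟩
            revert hpr
            cases e p <;> cases r <;> cases decide (p % 2 = 1) <;> simp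
          · refine Or.inr ⟨hv, ?_⟩
            revert hpr
            cases e p <;> cases r <;> cases decide (p % 2 = 1) <;> simp
        by_cases h : xor (e (l b)) (decide (l b % 2 = 1)) = xor r d
        · exact ⟨l b, le_rfl, h3.le, hfit _ hl4 h, hcharge _⟩
        · refine ⟨u b, h3.le, le_rfl, hfit _ hu4 ?_, hcharge _⟩
          rw [h5]
          revert h
          cases xor (e (l b)) (decide (l b % 2 = 1)) <;> cases xor r d <;> simp
      · obtain ⟨p, hp1, hp2, hp⟩ : ∃ p, l b ≤ p ∧ p ≤ u b ∧
            xor r (decide (p % 2 = 1)) = false := by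
          by_cases h : xor r (decide (l b % 2 = 1)) = false
          · exact ⟨l b, le_rfl, h3.le, h⟩
          · refine ⟨l b + 1, by omega, by omega, ?_⟩
            rcases Nat.mod_two_eq_zero_or_one (l b) with h5 | h5
            · have h6 : (l b + 1) % 2 = 1 := by omega
              simpa [h5, h6] using h
            · have h6 : (l b + 1) % 2 = 0 := by omega
              simpa [h5, h6] using h
        refine ⟨p, hp1, hp2, ?_⟩
        simp only [hp]
        refine ⟨fits_edge fr hxy hx hy, ?_⟩
        simp [charge, κ, sgn, fr.weight_B hx, fr.weight_B hy])
  have hqw : ∀ p ∈ JF.image q, w ≤ p := by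
    intro p hp
    obtain ⟨j, hj, rfl⟩ := Finset.mem_image.1 hp
    obtain ⟨b, hb, h1, -⟩ := hq1 j hj
    have := (hXl _ (hX b hb).1).1
    omega
  have hmemJ : ∀ j, j ∈ JF ∪ JN ↔ (∃ v ∈ U, j = Sum.inl v) ∨ ∃ r ∈ M, j = Sum.inr r := by
    intro j
    simp only [JF, JN, MB, MT, Finset.mem_union, Finset.mem_image, Finset.mem_filter]
    constructor
    · rintro ((⟨v, h, rfl⟩ | ⟨r, h, rfl⟩) | ⟨r, h, rfl⟩)
      · exact Or.inl ⟨v, h, rfl⟩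
      · exact Or.inr ⟨r, h.1, rfl⟩
      · exact Or.inr ⟨r, h.1, rfl⟩
    · rintro (⟨v, h, rfl⟩ | ⟨r, h, rfl⟩)
      · exact Or.inl (Or.inl ⟨v, h, rfl⟩)
      · by_cases hr : r.1 ∈ T
        · exact Or.inr ⟨r, ⟨h, hr⟩, rfl⟩
        · exact Or.inl (Or.inr ⟨r, ⟨h, hr⟩, rfl⟩)
  have hverts : ∀ z r, z ∈ verts (Sum.inr r : V ⊕ V × V) ↔ z = r.1 ∨ z = r.2 := by
    intro z r
    simp [verts, first, second]
  have hverts' : ∀ z v, z ∈ verts (Sum.inl v : V ⊕ V × V) ↔ z = v := by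
    intro z v
    simp [verts, first, second]
  have hUM : ∀ v ∈ U, ∀ r ∈ M, v ≠ r.1 ∧ v ≠ r.2 := by
    intro v hv r hr
    obtain ⟨h1, h2⟩ := Finset.mem_sdiff.1 hv
    have hvB : v ∉ B := by
      rcases Finset.mem_union.1 h1 with h | h
      · exact (fr.notMem_of_mem_S h).2.1
      · exact (fr.notMem_of_mem_T h).2.1
    obtain ⟨h3, h4, -⟩ := hM r hr
    refine ⟨?_, fun h => hvB (h ▸ h4)⟩
    rintro rfl
    have h5 := (Finset.mem_union.1 h3).resolve_left hvB
    exact h2 (Finset.mem_image_of_mem _ (Finset.mem_filter.2 ⟨hr, h5⟩))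
  have hcover : ∀ x, x ∈ S ∪ T → ∃ j ∈ JF ∪ JN, x ∈ verts j := by
    intro x hx
    by_cases h : x ∈ MT.image Prod.fst
    · obtain ⟨r, hr, rfl⟩ := Finset.mem_image.1 h
      exact ⟨Sum.inr r, (hmemJ _).2 (Or.inr ⟨r, (Finset.mem_filter.1 hr).1, rfl⟩),
        (hverts _ _).2 (Or.inl rfl)⟩
    · exact ⟨Sum.inl x, (hmemJ _).2 (Or.inl ⟨x, Finset.mem_sdiff.2 ⟨hx, h⟩, rfl⟩),
        (hverts' _ _).2 rfl⟩
  refine exists_embedding_of_flips fr c JF JN q (fun _ => cand) κ (by omega) hq3 ?_ ?_ ?_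
    (fun j hj => (hq2 j hj).1) ?_ (fun _ _ => hcandc)
    (fun x hx => hcover x (Finset.mem_union_left _ hx))
    (fun x hx => hcover x (Finset.mem_union_right _ hx)) (by omega) ?_
  · intro j hj
    obtain ⟨b, hb, -, h1⟩ := hq1 j hj
    have := hXl _ (hX b hb).2.1
    omega
  · intro j hj j' hj' x hx hx'
    rcases (hmemJ j).1 hj with ⟨v, hv, rfl⟩ | ⟨r, hr, rfl⟩ <;>
      rcases (hmemJ j').1 hj' with ⟨v', hv', rfl⟩ | ⟨r', hr', rfl⟩
    · rw [hverts'] at hx hx'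
      rw [← hx, ← hx']
    · rw [hverts'] at hx
      rw [hverts, hx] at hx'
      have := hUM v hv r' hr'
      tauto
    · rw [hverts'] at hx'
      rw [hverts, hx'] at hx
      have := hUM v' hv' r hr
      tauto
    · by_contra hne
      have := hMd r hr r' hr' fun h => hne (by rw [h])
      rw [hverts] at hx hx'
      rcases hx with rfl | rfl <;> tauto
  · rw [Finset.disjoint_left]
    intro j hj hj'
    obtain ⟨r, hr, rfl⟩ := Finset.mem_image.1 hj'
    rcases hJF _ hj with ⟨v, -, h⟩ | ⟨x, y, hx, -, -, h⟩
    · simp at h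
    · have h1 := (Finset.mem_filter.1 hr).2
      rw [Sum.inr_injective h] at h1
      exact (fr.notMem_of_mem_T h1).2.1 hx
  · intro j hj i hi
    obtain ⟨⟨x, y⟩, hr, rfl⟩ := Finset.mem_image.1 hj
    obtain ⟨h1, h2⟩ := Finset.mem_filter.1 hr
    obtain ⟨-, h4, h5⟩ := hM _ h1
    refine ⟨fits_alternating fr h5 h2 h4 (hcand _ hqw i hi), ?_⟩
    simp [charge, κ, fr.weight_T h2, fr.weight_B h4]
  · rw [Finset.sum_congr rfl fun j hj => (hq2 j hj).2]
    have h1 : ∑ j ∈ JF, κ j = -MB.card := by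
      rw [Finset.sum_union]
      · rw [Finset.sum_image fun _ _ _ _ h => Sum.inl_injective h,
          Finset.sum_image fun _ _ _ _ h => Sum.inr_injective h]
        simp [κ]
      · rw [Finset.disjoint_left]
        intro j hj hj'
        obtain ⟨v, -, rfl⟩ := Finset.mem_image.1 hj
        obtain ⟨r, -, h⟩ := Finset.mem_image.1 hj'
        simp at h
    have h2 : ∑ j ∈ JN, κ j = -MT.card := by
      rw [Finset.sum_image fun _ _ _ _ h => Sum.inr_injective h]
      simp [κ]
    rw [h1, h2]
    omega

end ManyThrough

/-! ### From the given definitions to directions along the cycle and integer error terms. -/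

noncomputable section Extremal

open scoped Classical

theorem Arc_true {V : Type*} {G : Digraph V} {x y : V} : G.Arc true x y ↔ G.Adj x y := by
  simp [Arc]

theorem Arc_false {V : Type*} {G : Digraph V} {x y : V} : G.Arc false x y ↔ G.Adj y x := by
  simp [Arc]

/-- An oriented cycle is given by the directions of its edges along the cycle. -/
theorem IsOrientedCycle.exists_directions {W : Type*} {C : Digraph W} {n : ℕ}
    (hC : C.IsOrientedCycle n) :
    ∃ (φ : W ≃ ZMod n) (e : ZMod n → Bool),
      (∀ u v, C.Adj u v → (e (φ u) = true ∧ φ v = φ u + 1) ∨ (e (φ v) = false ∧ φ u = φ v + 1)) ∧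
      (¬ C.IsAntidirected → ∃ i, e (i - 1) = e i) := by
  obtain ⟨h3, hasymm, ⟨ψ⟩⟩ := hC
  obtain ⟨m, rfl⟩ : ∃ m, n = m + 2 := ⟨n - 2, by omega⟩
  let φ : W ≃ ZMod (m + 2) := ψ.toEquiv
  have hφ : ∀ u v, C.Adj u v → φ v = φ u + 1 ∨ φ u = φ v + 1 := by
    intro u v huv
    have hne : u ≠ v := by
      rintro rfl
      exact hasymm _ _ huv huv
    have h1 : C.toSimpleGraphInclusive.Adj u v := by
      simp [toSimpleGraphInclusive, hne, huv]
    have h2 : φ u - φ v = 1 ∨ φ v - φ u = 1 := SimpleGraph.cycleGraph_adj.1 (ψ.map_adj_iff.2 h1)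
    rcases h2 with h | h
    · exact Or.inr (by rw [← h]; ring)
    · exact Or.inl (by rw [← h]; ring)
  let e : ZMod (m + 2) → Bool := fun i => decide (C.Adj (φ.symm i) (φ.symm (i + 1)))
  have he : ∀ u v, C.Adj u v → (e (φ u) = true ∧ φ v = φ u + 1) ∨
      (e (φ v) = false ∧ φ u = φ v + 1) := by
    intro u v huv
    rcases hφ u v huv with h | h
    · refine Or.inl ⟨?_, h⟩
      simp only [e, ← h, Equiv.symm_apply_apply, huv, decide_true]
    · refine Or.inr ⟨?_, h⟩
      simp only [e, ← h, Equiv.symm_apply_apply, hasymm u v huv, decide_false]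
  refine ⟨φ, e, he, fun hanti => ?_⟩
  obtain ⟨x, y, z, hxy, hyz, hxz, h1, h2⟩ := not_not.1 hanti
  rcases he x y h1 with ⟨h4, h5⟩ | ⟨h4, h5⟩ <;> rcases he y z h2 with ⟨h6, h7⟩ | ⟨h6, h7⟩
  · exact ⟨φ y, by rw [h6, h5, add_sub_cancel_right, h4]⟩
  -- In the two mixed cases `x` and `z` would lie on the same side of `y` and coincide.
  · exact (hxz (φ.injective (add_right_cancel (h5.symm.trans h7)))).elim
  · exact (hxz (φ.injective (h5.trans h7.symm))).elim
  · exact ⟨φ y, by rw [h4, h7, add_sub_cancel_right, h6]⟩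

variable {V : Type*} {G : Digraph V}

theorem le_degree_of_le_minSemidegree [Fintype V] {d : ℝ} (h : d ≤ G.minSemidegree) (x : V) :
    d ≤ G.outDegree x ∧ d ≤ G.inDegree x := by
  have h1 : G.minSemidegree ≤ min (G.outDegree x) (G.inDegree x) :=
    ciInf_le (OrderBot.bddBelow _) x
  have h2 := h1.trans (min_le_left _ _)
  have h3 := h1.trans (min_le_right _ _)
  constructor
  · exact h.trans (by exact_mod_cast h2)
  · exact h.trans (by exact_mod_cast h3)

theorem le_degreeIn_of_le_minSemidegree_between {A B : Finset V} {d : ℝ} (hAB : Disjoint A B)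
    (h : d ≤ (G.between A B).minSemidegree) :
    (∀ x ∈ A, d ≤ G.outDegreeIn B x ∧ d ≤ G.inDegreeIn B x) ∧
      ∀ x ∈ B, d ≤ G.outDegreeIn A x ∧ d ≤ G.inDegreeIn A x := by
  have key : ∀ (X : Finset V) (P : V → Prop) (Q : {x : V // x ∈ A ∪ B} → Prop),
      (∀ y, Q y → y.1 ∈ X ∧ P y.1) →
      (((Finset.univ.filter Q).card : ℕ) : ℝ) ≤ (((X.filter P).card : ℕ) : ℝ) := by
    intro X P Q hQ
    rw [← Finset.card_image_of_injective _ Subtype.val_injective]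
    have hsub : (Finset.univ.filter Q).image Subtype.val ⊆ X.filter P := by
      intro y hy
      obtain ⟨z, hz, rfl⟩ := Finset.mem_image.1 hy
      exact Finset.mem_filter.2 (hQ z (Finset.mem_filter.1 hz).2)
    exact_mod_cast Finset.card_le_card hsub
  constructor
  · intro x hx
    have hxB := Finset.disjoint_left.1 hAB hx
    have hx' := le_degree_of_le_minSemidegree h ⟨x, Finset.mem_union_left _ hx⟩
    refine ⟨hx'.1.trans (key _ _ _ ?_), hx'.2.trans (key _ _ _ ?_)⟩
    · rintro y ⟨h1, h2 | h2⟩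
      · exact ⟨h2.2, h1⟩
      · exact (hxB h2.1).elim
    · rintro y ⟨h1, h2 | h2⟩
      · exact (hxB h2.2).elim
      · exact ⟨h2.1, h1⟩
  · intro x hx
    have hxA := Finset.disjoint_right.1 hAB hx
    have hx' := le_degree_of_le_minSemidegree h ⟨x, Finset.mem_union_right _ hx⟩
    refine ⟨hx'.1.trans (key _ _ _ ?_), hx'.2.trans (key _ _ _ ?_)⟩
    · rintro y ⟨h1, h2 | h2⟩
      · exact (hxA h2.1).elim
      · exact ⟨h2.2, h1⟩
    · rintro y ⟨h1, h2 | h2⟩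
      · exact ⟨h2.1, h1⟩
      · exact (hxA h2.2).elim

theorem outDegreeIn_eq (X : Finset V) (x : V) :
    G.outDegreeIn X x = (X.filter fun y => G.Arc true x y).card := by
  simp only [outDegreeIn, Arc_true]

theorem inDegreeIn_eq (X : Finset V) (x : V) :
    G.inDegreeIn X x = (X.filter fun y => G.Arc false x y).card := by
  simp only [inDegreeIn, Arc_false]

/-- The bound `2 * ε * n + 3 ≤ k` absorbs two errors `ε * n` at once together with the roundings of
`n / 2`, as in `|B| - |A|` or the number of non-neighbours of a good vertex. -/
theorem IsABPartition.frame [Fintype V] {ε : ℝ} {A B S T : Finset V} (h : G.IsABPartition ε A B S T)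
    (hloop : G.Loopless) (hdeg : (Fintype.card V : ℝ) / 2 ≤ G.minSemidegree) {k : ℕ}
    (hk : 2 * ε * Fintype.card V + 3 ≤ k) (hε : 0 < ε) (hn : 1000000 * k ≤ Fintype.card V) :
    Frame G (Fintype.card V) k A B S T := by
  set n := Fintype.card V with hnV
  have hεn : 0 ≤ ε * n := by positivity
  have hfl : (n : ℝ) / 2 - 1 ≤ (⌊(n : ℝ) / 2⌋ : ℝ) := (Int.sub_one_lt_floor _).le
  have hce : (⌈(n : ℝ) / 2⌉ : ℝ) ≤ (n : ℝ) / 2 + 1 := (Int.ceil_lt_add_one _).le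
  have hA1 := h.card_A_lower
  have hA2 := h.card_A_upper
  have hB2 := h.card_B_upper
  have hST := h.card_S_add_card_T
  obtain ⟨hbA, hbB⟩ := le_degreeIn_of_le_minSemidegree_between h.disjoint_AB
    h.minSemidegree_between
  have hmany : ∀ {X : Finset V} {b x}, (n : ℝ) / 50 ≤ ((X.filter fun y => G.Arc b x y).card : ℝ) →
      n ≤ 50 * (X.filter fun y => G.Arc b x y).card := by
    intro X b x hX
    have : (n : ℝ) ≤ 50 * ((X.filter fun y => G.Arc b x y).card : ℝ) := by linarith
    exact_mod_cast this
  have hsmall : ∀ {X : Finset V} {b x}, ((X.filter fun y => G.Arc b x y).card : ℝ) < (n : ℝ) / 20 →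
      20 * (X.filter fun y => G.Arc b x y).card < n := by
    intro X b x hX
    have : 20 * ((X.filter fun y => G.Arc b x y).card : ℝ) < n := by linarith
    exact_mod_cast this
  have hgood : ∀ {X : Finset V} {b x}, (X.card : ℝ) ≤ (⌈(n : ℝ) / 2⌉ : ℝ) + ε * n →
      (n : ℝ) / 2 - ε * n ≤ ((X.filter fun y => G.Arc b x y).card : ℝ) →
      (X.filter fun y => ¬ G.Arc b x y).card ≤ k := by
    intro X b x hX hd
    have h1 := Finset.card_filter_add_card_filter_not (s := X) fun y => G.Arc b x y
    have h2 : ((X.filter fun y => G.Arc b x y).card : ℝ) +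
        ((X.filter fun y => ¬ G.Arc b x y).card : ℝ) = X.card := by exact_mod_cast h1
    have h3 : ((X.filter fun y => ¬ G.Arc b x y).card : ℝ) ≤ k := by linarith
    exact_mod_cast h3
  simp only [outDegreeIn_eq, inDegreeIn_eq] at hbA hbB
  refine
    { card_eq := rfl
      one_le := ?_
      large := hn
      loopless := hloop
      cover := ?_
      disjoint_AB := h.disjoint_AB
      disjoint_AS := h.disjoint_AS
      disjoint_AT := h.disjoint_AT
      disjoint_BS := h.disjoint_BS
      disjoint_BT := h.disjoint_BT
      disjoint_ST := h.disjoint_ST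
      A_le_B := h.card_A_le_card_B
      S_le_T := h.card_S_le_card_T
      B_le := ?_
      ST_le := ?_
      A_lower := ?_
      many_cls := ?_
      many_S := ?_
      many_T := ?_
      good := ?_
      degree := ?_
      unbalanced := ?_ }
  · have : (1 : ℝ) ≤ k := by linarith
    exact_mod_cast this
  · intro x
    have := Finset.mem_univ x
    rw [← h.cover] at this
    simpa only [Finset.mem_union, or_assoc] using this
  · have : (B.card : ℝ) ≤ A.card + k := by linarith
    exact_mod_cast this
  · have : ((S.card + T.card : ℕ) : ℝ) ≤ k := by linarith
    exact_mod_cast this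
  · have : (n : ℝ) ≤ 2 * A.card + 2 * k := by linarith
    exact_mod_cast this
  · intro c x hx b
    cases c <;> cases b
    · exact hmany (hbB x hx).2
    · exact hmany (hbB x hx).1
    · exact hmany (hbA x hx).2
    · exact hmany (hbA x hx).1
  · intro x hx b
    have := h.degree_S x hx
    simp only [outDegreeIn_eq, inDegreeIn_eq] at this
    cases b
    · exact hmany this.1
    · exact hmany this.2
  · intro x hx b
    have := h.degree_T x hx
    simp only [outDegreeIn_eq, inDegreeIn_eq] at this
    cases b
    · exact hmany this.1
    · exact hmany this.2
  · obtain ⟨ZA, hZA, hZA'⟩ : ∃ Z : Finset V, (Z.card : ℝ) ≤ ε * n ∧ ∀ x ∈ A, x ∉ Z →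
        (n : ℝ) / 2 - ε * n ≤ G.outDegreeIn B x ∧ (n : ℝ) / 2 - ε * n ≤ G.inDegreeIn B x :=
      ⟨_, h.almost_all_A, fun x hx hxZ => not_not.1 fun h => hxZ (Finset.mem_filter.2 ⟨hx, h⟩)⟩
    obtain ⟨ZB, hZB, hZB'⟩ : ∃ Z : Finset V, (Z.card : ℝ) ≤ ε * n ∧ ∀ x ∈ B, x ∉ Z →
        (n : ℝ) / 2 - ε * n ≤ G.outDegreeIn A x ∧ (n : ℝ) / 2 - ε * n ≤ G.inDegreeIn A x :=
      ⟨_, h.almost_all_B, fun x hx hxZ => not_not.1 fun h => hxZ (Finset.mem_filter.2 ⟨hx, h⟩)⟩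
    simp only [outDegreeIn_eq, inDegreeIn_eq] at hZA' hZB'
    refine ⟨ZA ∪ ZB, (Finset.card_union_le _ _).trans ?_, ?_⟩
    · have h3 : (ZA.card : ℝ) + ZB.card ≤ 2 * k := by linarith
      exact_mod_cast h3
    · intro c x hx hxZ b
      rw [Finset.mem_union, not_or] at hxZ
      cases c <;> cases b
      · exact hgood hA2 (hZB' x hx hxZ.2).2
      · exact hgood hA2 (hZB' x hx hxZ.2).1
      · exact hgood hB2 (hZA' x hx hxZ.1).2
      · exact hgood hB2 (hZA' x hx hxZ.1).1
  · intro x b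
    have h1 := le_degree_of_le_minSemidegree hdeg x
    simp only [outDegree, inDegree, outDegreeIn_eq, inDegreeIn_eq] at h1
    have h2 : (n : ℝ) / 2 ≤ ((Finset.univ.filter fun y => G.Arc b x y).card : ℝ) := by
      cases b
      · exact h1.2
      · exact h1.1
    have h3 : (n : ℝ) ≤ 2 * ((Finset.univ.filter fun y => G.Arc b x y).card : ℝ) := by linarith
    exact_mod_cast h3
  · intro hlt
    obtain ⟨h1, h2, h3⟩ := h.unbalanced hlt
    simp only [outDegreeIn_eq, inDegreeIn_eq] at h1 h2 h3
    refine ⟨fun x hx b => ?_, fun x hx => hsmall (h2 x hx), fun x hx => hsmall (h3 x hx)⟩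
    cases b
    · exact hsmall (h1 x hx).2
    · exact hsmall (h1 x hx).1

end Extremal
end Digraph

theorem mainTheorem3 :
    ∃ ε₀ : ℝ, 0 < ε₀ ∧ ∀ ε : ℝ, 0 < ε → ε ≤ ε₀ →
      ∃ n₀ : ℕ, ∀ n : ℕ, n₀ ≤ n →
        ∀ (V : Type*) [Fintype V] (G : Digraph V),
          Fintype.card V = n → G.Loopless →
          (n : ℝ) / 2 ≤ G.minSemidegree → G.IsABExtremal ε →
          ∀ (W : Type*) (C : Digraph W),
            C.IsOrientedCycle n → ¬ C.IsAntidirected → G.ContainsCopy C := by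
  -- With `k = ⌈2 * ε * n + 3⌉`, the number `1000000 * k` is at most `n / 5 + 4000000`, hence at
  -- most `n`. The threshold for `n` does not depend on `ε`.
  refine ⟨1 / 10000000, by norm_num, fun ε hε hε₀ => ⟨100000000, ?_⟩⟩
  intro n hn V _ G hV hloop hdeg hext W C hC hanti
  subst hV
  obtain ⟨A, B, S, T, hP⟩ := hext
  have hn' : (100000000 : ℝ) ≤ Fintype.card V := by exact_mod_cast hn
  have hceil := Nat.le_ceil (2 * ε * (Fintype.card V : ℝ) + 3)
  have hceil' := Nat.ceil_lt_add_one (a := 2 * ε * (Fintype.card V : ℝ) + 3) (by positivity)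
  have hεn : ε * (Fintype.card V : ℝ) ≤ 1 / 10000000 * (Fintype.card V : ℝ) := by gcongr
  have hlarge : 1000000 * ⌈2 * ε * (Fintype.card V : ℝ) + 3⌉₊ ≤ Fintype.card V := by
    have : 1000000 * (⌈2 * ε * (Fintype.card V : ℝ) + 3⌉₊ : ℝ) ≤ Fintype.card V := by linarith
    exact_mod_cast this
  have fr := hP.frame hloop hdeg hceil hε hlarge
  obtain ⟨φ, e, he, hth⟩ := hC.exists_directions
  have : NeZero (Fintype.card V) := ⟨by omega⟩
  obtain ⟨f, hf, hadj⟩ : ∃ f : ZMod (Fintype.card V) → V,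
      Function.Injective f ∧ ∀ i, G.Arc (e i) (f i) (f (i + 1)) := by
    classical
    by_cases h : 1000 * (Finset.univ.filter fun i => e (i - 1) = e i).card ≤ Fintype.card V
    · exact Digraph.exists_embedding_of_few fr (by convert h) (hth hanti)
    · exact Digraph.exists_embedding_of_many fr (by convert not_le.1 h)
  refine ⟨f ∘ φ, hf.comp φ.injective, fun u v huv => ?_⟩
  rcases he u v huv with ⟨h1, h2⟩ | ⟨h1, h2⟩
  · have := hadj (φ u)
    rw [h1, ← h2] at this
    simpa [Digraph.Arc] using this
  · have := hadj (φ v)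
    rw [h1, ← h2] at this
    simpa [Digraph.Arc] using this
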